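/- **Setting.** Let $\psi:\mathbb R\to\mathbb R$ satisfy: (A1) $\psi$ is uniformly continuous; (A2) $\psi<0$ on $(-\infty,0]$ and on $[1,\infty)$; (A3) $\max_{[0,1]}\psi>0$. Assume that $\psi$ is a *symmetric cone obstacle*: $\psi|_{(-\infty,1/2]}$ is affine and $\psi(x)=\psi(1-x)$ for all $x\in\mathbb R$. Let $A$ be the set of all curves $\gamma=(\gamma^1,\gamma^2)\in W^{2,2}(0,1;\mathbb R^2)$ with $\gamma'(x)\neq0$ for all $x\in[0,1]$, $\gamma(0)=(0,0)$, $\gamma(1)=(1,0)$ and $\gamma^2(x)\ge\psi(\gamma^1(x))$ for all $x\in[0,1]$, and let $$A_{\rm sym}:=\{\gamma\in A:\ \gamma(1-x)=(1-\gamma^1(x),\gamma^2(x))\ \text{ for all } x\in[0,1]\}.$$ For $\gamma\in A$ let $\partial_s f=f'/|\gamma'|$ be the arclength derivative, $L=\int_0^1|\gamma'|\,dx$ the length, $\tilde\gamma:[0,L]\to\mathbb R^2$ the arclength parametrization, $n$ the unit tangent $\partial_s\gamma$ rotated counterclockwise by $\pi/2$, $\kappa=\partial_s^2\gamma$ the curvature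 vector, $k=\langle\kappa,n\rangle$ the signed curvature as a function of arclength, and $B[\gamma]=\int_\gamma|\kappa|^2\,ds$ the bending energy. For $S\subseteq A$, a curve $\gamma\in S$ is a *local minimizer* of $B$ in $S$ if there is $\varepsilon>0$ with $B[\gamma]\le B[\eta]$ for all $\eta\in S$ with $\|\eta-\gamma\|_{W^{2,2}(0,1)}<\varepsilon$, and a *global minimizer* if $B[\gamma]\le B[\eta]$ for all $\eta\in S$. A *symmetric cut-and-glued free-elastica* is a curve $\gamma\in A_{\rm sym}$ such that $2k''+k^3=0$ on $(0,\frac L2)$, $k(0)=0$, $k<0$ on $(0,\frac L2)$, and $\tilde\gamma(\frac L2)=(\frac12,\psi(\frac12))$. **Theorem (Destabilization of symmetric cut-and-glued free-elasticae).** Let $h_*:=2\,\mathsf B(\tfrac34,\tfrac12)^{-1}$, where $\mathsf B$ is the Beta function. There exists a symmetric cut-and-glued free-elastica, and it is unique up to reparametrization (any two have the same arclength parametrization). For every symmetric cut-and-glued free-elastica $\gamma$: 1. if $\psi(\frac12)<h_*$, then $\gamma$ is a local minimizer of $B$ in $A_{\rm sym}$, but not a global minimizer of $B$ in $A_{\rm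 sym}$; 2. if $\psi(\frac12)\ge h_*$, then $\gamma$ is not a local minimizer of $B$ in $A_{\rm sym}$, and not a local minimizer of $B$ in $A$. -/

import Mathlib

noncomputable section

namespace ObstacleElastica

open MeasureTheory Set

/-- The Euclidean plane. -/
abbrev Plane := EuclideanSpace ℝ (Fin 2)

/-- The derivative of a curve on the parameter interval `[0,1]` (one-sided at the endpoints).
Curves are functions `ℝ → Plane` of which only the restriction to `[0,1]` is ever used. -/
def vel (γ : ℝ → Plane) (x : ℝ) : Plane := derivWithin γ (Icc 0 1) x

/-- The second derivative; for a `W^{2,2}`-curve it exists for almost every `x` and is the weak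
second derivative. -/
def acc (γ : ℝ → Plane) (x : ℝ) : Plane := derivWithin (vel γ) (Icc 0 1) x

/-- `γ ∈ W^{2,2}(0,1;ℝ²)`: the (continuous representative of the) curve is differentiable on
`[0,1]` and its derivative is the primitive of a function `g ∈ L²(0,1;ℝ²)`, the weak second
derivative of `γ`. In particular `γ` and `γ'` are continuous on `[0,1]`. -/
def IsW22 (γ : ℝ → Plane) : Prop :=
  DifferentiableOn ℝ γ (Icc 0 1) ∧
    ∃ g : ℝ → Plane, MemLp g 2 (volume.restrict (Icc 0 1)) ∧
      ∀ x ∈ Icc (0 : ℝ) 1, vel γ x = vel γ 0 + ∫ t in (0 : ℝ)..x, g t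

/-- Immersed `W^{2,2}`-curves. -/
def IsW22Imm (γ : ℝ → Plane) : Prop :=
  IsW22 γ ∧ ∀ x ∈ Icc (0 : ℝ) 1, vel γ x ≠ 0

/-- The distance of two curves in the norm of `W^{2,2}(0,1;ℝ²)`. -/
def w22Dist (γ η : ℝ → Plane) : ℝ :=
  Real.sqrt (∫ x in (0 : ℝ)..1,
    (‖γ x - η x‖ ^ 2 + ‖vel γ x - vel η x‖ ^ 2 + ‖acc γ x - acc η x‖ ^ 2))

/-- The unit tangent `t = ∂ₛγ`, where `∂ₛ f = f' / |γ'|`. -/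
def unitTangent (γ : ℝ → Plane) (x : ℝ) : Plane := ‖vel γ x‖⁻¹ • vel γ x

/-- The unit normal: the unit tangent rotated counterclockwise by `π/2`. -/
def unitNormal (γ : ℝ → Plane) (x : ℝ) : Plane :=
  !₂[-(unitTangent γ x 1), unitTangent γ x 0]

/-- The curvature vector `κ = ∂ₛ² γ`. -/
def curvatureVec (γ : ℝ → Plane) (x : ℝ) : Plane :=
  ‖vel γ x‖⁻¹ • derivWithin (unitTangent γ) (Icc 0 1) x

/-- The bending energy `B[γ] = ∫_γ |κ|² ds`. -/
def bendingEnergy (γ : ℝ → Plane) : ℝ :=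
  ∫ x in (0 : ℝ)..1, ‖curvatureVec γ x‖ ^ 2 * ‖vel γ x‖

/-- The arclength `s(x) = ∫₀ˣ |γ'|`. -/
def arclength (γ : ℝ → Plane) (x : ℝ) : ℝ := ∫ t in (0 : ℝ)..x, ‖vel γ t‖

/-- The length `L[γ]`. -/
def curveLength (γ : ℝ → Plane) : ℝ := arclength γ 1

/-- The parameter in `[0,1]` at which an immersed curve has arclength `s ∈ [0, L[γ]]`. -/
def paramOfArclength (γ : ℝ → Plane) (s : ℝ) : ℝ :=
  Function.invFunOn (arclength γ) (Icc 0 1) s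

/-- The arclength parametrization `γ̃ : [0, L[γ]] → ℝ²`. -/
def arclengthParam (γ : ℝ → Plane) (s : ℝ) : Plane := γ (paramOfArclength γ s)

/-- The signed curvature `k = ⟨κ, n⟩` as a function of the arclength `s ∈ [0, L[γ]]`. -/
def signedCurvature (γ : ℝ → Plane) (s : ℝ) : ℝ :=
  inner ℝ (curvatureVec γ (paramOfArclength γ s)) (unitNormal γ (paramOfArclength γ s))

/-- The obstacle assumptions: uniform continuity, negativity outside `(0,1)`, and a positive
value somewhere in `[0,1]`. -/
structure IsObstacle (ψ : ℝ → ℝ) : Prop where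
  uniformContinuous : UniformContinuous ψ
  neg_left : ∀ x ≤ 0, ψ x < 0
  neg_right : ∀ x ≥ 1, ψ x < 0
  exists_pos : ∃ x ∈ Icc (0 : ℝ) 1, 0 < ψ x

/-- Symmetric cones: affine on `(-∞, 1/2]` and symmetric about `1/2`. -/
def IsSymmetricCone (ψ : ℝ → ℝ) : Prop :=
  (∃ a b : ℝ, ∀ x ≤ 1 / 2, ψ x = a * x + b) ∧ ∀ x, ψ x = ψ (1 - x)

/-- The admissible class `A`. -/
def admissible (ψ : ℝ → ℝ) : Set (ℝ → Plane) :=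
  {γ | IsW22Imm γ ∧ γ 0 = !₂[0, 0] ∧ γ 1 = !₂[1, 0] ∧
    ∀ x ∈ Icc (0 : ℝ) 1, ψ (γ x 0) ≤ γ x 1}

/-- The symmetric admissible class `A_sym`. -/
def admissibleSym (ψ : ℝ → ℝ) : Set (ℝ → Plane) :=
  {γ | γ ∈ admissible ψ ∧ ∀ x ∈ Icc (0 : ℝ) 1, γ (1 - x) = !₂[1 - γ x 0, γ x 1]}

/-- Symmetric cut-and-glued free-elasticae. Under these conditions the
pointwise curvature is the smooth representative of the curvature on `(0, L/2)`, and its value at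
`0` is the limit of `k(s)` as `s ↓ 0`. -/
structure IsSCF (ψ : ℝ → ℝ) (γ : ℝ → Plane) : Prop where
  mem_sym : γ ∈ admissibleSym ψ
  contDiffOn : ContDiffOn ℝ 2 (signedCurvature γ) (Ioo 0 (curveLength γ / 2))
  elastica : ∀ s ∈ Ioo 0 (curveLength γ / 2),
    2 * deriv (deriv (signedCurvature γ)) s + signedCurvature γ s ^ 3 = 0
  curvature_zero : signedCurvature γ 0 = 0
  curvature_neg : ∀ s ∈ Ioo 0 (curveLength γ / 2), signedCurvature γ s < 0
  tip : arclengthParam γ (curveLength γ / 2) = !₂[1 / 2, ψ (1 / 2)]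

/-- Equality up to (orientation preserving) reparametrization: the arclength parametrizations
coincide. -/
def SameCurve (γ η : ℝ → Plane) : Prop :=
  curveLength γ = curveLength η ∧
    ∀ s ∈ Icc 0 (curveLength γ), arclengthParam γ s = arclengthParam η s

/-- Local minimizers of the bending energy in a class `S`, with respect to the `W^{2,2}`-norm. -/
def IsLocalMinimizer (S : Set (ℝ → Plane)) (γ : ℝ → Plane) : Prop :=
  γ ∈ S ∧ ∃ ε > 0, ∀ η ∈ S, w22Dist η γ < ε → bendingEnergy γ ≤ bendingEnergy η

/-- Global minimizers of the bending energy in a class `S`. -/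
def IsGlobalMinimizer (S : Set (ℝ → Plane)) (γ : ℝ → Plane) : Prop :=
  γ ∈ S ∧ ∀ η ∈ S, bendingEnergy γ ≤ bendingEnergy η

/-- The threshold height `h_* = 2 B(3/4, 1/2)⁻¹`, with the Beta function. -/
def criticalHeight : ℝ := 2 * (ProbabilityTheory.beta (3 / 4) (1 / 2))⁻¹

end ObstacleElastica

end

open ObstacleElastica

/-!
# Destabilization of symmetric cut-and-glued free elasticae

The equation `2 k'' + k³ = 0` for the curvature `k = θ'` of a curve becomes, after rotating and
scaling, the pendulum equation `φ'' = cos φ / 2` with the conserved quantity `φ'² = sin φ`. The left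
half of a symmetric cut-and-glued elastica starts with curvature `0`, that is, with the pendulum at
rest, and ends at the tip, where the tangent is horizontal. Hence it is determined up to scaling by
its initial angle `Φ ∈ (0, π)`, the angle swept by the pendulum (`IsSCF.exists_eq_elasticaCurve`). In
terms of `S(Φ) = ∫₀^Φ √(sin u) du` the tip has the coordinates `(g(Φ), f(Φ))` (`tipWidth`,
`tipHeight`), and after scaling the abscissa of the tip to `1 / 2` its height is `f(Φ) / (2 g(Φ))` and
the energy of the whole curve is `4 S(Φ) g(Φ)` (`bendingEnergy_of_elasticaVel`).

* The height `f / (2 g)` increases strictly from `0` to `∞` in the range of angles with `g > 0`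
  (`tip_slope_lt`, `exists_tip_slope`), which yields existence and uniqueness. At `Φ = π / 2` it equals
  `1 / S(π / 2) = h_*` (`lt_criticalHeight_iff`).
* The energy `4 S g` decreases strictly for `Φ ≥ π / 2` (`rootSineIntegral_mul_tipWidth_lt`). Hence, if
  `ψ(1 / 2) ≥ h_*`, then the elasticae with slightly larger angles, which have a higher tip and
  therefore stay above the cone, are admissible competitors of smaller energy. With the
  parametrization of the given curve they converge to it in `W^{2,2}` (`exists_w22Dist_le`).
* If `ψ(1 / 2) < h_*`, then `Φ < π / 2` and all symmetric curves close to the elastica are graphs. Let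
  `Θ < π / 2` be the largest tangent angle of the left half of such a graph. Completing the square in
  `θ'² / |γ'| + λ² |γ'| sin (Θ - θ)`, where the last term integrates to a function of the tip only,
  bounds the energy from below in terms of `S(Θ)` (`exists_calibration`), and
  `rootSineIntegral_mul_le_sq` compares this bound with the energy of the elastica.
* The elastica is never a global minimizer, since almost full large circles have arbitrarily small
  energy (`exists_small_energy`).
-/

noncomputable section

namespace ObstacleElastica

open MeasureTheory Set Filter Topology

/-! ### The pendulum equation -/

lemma lipschitzWith_pendulumField (a b : ℝ) :
    LipschitzWith (Real.toNNReal (|a| + |b|)) (fun p : ℝ × ℝ => (a * p.2, b * Real.cos p.1)) := by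
  refine LipschitzWith.of_dist_le_mul fun p q => ?_
  have hab : 0 ≤ |a| + |b| := by positivity
  have h1 : |p.1 - q.1| ≤ dist p q := by
    rw [Prod.dist_eq, ← Real.dist_eq]; exact le_max_left _ _
  have h2 : |p.2 - q.2| ≤ dist p q := by
    rw [Prod.dist_eq, ← Real.dist_eq]; exact le_max_right _ _
  have h3 : |Real.cos p.1 - Real.cos q.1| ≤ |p.1 - q.1| := by
    have := Real.lipschitzWith_cos.dist_le_mul p.1 q.1
    simpa [Real.dist_eq] using this
  rw [Real.coe_toNNReal _ hab, Prod.dist_eq (x := (_, _)), Real.dist_eq, Real.dist_eq,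
    ← mul_sub, ← mul_sub, abs_mul, abs_mul]
  have hd : 0 ≤ dist p q := dist_nonneg
  refine max_le ?_ ?_
  · nlinarith [abs_nonneg a, abs_nonneg b, mul_le_mul_of_nonneg_left h2 (abs_nonneg a),
      mul_nonneg (abs_nonneg b) hd]
  · nlinarith [abs_nonneg a, abs_nonneg b, mul_le_mul_of_nonneg_left (h3.trans h1) (abs_nonneg b),
      mul_nonneg (abs_nonneg a) hd]

/-- Solutions on `[-T, T]`. In the variables `(φ, 2 T φ')` the vector field is small enough for a
single application of the Picard-Lindelöf theorem to reach the times `± T`. -/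
lemma exists_pendulum_Icc (T : ℝ) (hT : 1 ≤ T) : ∃ α : ℝ → ℝ × ℝ, α 0 = (0, 0) ∧
    ∀ t ∈ Ioo (-T) T, HasDerivAt α ((α t).2, Real.cos (α t).1 / 2) t := by
  have hT0 : 0 < T := by linarith
  let F : ℝ → ℝ × ℝ → ℝ × ℝ := fun _ p => ((1 / (2 * T)) * p.2, T * Real.cos p.1)
  have hPL : IsPicardLindelof F (tmin := -T) (tmax := T) ⟨0, by constructor <;> linarith⟩
      ((0, 0) : ℝ × ℝ) (Real.toNNReal (T ^ 2)) 0 (Real.toNNReal T)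
      (Real.toNNReal (|1 / (2 * T)| + |T|)) := by
    constructor
    · intro t _
      exact (lipschitzWith_pendulumField (1 / (2 * T)) T).lipschitzOnWith
    · intro x _
      exact continuousOn_const
    · intro t _ p hp
      rw [Metric.mem_closedBall, Prod.dist_eq, Real.coe_toNNReal _ (by positivity)] at hp
      have h2 : |p.2| ≤ T ^ 2 := by
        have := (le_max_right _ _).trans hp
        simpa [Real.dist_eq] using this
      rw [Real.coe_toNNReal _ hT0.le, Prod.norm_def]
      refine max_le ?_ ?_
      · simp only [F, Real.norm_eq_abs, abs_mul]
        rw [abs_of_pos (by positivity : 0 < 1 / (2 * T)), div_mul_eq_mul_div, one_mul,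
          div_le_iff₀ (by positivity)]
        nlinarith
      · simp only [F, Real.norm_eq_abs, abs_mul]
        rw [abs_of_pos hT0]
        nlinarith [Real.abs_cos_le_one p.1]
    · simp only [sub_zero, zero_sub, neg_neg, max_self, NNReal.coe_zero]
      rw [Real.coe_toNNReal _ hT0.le, Real.coe_toNNReal _ (by positivity)]
      nlinarith
  obtain ⟨α, h0, hα⟩ := hPL.exists_eq_forall_mem_Icc_hasDerivWithinAt₀
  refine ⟨fun t => ((α t).1, (α t).2 / (2 * T)), ?_, ?_⟩
  · have : α 0 = (0, 0) := h0
    simp [this]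
  · intro t ht
    have h := (hα t (Ioo_subset_Icc_self ht)).hasDerivAt (Icc_mem_nhds ht.1 ht.2)
    have h1 : HasDerivAt (fun t => (α t).1) _ t := h.fst
    have h2 : HasDerivAt (fun t => (α t).2) _ t := h.snd
    have h3 := h1.prodMk (h2.div_const (2 * T))
    convert h3 using 1
    simp only [F, Prod.mk.injEq]
    constructor <;> field_simp

lemma exists_pendulum : ∃ α : ℝ → ℝ × ℝ, α 0 = (0, 0) ∧
    ∀ t, HasDerivAt α ((α t).2, Real.cos (α t).1 / 2) t := by
  have hex : ∀ T : ℝ, ∃ α : ℝ → ℝ × ℝ, α 0 = (0, 0) ∧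
      ∀ t ∈ Ioo (-(|T| + 1)) (|T| + 1), HasDerivAt α ((α t).2, Real.cos (α t).1 / 2) t :=
    fun T => exists_pendulum_Icc _ (by linarith [abs_nonneg T])
  choose A hA0 hA using hex
  have huniq : ∀ T T' : ℝ, |T| ≤ |T'| → ∀ t ∈ Ioo (-(|T| + 1)) (|T| + 1), A T t = A T' t := by
    intro T T' hTT t ht
    have := ODE_solution_unique_of_mem_Ioo (f := A T) (g := A T') (a := -(|T| + 1))
      (b := |T| + 1) (t₀ := 0) (v := fun _ p => (1 * p.2, (1 / 2) * Real.cos p.1))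
      (s := fun _ => univ)
      (fun t _ => (lipschitzWith_pendulumField 1 (1 / 2)).lipschitzOnWith)
      ⟨by linarith [abs_nonneg T], by linarith [abs_nonneg T]⟩
      (fun t ht => ⟨by simpa [div_eq_inv_mul] using hA T t ht, trivial⟩)
      (fun t ht => ⟨by
        simpa [div_eq_inv_mul] using hA T' t ⟨by linarith [ht.1], by linarith [ht.2]⟩, trivial⟩)
      (by rw [hA0, hA0])
    exact this ht
  refine ⟨fun t => A t t, hA0 0, fun t => ?_⟩
  have hmem : ∀ᶠ s in 𝓝 t, |s| < |t| + 1 :=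
    (continuous_abs.tendsto t).eventually (gt_mem_nhds (by linarith))
  have heq : (fun s => A s s) =ᶠ[𝓝 t] A (|t| + 1) := by
    filter_upwards [hmem] with s hs
    refine huniq s _ ?_ s ?_
    · rw [abs_of_nonneg (by positivity : 0 ≤ |t| + 1)]; exact hs.le
    · exact ⟨by linarith [neg_abs_le s], by linarith [le_abs_self s]⟩
  have h1 : A t t = A (|t| + 1) t := heq.eq_of_nhds
  beta_reduce
  rw [h1]
  refine HasDerivAt.congr_of_eventuallyEq (hA (|t| + 1) t ?_) heq
  rw [abs_of_nonneg (by positivity : 0 ≤ |t| + 1)]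
  exact ⟨by linarith [neg_abs_le t], by linarith [le_abs_self t]⟩

/-- The angle `φ` of the pendulum `φ'' = cos φ / 2`, `φ(0) = φ'(0) = 0`. Up to similarities the
curve with tangent angle `-φ` is the free elastica starting at an inflection point. -/
def pendulumAngle (t : ℝ) : ℝ := (Classical.choose exists_pendulum t).1

/-- The angular velocity `φ'` of the pendulum `φ'' = cos φ / 2`, `φ(0) = φ'(0) = 0`. -/
def pendulumRate (t : ℝ) : ℝ := (Classical.choose exists_pendulum t).2

lemma pendulumAngle_zero : pendulumAngle 0 = 0 := by
  simp [pendulumAngle, (Classical.choose_spec exists_pendulum).1]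

lemma pendulumRate_zero : pendulumRate 0 = 0 := by
  simp [pendulumRate, (Classical.choose_spec exists_pendulum).1]

lemma hasDerivAt_pendulumAngle (t : ℝ) : HasDerivAt pendulumAngle (pendulumRate t) t :=
  ((Classical.choose_spec exists_pendulum).2 t).fst

lemma hasDerivAt_pendulumRate (t : ℝ) :
    HasDerivAt pendulumRate (Real.cos (pendulumAngle t) / 2) t :=
  ((Classical.choose_spec exists_pendulum).2 t).snd

lemma continuous_pendulumAngle : Continuous pendulumAngle :=
  continuous_iff_continuousAt.2 fun t => (hasDerivAt_pendulumAngle t).continuousAt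

lemma continuous_pendulumRate : Continuous pendulumRate :=
  continuous_iff_continuousAt.2 fun t => (hasDerivAt_pendulumRate t).continuousAt

/-- Conservation of energy. -/
lemma pendulumRate_sq (t : ℝ) : pendulumRate t ^ 2 = Real.sin (pendulumAngle t) := by
  have h : ∀ s, HasDerivAt (fun s => pendulumRate s ^ 2 - Real.sin (pendulumAngle s)) 0 s := by
    intro s
    refine (((hasDerivAt_pendulumRate s).pow 2).sub (hasDerivAt_pendulumAngle s).sin).congr_deriv ?_
    push_cast; ring
  have := is_const_of_deriv_eq_zero (fun s => (h s).differentiableAt) (fun s => (h s).deriv) t 0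
  simp only [pendulumAngle_zero, pendulumRate_zero, Real.sin_zero] at this
  linarith

lemma abs_pendulumRate_le_one (t : ℝ) : |pendulumRate t| ≤ 1 := by
  rw [← sq_le_one_iff_abs_le_one, pendulumRate_sq]
  exact Real.sin_le_one _

lemma abs_pendulumAngle_sub_le (s t : ℝ) : |pendulumAngle s - pendulumAngle t| ≤ |s - t| := by
  have := Convex.norm_image_sub_le_of_norm_hasDerivWithin_le (s := univ) (C := 1)
    (fun x _ => (hasDerivAt_pendulumAngle x).hasDerivWithinAt)
    (fun x _ => abs_pendulumRate_le_one x) convex_univ (mem_univ t) (mem_univ s)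
  simpa using this

lemma abs_pendulumRate_sub_le (s t : ℝ) : |pendulumRate s - pendulumRate t| ≤ |s - t| := by
  have := Convex.norm_image_sub_le_of_norm_hasDerivWithin_le (s := univ) (C := 1)
    (fun x _ => (hasDerivAt_pendulumRate x).hasDerivWithinAt)
    (fun x _ => by
      rw [Real.norm_eq_abs, abs_div, abs_two]
      linarith [Real.abs_cos_le_one (pendulumAngle x)]) convex_univ (mem_univ t) (mem_univ s)
  simpa using this

/-- Uniqueness for the pendulum equation in an arbitrary parametrization `R` of the time axis. -/
lemma pendulum_unique {a b r R : ℝ → ℝ} {l M : ℝ} (hM : ∀ t ∈ Ico 0 l, |r t| ≤ M)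
    (hR : ∀ t, HasDerivAt R (r t) t) (hR0 : R 0 = 0) (ha : ContinuousOn a (Icc 0 l))
    (hb : ContinuousOn b (Icc 0 l))
    (ha' : ∀ t ∈ Ico 0 l, HasDerivWithinAt a (r t * b t) (Ici t) t)
    (hb' : ∀ t ∈ Ico 0 l, HasDerivWithinAt b (r t / 2 * Real.cos (a t)) (Ici t) t)
    (ha0 : a 0 = 0) (hb0 : b 0 = 0) :
    ∀ t ∈ Icc 0 l, a t = pendulumAngle (R t) ∧ b t = pendulumRate (R t) := by
  have hRc : Continuous R := continuous_iff_continuousAt.2 fun t => (hR t).continuousAt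
  have := ODE_solution_unique_of_mem_Icc_right (f := fun t => (a t, b t))
    (g := fun t => (pendulumAngle (R t), pendulumRate (R t))) (a := 0) (b := l)
    (K := Real.toNNReal (2 * M)) (s := fun _ => univ)
    (v := fun t p => (r t * p.2, (r t / 2) * Real.cos p.1))
    (fun t ht => ((lipschitzWith_pendulumField (r t) (r t / 2)).weaken
      (Real.toNNReal_le_toNNReal (by
        rw [abs_div, abs_two]
        linarith [hM t ht, abs_nonneg (r t)]))).lipschitzOnWith) (ha.prodMk hb)
    (fun t ht => (ha' t ht).prodMk (hb' t ht)) (fun _ _ => trivial)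
    ((continuous_pendulumAngle.comp hRc).prodMk (continuous_pendulumRate.comp hRc)).continuousOn
    (fun t ht => by
      have h := (((hasDerivAt_pendulumAngle (R t)).comp t (hR t)).prodMk
        ((hasDerivAt_pendulumRate (R t)).comp t (hR t))).hasDerivWithinAt (s := Ici t)
      refine h.congr_deriv ?_
      ext
      · simp [mul_comm]
      · simp; ring) (fun _ _ => trivial)
    (by simp [ha0, hb0, hR0, pendulumAngle_zero, pendulumRate_zero])
  intro t ht
  have h := this ht
  simp only [Prod.mk.injEq] at h
  exact h

/-- `σ` is a time before the first return of the pendulum to rest. -/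
def IsSwing (σ : ℝ) : Prop := 0 < σ ∧ ∀ t ∈ Ioo 0 σ, 0 < pendulumRate t

lemma IsSwing.rate_nonneg {σ : ℝ} (h : IsSwing σ) {t : ℝ} (ht : t ∈ Icc 0 σ) :
    0 ≤ pendulumRate t := by
  have hc : Icc 0 σ ⊆ closure (Ioo 0 σ) := by rw [closure_Ioo h.1.ne]
  have : ∀ t ∈ closure (Ioo 0 σ), 0 ≤ pendulumRate t := fun t ht =>
    closure_minimal (fun s hs => (h.2 s hs).le)
      (isClosed_le continuous_const continuous_pendulumRate) ht
  exact this t (hc ht)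

lemma IsSwing.strictMonoOn {σ : ℝ} (h : IsSwing σ) : StrictMonoOn pendulumAngle (Icc 0 σ) := by
  refine strictMonoOn_of_deriv_pos (convex_Icc 0 σ) continuous_pendulumAngle.continuousOn ?_
  intro t ht
  rw [interior_Icc] at ht
  rw [(hasDerivAt_pendulumAngle t).deriv]
  exact h.2 t ht

lemma IsSwing.angle_pos {σ : ℝ} (h : IsSwing σ) : 0 < pendulumAngle σ := by
  have := h.strictMonoOn ⟨le_rfl, h.1.le⟩ ⟨h.1.le, le_rfl⟩ h.1
  rwa [pendulumAngle_zero] at this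

lemma IsSwing.angle_nonneg {σ t : ℝ} (h : IsSwing σ) (ht : t ∈ Icc 0 σ) :
    0 ≤ pendulumAngle t := by
  have := h.strictMonoOn.monotoneOn ⟨le_rfl, h.1.le⟩ ht ht.1
  rwa [pendulumAngle_zero] at this

lemma IsSwing.angle_le {σ t : ℝ} (h : IsSwing σ) (ht : t ∈ Icc 0 σ) :
    pendulumAngle t ≤ pendulumAngle σ :=
  h.strictMonoOn.monotoneOn ht ⟨h.1.le, le_rfl⟩ ht.2

lemma IsSwing.angle_le_pi {σ : ℝ} (h : IsSwing σ) : pendulumAngle σ ≤ Real.pi := by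
  by_contra hlt
  push Not at hlt
  have hpi : Real.pi ∈ Ioo (pendulumAngle 0) (pendulumAngle σ) := by
    rw [pendulumAngle_zero]; exact ⟨Real.pi_pos, hlt⟩
  obtain ⟨t, ht, hte⟩ := intermediate_value_Ioo h.1.le continuous_pendulumAngle.continuousOn hpi
  have h1 := h.2 t ht
  have h2 := pendulumRate_sq t
  rw [hte, Real.sin_pi] at h2
  nlinarith

lemma IsSwing.rate_eq {σ t : ℝ} (h : IsSwing σ) (ht : t ∈ Icc 0 σ) :
    pendulumRate t = √(Real.sin (pendulumAngle t)) := by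
  rw [← pendulumRate_sq, Real.sqrt_sq (h.rate_nonneg ht)]

lemma IsSwing.mono {σ τ : ℝ} (h : IsSwing σ) (hτ : 0 < τ) (hle : τ ≤ σ) : IsSwing τ :=
  ⟨hτ, fun t ht => h.2 t ⟨ht.1, ht.2.trans_le hle⟩⟩

lemma IsSwing.eq_of_angle_eq {σ τ : ℝ} (h : IsSwing σ) (h' : IsSwing τ)
    (heq : pendulumAngle σ = pendulumAngle τ) : σ = τ := by
  rcases le_total σ τ with hle | hle
  · exact h'.strictMonoOn.injOn ⟨h.1.le, hle⟩ ⟨h'.1.le, le_rfl⟩ heq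
  · exact h.strictMonoOn.injOn ⟨h.1.le, le_rfl⟩ ⟨h'.1.le, hle⟩ heq

/-- The swing continues as long as the angle is below `π`. -/
lemma IsSwing.exists_gt {σ : ℝ} (h : IsSwing σ) (hπ : pendulumAngle σ < Real.pi) :
    ∃ τ > σ, IsSwing τ ∧ pendulumAngle τ < Real.pi := by
  have hpos : 0 < pendulumRate σ := by
    rw [h.rate_eq ⟨h.1.le, le_rfl⟩]
    exact Real.sqrt_pos.2 (Real.sin_pos_of_pos_of_lt_pi h.angle_pos hπ)
  have h1 : ∀ᶠ t in 𝓝 σ, 0 < pendulumRate t :=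
    (continuous_pendulumRate.tendsto σ).eventually (lt_mem_nhds hpos)
  have h2 : ∀ᶠ t in 𝓝 σ, pendulumAngle t < Real.pi :=
    (continuous_pendulumAngle.tendsto σ).eventually (gt_mem_nhds hπ)
  obtain ⟨ε, hε, hball⟩ := Metric.eventually_nhds_iff.1 (h1.and h2)
  refine ⟨σ + ε / 2, by linarith, ⟨by linarith [h.1], fun t ht => ?_⟩, ?_⟩
  · rcases lt_or_ge t σ with hlt | hge
    · exact h.2 t ⟨ht.1, hlt⟩
    · refine (hball ?_).1
      rw [Real.dist_eq, abs_of_nonneg (by linarith)]; linarith [ht.2]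
  · refine (hball ?_).2
    rw [Real.dist_eq, abs_of_nonneg (by linarith)]; linarith

lemma exists_isSwing_small : ∃ σ, IsSwing σ := by
  have h1 : ∀ᶠ t in 𝓝 (0 : ℝ), 0 < Real.cos (pendulumAngle t) := by
    have : Continuous fun t => Real.cos (pendulumAngle t) :=
      Real.continuous_cos.comp continuous_pendulumAngle
    refine (this.tendsto 0).eventually (lt_mem_nhds ?_)
    simp [pendulumAngle_zero]
  obtain ⟨ε, hε, hball⟩ := Metric.eventually_nhds_iff.1 h1
  refine ⟨ε, hε, fun t ht => ?_⟩
  have hm : StrictMonoOn pendulumRate (Icc 0 t) := by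
    refine strictMonoOn_of_deriv_pos (convex_Icc 0 t) continuous_pendulumRate.continuousOn ?_
    intro s hs
    rw [interior_Icc] at hs
    rw [(hasDerivAt_pendulumRate s).deriv]
    refine div_pos (hball ?_) two_pos
    rw [Real.dist_eq, sub_zero, abs_of_pos hs.1]; linarith [hs.2, ht.2]
  have := hm ⟨le_rfl, ht.1.le⟩ ⟨ht.1.le, le_rfl⟩ ht.1
  rwa [pendulumRate_zero] at this

/-- Every angle below `π` is reached. -/
lemma exists_isSwing_angle_eq {Θ : ℝ} (h0 : 0 < Θ) (hπ : Θ < Real.pi) :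
    ∃ σ, IsSwing σ ∧ pendulumAngle σ = Θ := by
  obtain ⟨σ₀, hσ₀⟩ := exists_isSwing_small
  -- it suffices to reach an angle `≥ Θ` during a swing
  suffices hs : ∃ τ, IsSwing τ ∧ Θ ≤ pendulumAngle τ by
    obtain ⟨τ, hτ, hle⟩ := hs
    have hmem : Θ ∈ Ioc (pendulumAngle 0) (pendulumAngle τ) := by
      rw [pendulumAngle_zero]; exact ⟨h0, hle⟩
    obtain ⟨σ, hσ, he⟩ := intermediate_value_Ioc hτ.1.le continuous_pendulumAngle.continuousOn hmem
    exact ⟨σ, hτ.mono hσ.1 hσ.2, he⟩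
  by_contra hno
  push Not at hno
  -- otherwise the angle stays in `[φ(σ₀), Θ]` forever, where the speed is bounded below
  have hall : ∀ τ, σ₀ ≤ τ → IsSwing τ := by
    intro τ hτ
    by_contra hn
    set s := sSup {t | IsSwing t} with hs
    have hbdd : BddAbove {t | IsSwing t} := by
      refine ⟨τ, fun t ht => ?_⟩
      by_contra hlt
      push Not at hlt
      exact hn (IsSwing.mono ht (hσ₀.1.trans_le hτ) hlt.le)
    have hswing : IsSwing s := by
      refine ⟨hσ₀.1.trans_le (le_csSup hbdd hσ₀), fun t ht => ?_⟩
      obtain ⟨u, hu, htu⟩ := exists_lt_of_lt_csSup ⟨σ₀, hσ₀⟩ ht.2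
      exact hu.2 t ⟨ht.1, htu⟩
    obtain ⟨u, hu, hu', -⟩ := hswing.exists_gt ((hno s hswing).trans hπ)
    exact absurd (le_csSup hbdd hu') (not_le.2 hu)
  have hlow : ∀ t, σ₀ ≤ t →
      min (Real.sin (pendulumAngle σ₀)) (Real.sin Θ) ≤ pendulumRate t := by
    intro t ht
    have hst := hall t ht
    have hle1 : pendulumAngle σ₀ ≤ pendulumAngle t := hst.angle_le ⟨hσ₀.1.le, ht⟩
    have hlt2 := hno t hst
    have hconc := strictConcaveOn_sin_Icc.concaveOn.min_le_of_mem_Icc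
      (x := pendulumAngle σ₀) (y := Θ) (z := pendulumAngle t)
      ⟨hσ₀.angle_pos.le, ((hno _ hσ₀).trans hπ).le⟩ ⟨h0.le, hπ.le⟩ ⟨hle1, hlt2.le⟩
    have h1 := pendulumRate_sq t
    have h2 := hst.rate_nonneg ⟨hst.1.le, le_rfl⟩
    have h3 := abs_pendulumRate_le_one t
    rw [abs_of_nonneg h2] at h3
    nlinarith
  set m := min (Real.sin (pendulumAngle σ₀)) (Real.sin Θ) with hm
  have hmpos : 0 < m := lt_min
    (Real.sin_pos_of_pos_of_lt_pi hσ₀.angle_pos ((hno _ hσ₀).trans hπ))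
    (Real.sin_pos_of_pos_of_lt_pi h0 hπ)
  have hgrow := Convex.mul_sub_le_image_sub_of_le_deriv (convex_Ici σ₀) (f := pendulumAngle)
    (C := m) continuous_pendulumAngle.continuousOn
    (fun t _ => (hasDerivAt_pendulumAngle t).differentiableAt.differentiableWithinAt)
    (fun t ht => by
      rw [(hasDerivAt_pendulumAngle t).deriv]
      exact hlow t (interior_subset ht)) σ₀ (mem_Ici.2 le_rfl) (σ₀ + Θ / m)
    (mem_Ici.2 (by have := div_pos h0 hmpos; linarith)) (by have := div_pos h0 hmpos; linarith)
  have h1 : m * (σ₀ + Θ / m - σ₀) = Θ := by field_simp; ring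
  rw [h1] at hgrow
  have := hno (σ₀ + Θ / m) (hall _ (by have := div_pos h0 hmpos; linarith))
  linarith [hσ₀.angle_pos]

/-! ### The tip of the free elastica -/

/-- The integral `S(Θ) = ∫₀^Θ √(sin u) du`. -/
def rootSineIntegral (Θ : ℝ) : ℝ := ∫ u in (0 : ℝ)..Θ, √(Real.sin u)

/-- The height of the free elastica that starts at an inflection point with tangent angle `Θ` and
runs until its tangent is horizontal, normalized by `k² = sin(Θ - θ)`. -/
def tipHeight (Θ : ℝ) : ℝ :=
  2 * Real.sin Θ * √(Real.sin Θ) - rootSineIntegral Θ * Real.cos Θ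

/-- The horizontal extent of the free elastica that starts at an inflection point with tangent
angle `Θ` and runs until its tangent is horizontal, normalized by `k² = sin(Θ - θ)`. -/
def tipWidth (Θ : ℝ) : ℝ :=
  2 * √(Real.sin Θ) * Real.cos Θ + rootSineIntegral Θ * Real.sin Θ

lemma continuous_sqrt_sin : Continuous fun u => √(Real.sin u) :=
  Real.continuous_sqrt.comp Real.continuous_sin

lemma hasDerivAt_rootSineIntegral (Θ : ℝ) :
    HasDerivAt rootSineIntegral (√(Real.sin Θ)) Θ :=
  intervalIntegral.integral_hasDerivAt_right (continuous_sqrt_sin.intervalIntegrable _ _)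
    (continuous_sqrt_sin.stronglyMeasurableAtFilter _ _) continuous_sqrt_sin.continuousAt

lemma continuous_rootSineIntegral : Continuous rootSineIntegral :=
  continuous_iff_continuousAt.2 fun t => (hasDerivAt_rootSineIntegral t).continuousAt

lemma rootSineIntegral_zero : rootSineIntegral 0 = 0 := intervalIntegral.integral_same

lemma rootSineIntegral_pos {Θ : ℝ} (h0 : 0 < Θ) (hπ : Θ ≤ Real.pi) :
    0 < rootSineIntegral Θ :=
  intervalIntegral.intervalIntegral_pos_of_pos_on (continuous_sqrt_sin.intervalIntegrable _ _)
    (fun _ hu => Real.sqrt_pos.2 (Real.sin_pos_of_pos_of_lt_pi hu.1 (hu.2.trans_le hπ))) h0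

lemma continuous_tipHeight : Continuous tipHeight := by
  unfold tipHeight
  have := continuous_rootSineIntegral
  have := continuous_sqrt_sin
  fun_prop

lemma continuous_tipWidth : Continuous tipWidth := by
  unfold tipWidth
  have := continuous_rootSineIntegral
  have := continuous_sqrt_sin
  fun_prop

lemma hasDerivAt_sqrt_sin {Θ : ℝ} (hs : 0 < Real.sin Θ) :
    HasDerivAt (fun u => √(Real.sin u)) (Real.cos Θ / (2 * √(Real.sin Θ))) Θ :=
  (Real.hasDerivAt_sin Θ).sqrt hs.ne'

lemma hasDerivAt_tipHeight {Θ : ℝ} (hs : 0 < Real.sin Θ) :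
    HasDerivAt tipHeight (tipWidth Θ) Θ := by
  have hr : √(Real.sin Θ) ^ 2 = Real.sin Θ := Real.sq_sqrt hs.le
  have hr0 : 0 < √(Real.sin Θ) := Real.sqrt_pos.2 hs
  refine ((((Real.hasDerivAt_sin Θ).const_mul 2).mul (hasDerivAt_sqrt_sin hs)).sub
    ((hasDerivAt_rootSineIntegral Θ).mul (Real.hasDerivAt_cos Θ))).congr_deriv ?_
  unfold tipWidth
  field_simp
  generalize √(Real.sin Θ) = r at *
  rw [← hr]; ring

lemma hasDerivAt_tipWidth {Θ : ℝ} (hs : 0 < Real.sin Θ) :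
    HasDerivAt tipWidth (1 / √(Real.sin Θ) - tipHeight Θ) Θ := by
  have hr : √(Real.sin Θ) ^ 2 = Real.sin Θ := Real.sq_sqrt hs.le
  have hr0 : 0 < √(Real.sin Θ) := Real.sqrt_pos.2 hs
  refine ((((hasDerivAt_sqrt_sin hs).const_mul 2).mul (Real.hasDerivAt_cos Θ)).add
    ((hasDerivAt_rootSineIntegral Θ).mul (Real.hasDerivAt_sin Θ))).congr_deriv ?_
  unfold tipHeight
  have hcs : Real.cos Θ ^ 2 = 1 - Real.sin Θ ^ 2 := by linarith [Real.sin_sq_add_cos_sq Θ]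
  field_simp
  rw [hcs]
  generalize √(Real.sin Θ) = r at *
  rw [← hr]; ring

lemma tipHeight_sq_add_tipWidth_sq {Θ : ℝ} (hs : 0 ≤ Real.sin Θ) :
    tipHeight Θ ^ 2 + tipWidth Θ ^ 2 = 4 * Real.sin Θ + rootSineIntegral Θ ^ 2 := by
  have hr : √(Real.sin Θ) ^ 2 = Real.sin Θ := Real.sq_sqrt hs
  have hcs := Real.sin_sq_add_cos_sq Θ
  unfold tipHeight tipWidth
  linear_combination (4 * √(Real.sin Θ) ^ 2 + rootSineIntegral Θ ^ 2) * hcs + 4 * hr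

lemma tipWidth_mul_sin_sub_tipHeight_mul_cos (Θ : ℝ) :
    tipWidth Θ * Real.sin Θ - tipHeight Θ * Real.cos Θ = rootSineIntegral Θ := by
  unfold tipHeight tipWidth
  linear_combination rootSineIntegral Θ * Real.sin_sq_add_cos_sq Θ

lemma tipHeight_pos {Θ : ℝ} (h0 : 0 < Θ) (hπ : Θ ≤ Real.pi) : 0 < tipHeight Θ := by
  have hs : 0 ≤ Real.sin Θ := Real.sin_nonneg_of_nonneg_of_le_pi h0.le hπ
  have hS := rootSineIntegral_pos h0 hπ
  unfold tipHeight
  rcases lt_or_ge Θ (Real.pi / 2) with hlt | hge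
  · have hs' : 0 < Real.sin Θ := Real.sin_pos_of_pos_of_lt_pi h0 (by linarith [Real.pi_pos])
    have hc : 0 < Real.cos Θ := Real.cos_pos_of_mem_Ioo ⟨by linarith, hlt⟩
    have hr0 : 0 < √(Real.sin Θ) := Real.sqrt_pos.2 hs'
    have hSle : rootSineIntegral Θ ≤ Θ * √(Real.sin Θ) := by
      have := intervalIntegral.integral_mono_on h0.le
        (continuous_sqrt_sin.intervalIntegrable 0 Θ) (continuous_const.intervalIntegrable 0 Θ)
        (g := fun _ => √(Real.sin Θ)) (μ := volume) (fun u hu => by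
          refine Real.sqrt_le_sqrt (Real.sin_le_sin_of_le_of_le_pi_div_two ?_ hlt.le hu.2)
          linarith [hu.1, Real.pi_pos])
      simpa [rootSineIntegral] using this
    have htan : Θ * Real.cos Θ < Real.sin Θ := by
      have := Real.lt_tan h0 hlt
      rwa [Real.tan_eq_sin_div_cos, lt_div_iff₀ hc] at this
    have h1 := mul_le_mul_of_nonneg_right hSle hc.le
    have h2 := mul_lt_mul_of_pos_right htan hr0
    nlinarith [mul_pos hs' hr0]
  · have hc : Real.cos Θ ≤ 0 := Real.cos_nonpos_of_pi_div_two_le_of_le hge (by linarith)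
    rcases hge.eq_or_lt with heq | hlt
    · rw [← heq]; simp
    · have hc : Real.cos Θ < 0 := Real.cos_neg_of_pi_div_two_lt_of_lt hlt (by linarith)
      have : 0 ≤ 2 * Real.sin Θ * √(Real.sin Θ) := by positivity
      nlinarith

lemma tipWidth_eq {Θ : ℝ} (hs : 0 ≤ Real.sin Θ) :
    tipWidth Θ = √(Real.sin Θ) * (2 * Real.cos Θ + rootSineIntegral Θ * √(Real.sin Θ)) := by
  have hr : √(Real.sin Θ) ^ 2 = Real.sin Θ := Real.sq_sqrt hs
  unfold tipWidth
  linear_combination -rootSineIntegral Θ * hr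

lemma tipWidth_pos_of_le_pi_div_two {Θ : ℝ} (h0 : 0 < Θ) (h2 : Θ ≤ Real.pi / 2) :
    0 < tipWidth Θ := by
  have hs' : 0 < Real.sin Θ := Real.sin_pos_of_pos_of_lt_pi h0 (by linarith [Real.pi_pos])
  have hc : 0 ≤ Real.cos Θ := Real.cos_nonneg_of_mem_Icc ⟨by linarith, h2⟩
  have hS := rootSineIntegral_pos h0 (by linarith [Real.pi_pos])
  unfold tipWidth
  positivity

/-- The set of angles with positive width is an interval. -/
lemma tipWidth_pos_of_le {Θ Θ' : ℝ} (h0 : 0 < Θ) (hle : Θ ≤ Θ') (hπ : Θ' < Real.pi)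
    (hw : 0 < tipWidth Θ') : 0 < tipWidth Θ := by
  rcases le_or_gt Θ (Real.pi / 2) with h2 | h2
  · exact tipWidth_pos_of_le_pi_div_two h0 h2
  have hanti : AntitoneOn (fun u => 2 * Real.cos u + rootSineIntegral u * √(Real.sin u))
      (Icc Θ Θ') := by
    have hsin : ∀ u ∈ Icc Θ Θ', 0 < Real.sin u := fun u hu =>
      Real.sin_pos_of_pos_of_lt_pi (h0.trans_le hu.1) (hu.2.trans_lt hπ)
    have hd : ∀ u ∈ Icc Θ Θ',
        HasDerivAt (fun u => 2 * Real.cos u + rootSineIntegral u * √(Real.sin u))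
          (-Real.sin u + rootSineIntegral u * Real.cos u / (2 * √(Real.sin u))) u := by
      intro u hu
      have hr : √(Real.sin u) ^ 2 = Real.sin u := Real.sq_sqrt (hsin u hu).le
      refine (((Real.hasDerivAt_cos u).const_mul 2).add
        ((hasDerivAt_rootSineIntegral u).mul (hasDerivAt_sqrt_sin (hsin u hu)))).congr_deriv ?_
      linear_combination hr
    refine antitoneOn_of_deriv_nonpos (convex_Icc _ _)
      (fun u hu => (hd u hu).continuousAt.continuousWithinAt)
      (fun u hu => (hd u (interior_subset hu)).differentiableAt.differentiableWithinAt) ?_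
    intro u hu
    have hu' := interior_subset hu
    rw [(hd u hu').deriv]
    have hc : Real.cos u ≤ 0 :=
      Real.cos_nonpos_of_pi_div_two_le_of_le (h2.le.trans hu'.1) (by linarith [hu'.2])
    have hS := rootSineIntegral_pos (h0.trans_le hu'.1) (hu'.2.trans hπ.le)
    have : rootSineIntegral u * Real.cos u / (2 * √(Real.sin u)) ≤ 0 :=
      div_nonpos_of_nonpos_of_nonneg (mul_nonpos_of_nonneg_of_nonpos hS.le hc) (by positivity)
    linarith [hsin u hu']
  have hs : 0 < Real.sin Θ := Real.sin_pos_of_pos_of_lt_pi h0 (hle.trans_lt hπ)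
  have hs' : 0 < Real.sin Θ' := Real.sin_pos_of_pos_of_lt_pi (h0.trans_le hle) hπ
  rw [tipWidth_eq hs'.le] at hw
  rw [tipWidth_eq hs.le]
  have hq := (mul_pos_iff_of_pos_left (Real.sqrt_pos.2 hs')).1 hw
  exact mul_pos (Real.sqrt_pos.2 hs)
    (hq.trans_le (hanti ⟨le_rfl, hle⟩ ⟨hle, le_rfl⟩ hle))

/-- The quantity that governs the monotonicity of both the slope of the chord and the energy. -/
lemma monotonicity_quantity_pos {Θ : ℝ} (h0 : 0 < Θ) (hπ : Θ < Real.pi) (hw : 0 ≤ tipWidth Θ) :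
    0 < 2 * Real.sin Θ + rootSineIntegral Θ ^ 2
      + rootSineIntegral Θ * Real.cos Θ / √(Real.sin Θ) := by
  have hs : 0 < Real.sin Θ := Real.sin_pos_of_pos_of_lt_pi h0 hπ
  have hr0 : 0 < √(Real.sin Θ) := Real.sqrt_pos.2 hs
  have hS := rootSineIntegral_pos h0 hπ.le
  rcases le_or_gt 0 (Real.cos Θ) with hc | hc
  · positivity
  · rw [tipWidth_eq hs.le] at hw
    have hq : 0 ≤ 2 * Real.cos Θ + rootSineIntegral Θ * √(Real.sin Θ) :=
      nonneg_of_mul_nonneg_right hw hr0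
    have h1 : 0 ≤ rootSineIntegral Θ ^ 2
      + rootSineIntegral Θ * Real.cos Θ / √(Real.sin Θ) := by
      have : rootSineIntegral Θ ^ 2 + rootSineIntegral Θ * Real.cos Θ / √(Real.sin Θ)
          = rootSineIntegral Θ * (rootSineIntegral Θ * √(Real.sin Θ) + Real.cos Θ)
            / √(Real.sin Θ) := by
        field_simp
      rw [this]
      exact div_nonneg (mul_nonneg hS.le (by linarith)) hr0.le
    linarith

/-- The slope of the chord from the inflection point to the tip is increasing in the angle. -/
lemma tip_slope_lt {Θ Θ' : ℝ} (h0 : 0 < Θ) (hlt : Θ < Θ') (hπ : Θ' < Real.pi)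
    (hw : 0 < tipWidth Θ') : tipHeight Θ * tipWidth Θ' < tipHeight Θ' * tipWidth Θ := by
  have hpos : ∀ u ∈ Icc Θ Θ', 0 < tipWidth u := fun u hu =>
    tipWidth_pos_of_le (h0.trans_le hu.1) hu.2 hπ hw
  have hsin : ∀ u ∈ Icc Θ Θ', 0 < Real.sin u := fun u hu =>
    Real.sin_pos_of_pos_of_lt_pi (h0.trans_le hu.1) (hu.2.trans_lt hπ)
  have hmono : StrictMonoOn (fun u => tipHeight u / tipWidth u) (Icc Θ Θ') := by
    have hd : ∀ u ∈ Icc Θ Θ', HasDerivAt (fun u => tipHeight u / tipWidth u)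
        ((2 * Real.sin u + rootSineIntegral u ^ 2
          + rootSineIntegral u * Real.cos u / √(Real.sin u)) / tipWidth u ^ 2) u := by
      intro u hu
      have hr : √(Real.sin u) ^ 2 = Real.sin u := Real.sq_sqrt (hsin u hu).le
      have hr0 : 0 < √(Real.sin u) := Real.sqrt_pos.2 (hsin u hu)
      refine ((hasDerivAt_tipHeight (hsin u hu)).div (hasDerivAt_tipWidth (hsin u hu))
        (hpos u hu).ne').congr_deriv ?_
      congr 1
      have h1 := tipHeight_sq_add_tipWidth_sq (hsin u hu).le
      have h2 : tipHeight u / √(Real.sin u) = 2 * Real.sin u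
          - rootSineIntegral u * Real.cos u / √(Real.sin u) := by
        unfold tipHeight; field_simp
      linear_combination h1 - h2
    refine strictMonoOn_of_deriv_pos (convex_Icc _ _)
      (fun u hu => (hd u hu).continuousAt.continuousWithinAt) ?_
    intro u hu
    have hu' := interior_subset hu
    rw [(hd u hu').deriv]
    exact div_pos (monotonicity_quantity_pos (h0.trans_le hu'.1) (hu'.2.trans_lt hπ)
      (hpos u hu').le) (pow_pos (hpos u hu') 2)
  have := hmono ⟨le_rfl, hlt.le⟩ ⟨hlt.le, le_rfl⟩ hlt
  rwa [div_lt_div_iff₀ (hpos _ ⟨le_rfl, hlt.le⟩) hw] at this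

/-- Beyond the angle `π/2` the energy of the elastica decreases. -/
lemma rootSineIntegral_mul_tipWidth_lt {Θ Θ' : ℝ} (h2 : Real.pi / 2 ≤ Θ) (hlt : Θ < Θ')
    (hπ : Θ' < Real.pi) (hw : 0 < tipWidth Θ') :
    rootSineIntegral Θ' * tipWidth Θ' < rootSineIntegral Θ * tipWidth Θ := by
  have h0 : 0 < Θ := by linarith [Real.pi_pos]
  have hpos : ∀ u ∈ Icc Θ Θ', 0 < tipWidth u := fun u hu =>
    tipWidth_pos_of_le (h0.trans_le hu.1) hu.2 hπ hw
  have hsin : ∀ u ∈ Icc Θ Θ', 0 < Real.sin u := fun u hu =>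
    Real.sin_pos_of_pos_of_lt_pi (h0.trans_le hu.1) (hu.2.trans_lt hπ)
  have hd : ∀ u ∈ Icc Θ Θ', HasDerivAt (fun u => rootSineIntegral u * tipWidth u)
      (Real.cos u * (2 * Real.sin u + rootSineIntegral u ^ 2
          + rootSineIntegral u * Real.cos u / √(Real.sin u))) u := by
    intro u hu
    have hr : √(Real.sin u) ^ 2 = Real.sin u := Real.sq_sqrt (hsin u hu).le
    have hr0 : 0 < √(Real.sin u) := Real.sqrt_pos.2 (hsin u hu)
    refine ((hasDerivAt_rootSineIntegral u).mul
      (hasDerivAt_tipWidth (hsin u hu))).congr_deriv ?_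
    have hcs : Real.cos u ^ 2 = 1 - Real.sin u ^ 2 := by linarith [Real.sin_sq_add_cos_sq u]
    unfold tipHeight tipWidth
    field_simp
    linear_combination (2 * √(Real.sin u) * Real.cos u - rootSineIntegral u * Real.sin u) * hr
      - rootSineIntegral u * hcs
  have hanti : StrictAntiOn (fun u => rootSineIntegral u * tipWidth u) (Icc Θ Θ') := by
    refine strictAntiOn_of_deriv_neg (convex_Icc _ _)
      (fun u hu => (hd u hu).continuousAt.continuousWithinAt) ?_
    intro u hu
    have hu' := interior_subset hu
    rw [interior_Icc] at hu
    rw [(hd u hu').deriv]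
    refine mul_neg_of_neg_of_pos
      (Real.cos_neg_of_pi_div_two_lt_of_lt (h2.trans_lt hu.1) (by linarith [hu.2])) ?_
    exact monotonicity_quantity_pos (h0.trans_le hu'.1) (hu'.2.trans_lt hπ) (hpos u hu').le
  exact hanti ⟨le_rfl, hlt.le⟩ ⟨hlt.le, le_rfl⟩ hlt

lemma tip_slope_le {Θ Θ' : ℝ} (h0 : 0 < Θ) (hle : Θ ≤ Θ') (hπ : Θ' < Real.pi)
    (hw : 0 < tipWidth Θ') : tipHeight Θ * tipWidth Θ' ≤ tipHeight Θ' * tipWidth Θ := by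
  rcases hle.eq_or_lt with h | h
  · rw [h]
  · exact (tip_slope_lt h0 h hπ hw).le

/-- The inequality behind local minimality. The quotient of the two sides is smallest at `Φ`,
since its derivative has the sign of `tipWidth Φ * tipHeight Θ - tipHeight Φ * tipWidth Θ`. -/
lemma rootSineIntegral_mul_le_sq {Φ Θ : ℝ} (hΦ : Φ ∈ Ioo 0 (Real.pi / 2))
    (hΘ : Θ ∈ Ioo 0 (Real.pi / 2)) :
    rootSineIntegral Φ * (tipWidth Φ * Real.sin Θ - tipHeight Φ * Real.cos Θ)
      ≤ rootSineIntegral Θ ^ 2 := by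
  have hpi := Real.pi_pos
  have hg := tipWidth_pos_of_le_pi_div_two hΦ.1 hΦ.2.le
  have hf := tipHeight_pos hΦ.1 (by linarith [hΦ.2])
  have hSΦ := rootSineIntegral_pos hΦ.1 (by linarith [hΦ.2])
  have hSΘ := rootSineIntegral_pos hΘ.1 (by linarith [hΘ.2])
  set u : ℝ → ℝ := fun x => tipWidth Φ * Real.sin x - tipHeight Φ * Real.cos x with hu
  have huΦ : u Φ = rootSineIntegral Φ := tipWidth_mul_sin_sub_tipHeight_mul_cos Φ
  rcases le_or_gt (u Θ) 0 with hneg | hpos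
  · exact (mul_nonpos_of_nonneg_of_nonpos hSΦ.le hneg).trans (sq_nonneg _)
  have hu' : ∀ x, HasDerivAt u (tipWidth Φ * Real.cos x + tipHeight Φ * Real.sin x) x := by
    intro x
    refine (((Real.hasDerivAt_sin x).const_mul _).sub
      ((Real.hasDerivAt_cos x).const_mul _)).congr_deriv ?_
    ring
  have humono : MonotoneOn u (Icc 0 (Real.pi / 2)) := by
    refine monotoneOn_of_deriv_nonneg (convex_Icc _ _)
      (fun x _ => (hu' x).continuousAt.continuousWithinAt)
      (fun x _ => (hu' x).differentiableAt.differentiableWithinAt) ?_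
    intro x hx
    have hx' := interior_subset hx
    rw [(hu' x).deriv]
    have h1 := Real.cos_nonneg_of_mem_Icc ⟨by linarith [hx'.1], hx'.2⟩
    have h2 := Real.sin_nonneg_of_nonneg_of_le_pi hx'.1 (by linarith [hx'.2])
    positivity
  have hd : ∀ x ∈ Ioo 0 (Real.pi / 2), 0 < u x →
      HasDerivAt (fun x => rootSineIntegral x ^ 2 / u x) (rootSineIntegral x *
        (tipHeight x * tipWidth Φ - tipHeight Φ * tipWidth x) / u x ^ 2) x := by
    intro x hx hux
    refine (((hasDerivAt_rootSineIntegral x).pow 2).div (hu' x) hux.ne').congr_deriv ?_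
    congr 1
    simp only [hu, Pi.pow_apply]
    unfold tipHeight tipWidth
    push_cast; ring
  have hgoal : rootSineIntegral Φ ^ 2 / u Φ ≤ rootSineIntegral Θ ^ 2 / u Θ := by
    have huΦpos : 0 < u Φ := by rw [huΦ]; exact hSΦ
    rcases le_total Θ Φ with hle | hle
    · have hsub : ∀ x ∈ Icc Θ Φ, x ∈ Ioo 0 (Real.pi / 2) ∧ 0 < u x := fun x hx =>
        ⟨⟨hΘ.1.trans_le hx.1, hx.2.trans_lt hΦ.2⟩, hpos.trans_le
          (humono ⟨hΘ.1.le, hΘ.2.le⟩ ⟨hΘ.1.le.trans hx.1, hx.2.trans hΦ.2.le⟩ hx.1)⟩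
      have hanti : AntitoneOn (fun x => rootSineIntegral x ^ 2 / u x) (Icc Θ Φ) := by
        refine antitoneOn_of_deriv_nonpos (convex_Icc _ _)
          (fun x hx => (hd x (hsub x hx).1 (hsub x hx).2).continuousAt.continuousWithinAt)
          (fun x hx => (hd x (hsub x (interior_subset hx)).1
            (hsub x (interior_subset hx)).2).differentiableAt.differentiableWithinAt) ?_
        intro x hx
        have hx' := interior_subset hx
        obtain ⟨h1, h2⟩ := hsub x hx'
        rw [(hd x h1 h2).deriv]
        refine div_nonpos_of_nonpos_of_nonneg (mul_nonpos_of_nonneg_of_nonpos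
          (rootSineIntegral_pos h1.1 (by linarith [h1.2])).le ?_) (sq_nonneg _)
        linarith [tip_slope_le h1.1 hx'.2 (by linarith [hΦ.2]) hg]
      exact hanti ⟨le_rfl, hle⟩ ⟨hle, le_rfl⟩ hle
    · have hsub : ∀ x ∈ Icc Φ Θ, x ∈ Ioo 0 (Real.pi / 2) ∧ 0 < u x := fun x hx =>
        ⟨⟨hΦ.1.trans_le hx.1, hx.2.trans_lt hΘ.2⟩, huΦpos.trans_le
          (humono ⟨hΦ.1.le, hΦ.2.le⟩ ⟨hΦ.1.le.trans hx.1, hx.2.trans hΘ.2.le⟩ hx.1)⟩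
      have hmono : MonotoneOn (fun x => rootSineIntegral x ^ 2 / u x) (Icc Φ Θ) := by
        refine monotoneOn_of_deriv_nonneg (convex_Icc _ _)
          (fun x hx => (hd x (hsub x hx).1 (hsub x hx).2).continuousAt.continuousWithinAt)
          (fun x hx => (hd x (hsub x (interior_subset hx)).1
            (hsub x (interior_subset hx)).2).differentiableAt.differentiableWithinAt) ?_
        intro x hx
        have hx' := interior_subset hx
        obtain ⟨h1, h2⟩ := hsub x hx'
        rw [(hd x h1 h2).deriv]
        refine div_nonneg (mul_nonneg
          (rootSineIntegral_pos h1.1 (by linarith [h1.2])).le ?_) (sq_nonneg _)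
        linarith [tip_slope_le hΦ.1 hx'.1 (by linarith [h1.2])
          (tipWidth_pos_of_le_pi_div_two h1.1 h1.2.le)]
      exact hmono ⟨le_rfl, hle⟩ ⟨hle, le_rfl⟩ hle
  rw [huΦ, sq, mul_div_assoc, div_self hSΦ.ne', mul_one, le_div_iff₀ hpos] at hgoal
  exact hgoal

/-- Every positive slope is attained. -/
lemma exists_tip_slope {h : ℝ} (hh : 0 < h) :
    ∃ Θ ∈ Ioo 0 Real.pi, 0 < tipWidth Θ ∧ tipHeight Θ = 2 * h * tipWidth Θ := by
  set β := Real.arctan (2 * h) with hβ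
  have hβ0 : 0 < β := Real.arctan_pos.2 (by linarith)
  have hβ2 : β < Real.pi / 2 := Real.arctan_lt_pi_div_two _
  have hpi := Real.pi_pos
  have hc : 0 < Real.cos β := Real.cos_arctan_pos _
  have hsc : Real.sin β = 2 * h * Real.cos β := by
    have := Real.tan_arctan (2 * h)
    rw [← hβ, Real.tan_eq_sin_div_cos, div_eq_iff hc.ne'] at this
    exact this
  have hcont : ContinuousOn (fun Θ => tipHeight Θ - 2 * h * tipWidth Θ) (Icc β Real.pi) :=
    (continuous_tipHeight.sub (continuous_const.mul continuous_tipWidth)).continuousOn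
  have h1 : tipHeight β - 2 * h * tipWidth β < 0 := by
    have hS := rootSineIntegral_pos hβ0 (by linarith)
    have hs : 0 < Real.sin β := by rw [hsc]; positivity
    have : tipHeight β - 2 * h * tipWidth β = 2 * √(Real.sin β) * (Real.sin β - 2 * h * Real.cos β)
        - rootSineIntegral β * (Real.cos β + 2 * h * Real.sin β) := by
      unfold tipHeight tipWidth; ring
    rw [this, hsc, sub_self, mul_zero]
    have : 0 < rootSineIntegral β * (Real.cos β + 2 * h * (2 * h * Real.cos β)) := by positivity
    linarith
  have h2 : 0 < tipHeight Real.pi - 2 * h * tipWidth Real.pi := by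
    have := rootSineIntegral_pos hpi le_rfl
    simp [tipHeight, tipWidth, this]
  obtain ⟨Θ, hΘ, hz⟩ := intermediate_value_Ioo (by linarith) hcont
    (show (0 : ℝ) ∈ Ioo _ _ from ⟨h1, h2⟩)
  have heq : tipHeight Θ = 2 * h * tipWidth Θ := by simpa [sub_eq_zero] using hz
  refine ⟨Θ, ⟨hβ0.trans hΘ.1, hΘ.2⟩, ?_, heq⟩
  have := tipHeight_pos (hβ0.trans hΘ.1) hΘ.2.le
  rw [heq] at this
  exact pos_of_mul_pos_right this (by linarith)

lemma tip_slope_unique {h Θ Θ' : ℝ} (hΘ : Θ ∈ Ioo 0 Real.pi) (hΘ' : Θ' ∈ Ioo 0 Real.pi)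
    (hw : 0 < tipWidth Θ) (hw' : 0 < tipWidth Θ')
    (he : tipHeight Θ = 2 * h * tipWidth Θ) (he' : tipHeight Θ' = 2 * h * tipWidth Θ') :
    Θ = Θ' := by
  rcases lt_trichotomy Θ Θ' with hlt | heq | hlt
  · have := tip_slope_lt hΘ.1 hlt hΘ'.2 hw'
    rw [he, he'] at this
    nlinarith
  · exact heq
  · have := tip_slope_lt hΘ'.1 hlt hΘ.2 hw
    rw [he, he'] at this
    nlinarith

/-! ### The critical height -/

/-- The substitution `x = sin² t` in the Beta integral. -/
lemma rootSineIntegral_pi_div_two :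
    rootSineIntegral (Real.pi / 2) = ProbabilityTheory.beta (3 / 4) (1 / 2) / 2 := by
  have hpi := Real.pi_pos
  have hbeta : ProbabilityTheory.beta (3 / 4) (1 / 2)
      = ∫ x in Ioo (0 : ℝ) 1, x ^ (-(1 / 4) : ℝ) * (1 - x) ^ (-(1 / 2) : ℝ) := by
    rw [ProbabilityTheory.beta_eq_betaIntegralReal _ _ (by norm_num) (by norm_num),
      Complex.betaIntegral, intervalIntegral.integral_of_le zero_le_one,
      integral_Ioc_eq_integral_Ioo]
    have : ∫ x in Ioo (0 : ℝ) 1, (x : ℂ) ^ (((3 / 4 : ℝ) : ℂ) - 1)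
          * (1 - (x : ℂ)) ^ (((1 / 2 : ℝ) : ℂ) - 1)
        = ∫ x in Ioo (0 : ℝ) 1,
          ((x ^ (-(1 / 4) : ℝ) * (1 - x) ^ (-(1 / 2) : ℝ) : ℝ) : ℂ) := by
      refine setIntegral_congr_fun measurableSet_Ioo fun x hx => ?_
      rw [Complex.ofReal_mul, Complex.ofReal_cpow hx.1.le,
        Complex.ofReal_cpow (by linarith [hx.2])]
      congr 2 <;> push_cast <;> ring_nf
    rw [this, integral_complex_ofReal, Complex.ofReal_re]
  have himg : (fun t => Real.sin t ^ 2) '' Ioo 0 (Real.pi / 2) = Ioo (0 : ℝ) 1 := by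
    ext x
    constructor
    · rintro ⟨t, ht, rfl⟩
      have hs := Real.sin_pos_of_pos_of_lt_pi ht.1 (by linarith [ht.2])
      have hc := Real.cos_pos_of_mem_Ioo ⟨by linarith [ht.1], ht.2⟩
      exact ⟨by positivity, by nlinarith [Real.sin_sq_add_cos_sq t]⟩
    · intro hx
      have h1 : 0 < √x := Real.sqrt_pos.2 hx.1
      have h2 : √x < 1 := by rw [Real.sqrt_lt' one_pos]; simpa using hx.2
      refine ⟨Real.arcsin (√x), ⟨Real.arcsin_pos.2 h1, Real.arcsin_lt_pi_div_two.2 h2⟩, ?_⟩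
      simp only
      rw [Real.sin_arcsin (by linarith) h2.le, Real.sq_sqrt hx.1.le]
  have hinj : InjOn (fun t => Real.sin t ^ 2) (Ioo 0 (Real.pi / 2)) := by
    intro s hs t ht hst
    have h1 := Real.sin_pos_of_pos_of_lt_pi hs.1 (by linarith [hs.2])
    have h2 := Real.sin_pos_of_pos_of_lt_pi ht.1 (by linarith [ht.2])
    have h3 : Real.sin s = Real.sin t := (sq_eq_sq₀ h1.le h2.le).1 hst
    exact Real.injOn_sin ⟨by linarith [hs.1], hs.2.le⟩ ⟨by linarith [ht.1], ht.2.le⟩ h3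
  have hder : ∀ t ∈ Ioo 0 (Real.pi / 2), HasDerivWithinAt (fun t => Real.sin t ^ 2)
      (2 * Real.sin t * Real.cos t) (Ioo 0 (Real.pi / 2)) t := by
    intro t _
    refine (((Real.hasDerivAt_sin t).pow 2).congr_deriv ?_).hasDerivWithinAt
    push_cast; ring
  have hcv := integral_image_eq_integral_abs_deriv_smul measurableSet_Ioo hder hinj
    (fun x => x ^ (-(1 / 4) : ℝ) * (1 - x) ^ (-(1 / 2) : ℝ))
  rw [himg] at hcv
  have hfin : ∫ t in Ioo 0 (Real.pi / 2), |2 * Real.sin t * Real.cos t| •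
      ((Real.sin t ^ 2) ^ (-(1 / 4) : ℝ) * (1 - Real.sin t ^ 2) ^ (-(1 / 2) : ℝ))
      = ∫ t in Ioo 0 (Real.pi / 2), 2 * √(Real.sin t) := by
    refine setIntegral_congr_fun measurableSet_Ioo fun t ht => ?_
    have hs := Real.sin_pos_of_pos_of_lt_pi ht.1 (by linarith [ht.2])
    have hc := Real.cos_pos_of_mem_Ioo ⟨by linarith [ht.1], ht.2⟩
    simp only [smul_eq_mul]
    rw [abs_of_pos (by positivity), show 1 - Real.sin t ^ 2 = Real.cos t ^ 2 by
      linarith [Real.sin_sq_add_cos_sq t], ← Real.rpow_natCast (Real.sin t),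
      ← Real.rpow_natCast (Real.cos t), ← Real.rpow_mul hs.le, ← Real.rpow_mul hc.le]
    have e1 : Real.cos t ^ ((2 : ℕ) * -(1 / 2) : ℝ) = (Real.cos t)⁻¹ := by
      rw [← Real.rpow_neg_one]; norm_num
    have e2 : Real.sin t * Real.sin t ^ ((2 : ℕ) * -(1 / 4) : ℝ) = √(Real.sin t) := by
      rw [Real.sqrt_eq_rpow]
      nth_rewrite 1 [← Real.rpow_one (Real.sin t)]
      rw [← Real.rpow_add hs]; norm_num
    rw [e1, ← e2]
    field_simp
  have : rootSineIntegral (Real.pi / 2) = ∫ t in Ioo 0 (Real.pi / 2), √(Real.sin t) := by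
    rw [rootSineIntegral, intervalIntegral.integral_of_le (by linarith),
      integral_Ioc_eq_integral_Ioo]
  rw [hbeta, hcv, hfin, integral_const_mul, this]
  ring

/-- The critical height is the height of the tip for the initial angle `π / 2`, and this height
increases with the angle. -/
lemma lt_criticalHeight_iff {h Θ : ℝ} (hΘ : Θ ∈ Ioo 0 Real.pi) (hw : 0 < tipWidth Θ)
    (he : tipHeight Θ = 2 * h * tipWidth Θ) : h < criticalHeight ↔ Θ < Real.pi / 2 := by
  have hpi := Real.pi_pos
  have hS := rootSineIntegral_pos (Θ := Real.pi / 2) (by linarith) (by linarith)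
  have hcrit : criticalHeight * rootSineIntegral (Real.pi / 2) = 1 := by
    have hb := ProbabilityTheory.beta_pos (α := 3 / 4) (β := 1 / 2) (by norm_num) (by norm_num)
    rw [criticalHeight, rootSineIntegral_pi_div_two]
    field_simp
  have hf2 : tipHeight (Real.pi / 2) = 2 := by simp [tipHeight]
  have hg2 : tipWidth (Real.pi / 2) = rootSineIntegral (Real.pi / 2) := by simp [tipWidth]
  constructor
  · intro hlt
    by_contra hge
    push Not at hge
    have := tip_slope_le (by linarith) hge hΘ.2 hw
    rw [hf2, hg2, he] at this
    have h3 : h * rootSineIntegral (Real.pi / 2) < 1 := by nlinarith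
    nlinarith
  · intro hlt
    have := tip_slope_lt hΘ.1 hlt (by linarith) (by rw [hg2]; exact hS)
    rw [hf2, hg2, he] at this
    by_contra hge
    push Not at hge
    have h3 : 1 ≤ h * rootSineIntegral (Real.pi / 2) := by nlinarith
    nlinarith

/-! ### Coordinates of the plane -/

lemma norm_sq_plane (v : Plane) : ‖v‖ ^ 2 = v 0 ^ 2 + v 1 ^ 2 := by
  simp [EuclideanSpace.norm_sq_eq, Fin.sum_univ_two]

lemma abs_apply_le_norm (v : Plane) (i : Fin 2) : |v i| ≤ ‖v‖ := by
  simpa using PiLp.norm_apply_le v i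

lemma hasDerivWithinAt_plane {f : ℝ → Plane} {f' : Plane} {s : Set ℝ} {x : ℝ} :
    HasDerivWithinAt f f' s x ↔ ∀ i, HasDerivWithinAt (fun x => f x i) (f' i) s x := by
  rw [hasDerivWithinAt_iff_hasFDerivWithinAt, hasFDerivWithinAt_euclidean]
  refine forall_congr' fun i => ?_
  rw [hasDerivWithinAt_iff_hasFDerivWithinAt]
  congr! 1

lemma hasDerivAt_plane {f : ℝ → Plane} {f' : Plane} {x : ℝ} :
    HasDerivAt f f' x ↔ ∀ i, HasDerivAt (fun x => f x i) (f' i) x := by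
  simp only [← hasDerivWithinAt_univ, hasDerivWithinAt_plane]

lemma continuous_plane_mk {X : Type*} [TopologicalSpace X] {a b : X → ℝ} (ha : Continuous a)
    (hb : Continuous b) : Continuous fun x => (!₂[a x, b x] : Plane) := by
  refine (PiLp.continuous_toLp 2 _).comp (continuous_pi fun i => ?_)
  fin_cases i
  · exact ha
  · exact hb

lemma plane_eq {v w : Plane} (h0 : v 0 = w 0) (h1 : v 1 = w 1) : v = w := by
  ext i; fin_cases i
  · exact h0
  · exact h1

lemma intervalIntegral_apply {f : ℝ → Plane} {a b : ℝ} (hf : IntervalIntegrable f volume a b)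
    (i : Fin 2) : (∫ t in a..b, f t) i = ∫ t in a..b, f t i :=
  ((EuclideanSpace.proj (𝕜 := ℝ) i : Plane →L[ℝ] ℝ).intervalIntegral_comp_comm hf).symm

/-- The unit vector with angle `θ`. -/
def dir (θ : ℝ) : Plane := !₂[Real.cos θ, Real.sin θ]

/-- The unit vector with angle `θ`, rotated counterclockwise by `π / 2`. -/
def dirPerp (θ : ℝ) : Plane := !₂[-Real.sin θ, Real.cos θ]

@[simp] lemma dir_zero (θ : ℝ) : dir θ 0 = Real.cos θ := rfl
@[simp] lemma dir_one (θ : ℝ) : dir θ 1 = Real.sin θ := rfl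
@[simp] lemma dirPerp_zero (θ : ℝ) : dirPerp θ 0 = -Real.sin θ := rfl
@[simp] lemma dirPerp_one (θ : ℝ) : dirPerp θ 1 = Real.cos θ := rfl

@[simp] lemma norm_dir (θ : ℝ) : ‖dir θ‖ = 1 := by
  have h := norm_sq_plane (dir θ)
  rw [dir_zero, dir_one, Real.cos_sq_add_sin_sq] at h
  exact (pow_eq_one_iff_of_nonneg (norm_nonneg _) two_ne_zero).1 h

@[simp] lemma norm_dirPerp (θ : ℝ) : ‖dirPerp θ‖ = 1 := by
  have h := norm_sq_plane (dirPerp θ)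
  rw [dirPerp_zero, dirPerp_one, neg_sq, Real.sin_sq_add_cos_sq] at h
  exact (pow_eq_one_iff_of_nonneg (norm_nonneg _) two_ne_zero).1 h

lemma continuous_dir : Continuous dir :=
  continuous_plane_mk Real.continuous_cos Real.continuous_sin

lemma continuous_dirPerp : Continuous dirPerp :=
  continuous_plane_mk Real.continuous_sin.neg Real.continuous_cos

lemma hasDerivAt_dir (θ : ℝ) : HasDerivAt dir (dirPerp θ) θ := by
  rw [hasDerivAt_plane]
  intro i; fin_cases i
  · exact Real.hasDerivAt_cos θ
  · exact Real.hasDerivAt_sin θ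

lemma hasDerivAt_dirPerp (θ : ℝ) : HasDerivAt dirPerp (-dir θ) θ := by
  rw [hasDerivAt_plane]
  intro i; fin_cases i
  · exact (Real.hasDerivAt_sin θ).neg
  · exact Real.hasDerivAt_cos θ

lemma norm_dir_sub_le (θ θ' : ℝ) : ‖dir θ - dir θ'‖ ≤ |θ - θ'| := by
  have := Convex.norm_image_sub_le_of_norm_hasDerivWithin_le (s := univ) (C := 1)
    (fun x _ => (hasDerivAt_dir x).hasDerivWithinAt) (fun x _ => (norm_dirPerp x).le)
    convex_univ (mem_univ θ') (mem_univ θ)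
  simpa using this

lemma norm_dirPerp_sub_le (θ θ' : ℝ) : ‖dirPerp θ - dirPerp θ'‖ ≤ |θ - θ'| := by
  have := Convex.norm_image_sub_le_of_norm_hasDerivWithin_le (s := univ) (C := 1)
    (fun x _ => (hasDerivAt_dirPerp x).hasDerivWithinAt)
    (fun x _ => by rw [norm_neg]; exact (norm_dir x).le)
    convex_univ (mem_univ θ') (mem_univ θ)
  simpa using this

/-! ### Absolutely continuous functions with square integrable derivative -/

lemma _root_.AbsolutelyContinuousOnInterval.comp_lipschitzOnWith {X Y : Type*} [PseudoMetricSpace X]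
    [PseudoMetricSpace Y] {f : ℝ → X} {F : X → Y} {K : NNReal} {s : Set X} {a b : ℝ}
    (hf : AbsolutelyContinuousOnInterval f a b) (hF : LipschitzOnWith K F s)
    (hs : MapsTo f (uIcc a b) s) : AbsolutelyContinuousOnInterval (fun x => F (f x)) a b := by
  unfold AbsolutelyContinuousOnInterval at hf ⊢
  have h := hf.const_mul (K : ℝ)
  rw [mul_zero] at h
  refine squeeze_zero' (Eventually.of_forall fun E => Finset.sum_nonneg fun _ _ => dist_nonneg)
    ?_ h
  refine eventually_inf_principal.2 (Eventually.of_forall fun E hE => ?_)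
  rw [Finset.mul_sum]
  exact Finset.sum_le_sum fun i hi => hF.dist_le_mul _ (hs (hE.1 i hi).1) _ (hs (hE.1 i hi).2)

/-- `f ∈ W^{1,2}(0,1)` with weak derivative `g`: the function `f` is absolutely continuous on
`[0,1]` and its pointwise derivative is almost everywhere equal to the square integrable `g`. -/
structure IsW12 {E : Type*} [NormedAddCommGroup E] [NormedSpace ℝ E] (f g : ℝ → E) : Prop where
  ac : AbsolutelyContinuousOnInterval f 0 1
  memLp : MemLp g 2 (volume.restrict (Icc 0 1))
  ae_deriv : ∀ᵐ x, x ∈ Ioo (0 : ℝ) 1 → HasDerivAt f (g x) x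

lemma ae_restrict_Icc_of_Ioo {p : ℝ → Prop} (h : ∀ᵐ x, x ∈ Ioo (0 : ℝ) 1 → p x) :
    ∀ᵐ x ∂(volume.restrict (Icc (0 : ℝ) 1)), p x := by
  rw [← restrict_Ioo_eq_restrict_Icc, ae_restrict_iff' measurableSet_Ioo]
  exact h

lemma intervalIntegral_eq_setIntegral_Icc {E : Type*} [NormedAddCommGroup E] [NormedSpace ℝ E]
    (f : ℝ → E) : ∫ x in (0 : ℝ)..1, f x = ∫ x in Icc (0 : ℝ) 1, f x := by
  rw [intervalIntegral.integral_of_le zero_le_one, integral_Icc_eq_integral_Ioc]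

lemma integral_congr_of_Ioo {E : Type*} [NormedAddCommGroup E] [NormedSpace ℝ E] {f g : ℝ → E}
    {a b : ℝ} (hab : a ≤ b) (h : ∀ᵐ x, x ∈ Ioo a b → f x = g x) :
    ∫ x in a..b, f x = ∫ x in a..b, g x := by
  rw [intervalIntegral.integral_of_le hab, intervalIntegral.integral_of_le hab,
    integral_Ioc_eq_integral_Ioo, integral_Ioc_eq_integral_Ioo]
  exact setIntegral_congr_ae measurableSet_Ioo h

lemma intervalIntegrable_of_integrableOn_Icc {E : Type*} [NormedAddCommGroup E] {g : ℝ → E}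
    (hg : IntegrableOn g (Icc 0 1)) {a b : ℝ} (ha : a ∈ Icc (0 : ℝ) 1) (hb : b ∈ Icc (0 : ℝ) 1) :
    IntervalIntegrable g volume a b :=
  (hg.mono_set (uIcc_subset_Icc ha hb)).intervalIntegrable

lemma memLp_intervalIntegrable {E : Type*} [NormedAddCommGroup E] {g : ℝ → E}
    (hg : MemLp g 2 (volume.restrict (Icc 0 1))) {a b : ℝ} (ha : a ∈ Icc (0 : ℝ) 1)
    (hb : b ∈ Icc (0 : ℝ) 1) : IntervalIntegrable g volume a b :=
  intervalIntegrable_of_integrableOn_Icc (hg.integrable one_le_two) ha hb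

/-- The fundamental theorem of calculus for absolutely continuous functions. -/
lemma integral_eq_sub_of_ac {f g : ℝ → ℝ} (hf : AbsolutelyContinuousOnInterval f 0 1)
    (hfg : ∀ᵐ x, x ∈ Ioo (0 : ℝ) 1 → HasDerivAt f (g x) x) {a b : ℝ}
    (ha : a ∈ Icc (0 : ℝ) 1) (hb : b ∈ Icc (0 : ℝ) 1) (hab : a ≤ b) :
    ∫ x in a..b, g x = f b - f a := by
  rw [← (hf.mono (c := a) (d := b) (by
    rw [uIcc_of_le zero_le_one]; exact uIcc_subset_Icc ha hb)).integral_deriv_eq_sub]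
  refine integral_congr_of_Ioo hab ?_
  filter_upwards [hfg] with x hx hxm
  exact (hx ⟨ha.1.trans_lt hxm.1, hxm.2.trans_le hb.2⟩).deriv.symm

lemma IsW12.apply {V G : ℝ → Plane} (h : IsW12 V G) (i : Fin 2) :
    IsW12 (fun x => V x i) (fun x => G x i) where
  ac := h.ac.comp_lipschitzOnWith (F := fun v : Plane => v i) (s := univ)
    ((EuclideanSpace.proj (𝕜 := ℝ) i : Plane →L[ℝ] ℝ).lipschitz.lipschitzOnWith)
    (mapsTo_univ _ _)
  memLp := h.memLp.continuousLinearMap_comp (EuclideanSpace.proj (𝕜 := ℝ) i : Plane →L[ℝ] ℝ)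
  ae_deriv := by
    filter_upwards [h.ae_deriv] with x hx hxm
    exact hasDerivAt_plane.1 (hx hxm) i

lemma IsW12.integral_eq_sub {V G : ℝ → Plane} (h : IsW12 V G) {a b : ℝ}
    (ha : a ∈ Icc (0 : ℝ) 1) (hb : b ∈ Icc (0 : ℝ) 1) (hab : a ≤ b) :
    ∫ x in a..b, G x = V b - V a := by
  have hi := memLp_intervalIntegrable h.memLp ha hb
  have hi' : ∀ i, (∫ x in a..b, G x) i = (V b - V a) i := fun i => by
    rw [intervalIntegral_apply hi]
    exact integral_eq_sub_of_ac (h.apply i).ac (h.apply i).ae_deriv ha hb hab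
  exact plane_eq (hi' 0) (hi' 1)

lemma isW12_of_primitive {V g : ℝ → Plane} (hg : MemLp g 2 (volume.restrict (Icc 0 1)))
    (hV : ∀ x ∈ Icc (0 : ℝ) 1, V x = V 0 + ∫ t in (0 : ℝ)..x, g t) : IsW12 V g := by
  have h01 : (0 : ℝ) ∈ Icc (0 : ℝ) 1 := ⟨le_rfl, zero_le_one⟩
  have h11 : (1 : ℝ) ∈ Icc (0 : ℝ) 1 := ⟨zero_le_one, le_rfl⟩
  have hint := memLp_intervalIntegrable hg h01 h11
  have hcomp : ∀ i, AbsolutelyContinuousOnInterval (fun x => V x i) 0 1 := by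
    intro i
    have hgi : IntervalIntegrable (fun t => g t i) volume 0 1 :=
      memLp_intervalIntegrable
        (hg.continuousLinearMap_comp (EuclideanSpace.proj (𝕜 := ℝ) i : Plane →L[ℝ] ℝ)) h01 h11
    have h1 := hgi.absolutelyContinuousOnInterval_intervalIntegral (c := 0) (by simp)
    rw [absolutelyContinuousOnInterval_iff] at h1 ⊢
    intro ε hε
    obtain ⟨δ, hδ, hd⟩ := h1 ε hε
    refine ⟨δ, hδ, fun E hE hs => lt_of_le_of_lt (le_of_eq ?_) (hd E hE hs)⟩
    refine Finset.sum_congr rfl fun j hj => ?_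
    have hmem := hE.1 j hj
    rw [uIcc_of_le zero_le_one] at hmem
    have hval : ∀ x ∈ Icc (0 : ℝ) 1, V x i = V 0 i + ∫ t in (0 : ℝ)..x, g t i := fun x hx => by
      rw [hV x hx, PiLp.add_apply, intervalIntegral_apply (memLp_intervalIntegrable hg h01 hx)]
    rw [hval _ hmem.1, hval _ hmem.2, dist_add_left]
  refine ⟨?_, hg, ?_⟩
  · have hlin : ∀ v : Plane, LipschitzWith ‖v‖₊ fun r : ℝ => r • v := fun v =>
      LipschitzWith.of_dist_le_mul fun r s => by
        rw [dist_eq_norm, ← sub_smul, norm_smul, dist_eq_norm, mul_comm, coe_nnnorm]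
    have h := ((hcomp 0).comp_lipschitzOnWith (s := univ)
      ((hlin !₂[1, 0]).lipschitzOnWith) (mapsTo_univ _ _)).fun_add
      ((hcomp 1).comp_lipschitzOnWith (s := univ)
      ((hlin !₂[0, 1]).lipschitzOnWith) (mapsTo_univ _ _))
    convert h using 2 with x
    exact plane_eq (by simp) (by simp)
  · filter_upwards [hint.ae_hasDerivAt_integral] with x hx hxm
    have h1 := hx (by rw [uIcc_of_le zero_le_one]; exact Ioo_subset_Icc_self hxm) 0 (by simp)
    refine (h1.const_add (V 0)).congr_of_eventuallyEq ?_
    filter_upwards [Icc_mem_nhds hxm.1 hxm.2] with y hy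
    exact hV y hy

/-! ### Curves of class `W^{2,2}` -/

lemma IsW22.hasDerivWithinAt {γ : ℝ → Plane} (h : IsW22 γ) {x : ℝ} (hx : x ∈ Icc (0 : ℝ) 1) :
    HasDerivWithinAt γ (vel γ x) (Icc 0 1) x :=
  (h.1 x hx).hasDerivWithinAt

lemma IsW22.isW12_vel {γ : ℝ → Plane} (h : IsW22 γ) : IsW12 (vel γ) (acc γ) := by
  obtain ⟨-, g, hg, hv⟩ := h
  have h1 := isW12_of_primitive hg hv
  have heq : ∀ᵐ x, x ∈ Ioo (0 : ℝ) 1 → acc γ x = g x := by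
    filter_upwards [h1.ae_deriv] with x hx hxm
    exact (hx hxm).hasDerivWithinAt.derivWithin
      (uniqueDiffOn_Icc zero_lt_one x (Ioo_subset_Icc_self hxm))
  refine ⟨h1.ac, hg.ae_eq (EventuallyEq.symm (ae_restrict_Icc_of_Ioo heq)), ?_⟩
  filter_upwards [h1.ae_deriv, heq] with x hx he hxm
  rw [he hxm]; exact hx hxm

lemma IsW12.continuousOn {E : Type*} [NormedAddCommGroup E] [NormedSpace ℝ E] {f g : ℝ → E}
    (h : IsW12 f g) : ContinuousOn f (Icc 0 1) := by
  have := h.ac.continuousOn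
  rwa [uIcc_of_le zero_le_one] at this

lemma IsW22.continuousOn_vel {γ : ℝ → Plane} (h : IsW22 γ) : ContinuousOn (vel γ) (Icc 0 1) :=
  h.isW12_vel.continuousOn

/-- A curve of class `W^{2,2}` is the primitive of its velocity. -/
lemma IsW22.eq_integral_vel {γ : ℝ → Plane} (h : IsW22 γ) {x y : ℝ} (hx : x ∈ Icc (0 : ℝ) 1)
    (hy : y ∈ Icc (0 : ℝ) 1) (hxy : x ≤ y) : ∫ t in x..y, vel γ t = γ y - γ x := by
  have hsub : Icc x y ⊆ Icc 0 1 := Icc_subset_Icc hx.1 hy.2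
  refine intervalIntegral.integral_eq_sub_of_hasDerivAt_of_le hxy
    (fun t ht => (h.hasDerivWithinAt (hsub ht)).continuousWithinAt.mono hsub) ?_
    ((h.continuousOn_vel.mono hsub).intervalIntegrable_of_Icc hxy)
  intro t ht
  exact (h.hasDerivWithinAt (hsub (Ioo_subset_Icc_self ht))).hasDerivAt
    (Icc_mem_nhds (hx.1.trans_lt ht.1) (ht.2.trans_le hy.2))

lemma hasDerivAt_primitive {V : ℝ → Plane} (hV : Continuous V) (x : ℝ) :
    HasDerivAt (fun x => ∫ t in (0 : ℝ)..x, V t) (V x) x :=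
  intervalIntegral.integral_hasDerivAt_right (hV.intervalIntegrable _ _)
    (hV.stronglyMeasurableAtFilter _ _) hV.continuousAt

lemma vel_primitive {V : ℝ → Plane} (hV : Continuous V) {x : ℝ} (hx : x ∈ Icc (0 : ℝ) 1) :
    vel (fun x => ∫ t in (0 : ℝ)..x, V t) x = V x :=
  (hasDerivAt_primitive hV x).hasDerivWithinAt.derivWithin (uniqueDiffOn_Icc zero_lt_one x hx)

lemma isW22_primitive {V G : ℝ → Plane} (hV : Continuous V) (h : IsW12 V G) :
    IsW22 (fun x => ∫ t in (0 : ℝ)..x, V t) := by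
  refine ⟨fun x _ => (hasDerivAt_primitive hV x).differentiableAt.differentiableWithinAt, G,
    h.memLp, fun x hx => ?_⟩
  have h01 : (0 : ℝ) ∈ Icc (0 : ℝ) 1 := ⟨le_rfl, zero_le_one⟩
  rw [vel_primitive hV hx, vel_primitive hV h01, h.integral_eq_sub h01 hx hx.1]
  abel

lemma acc_ae_eq {γ V G : ℝ → Plane} (hv : ∀ x ∈ Icc (0 : ℝ) 1, vel γ x = V x) (h : IsW12 V G) :
    ∀ᵐ x, x ∈ Ioo (0 : ℝ) 1 → acc γ x = G x := by
  filter_upwards [h.ae_deriv] with x hx hxm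
  have hd : HasDerivWithinAt (vel γ) (G x) (Icc 0 1) x :=
    (hx hxm).hasDerivWithinAt.congr hv (hv x (Ioo_subset_Icc_self hxm))
  exact hd.derivWithin (uniqueDiffOn_Icc zero_lt_one x (Ioo_subset_Icc_self hxm))

lemma hasDerivAt_norm_plane {f : ℝ → Plane} {a : Plane} {x : ℝ} (hne : f x ≠ 0)
    (ha : HasDerivAt f a x) :
    HasDerivAt (fun y => ‖f y‖) ((f x 0 * a 0 + f x 1 * a 1) / ‖f x‖) x := by
  have hn : 0 < ‖f x‖ := norm_pos_iff.2 hne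
  have ha' := hasDerivAt_plane.1 ha
  have hs : √(f x 0 ^ 2 + f x 1 ^ 2) = ‖f x‖ := by
    rw [← norm_sq_plane, Real.sqrt_sq hn.le]
  have h3 : (fun y => ‖f y‖) = fun y => √(f y 0 ^ 2 + f y 1 ^ 2) := by
    ext y; rw [← norm_sq_plane, Real.sqrt_sq (norm_nonneg _)]
  rw [h3]
  refine ((((ha' 0).pow 2).add ((ha' 1).pow 2)).sqrt (by
    simp only [Pi.add_apply, Pi.pow_apply]; rw [← norm_sq_plane]; positivity)).congr_deriv ?_
  simp only [Pi.add_apply, Pi.pow_apply]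
  rw [hs]; norm_num; field_simp

/-- Functions that agree on `[0,1]` are simultaneously absolutely continuous there. -/
lemma absolutelyContinuous_congr {E : Type*} [NormedAddCommGroup E] {f g : ℝ → E}
    (h : AbsolutelyContinuousOnInterval f 0 1) (hfg : ∀ x ∈ Icc (0 : ℝ) 1, g x = f x) :
    AbsolutelyContinuousOnInterval g 0 1 := by
  rw [absolutelyContinuousOnInterval_iff] at h ⊢
  intro ε hε
  obtain ⟨δ, hδ, hd⟩ := h ε hε
  refine ⟨δ, hδ, fun E hE hs => lt_of_le_of_lt (le_of_eq ?_) (hd E hE hs)⟩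
  refine Finset.sum_congr rfl fun j hj => ?_
  have hmem := hE.1 j hj
  rw [uIcc_of_le zero_le_one] at hmem
  rw [hfg _ hmem.1, hfg _ hmem.2]

/-- The density of the bending energy in coordinates: `κ² |γ'| = (γ' ∧ γ'')² / |γ'|⁵`. -/
lemma energyDensity_eq {γ : ℝ → Plane} {a : Plane} {x : ℝ} (hx : x ∈ Ioo (0 : ℝ) 1)
    (hne : vel γ x ≠ 0) (ha : HasDerivAt (vel γ) a x) :
    ‖curvatureVec γ x‖ ^ 2 * ‖vel γ x‖
      = (vel γ x 0 * a 1 - vel γ x 1 * a 0) ^ 2 / ‖vel γ x‖ ^ 5 := by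
  have hn : 0 < ‖vel γ x‖ := norm_pos_iff.2 hne
  have hsq := norm_sq_plane (vel γ x)
  have hnd := hasDerivAt_norm_plane hne ha
  set n := ‖vel γ x‖ with hnn
  set ω := vel γ x 0 * a 1 - vel γ x 1 * a 0 with hω
  have hT : HasDerivAt (unitTangent γ) ((ω / n ^ 3) • !₂[-vel γ x 1, vel γ x 0]) x := by
    refine ((hnd.inv hn.ne').smul ha).congr_deriv (plane_eq ?_ ?_)
    · simp [← hnn]
      field_simp
      rw [hsq, hω]; ring
    · simp [← hnn]
      field_simp
      rw [hsq, hω]; ring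
  have hκ : curvatureVec γ x = n⁻¹ • ((ω / n ^ 3) • !₂[-vel γ x 1, vel γ x 0]) := by
    rw [curvatureVec, hT.hasDerivWithinAt.derivWithin
      (uniqueDiffOn_Icc zero_lt_one x (Ioo_subset_Icc_self hx))]
  rw [hκ, norm_sq_plane]
  simp
  field_simp
  rw [hsq]; ring

/-! ### The distance in `W^{2,2}` controls the velocities -/

lemma sq_integral_le_integral_sq {f : ℝ → ℝ} (hf : MemLp f 2 (volume.restrict (Icc 0 1))) :
    (∫ x in (0 : ℝ)..1, f x) ^ 2 ≤ ∫ x in (0 : ℝ)..1, f x ^ 2 := by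
  have h01 : (0 : ℝ) ∈ Icc (0 : ℝ) 1 := ⟨le_rfl, zero_le_one⟩
  have h11 : (1 : ℝ) ∈ Icc (0 : ℝ) 1 := ⟨zero_le_one, le_rfl⟩
  have h1 := memLp_intervalIntegrable hf h01 h11
  have h2 : IntervalIntegrable (fun x => f x ^ 2) volume 0 1 :=
    intervalIntegrable_of_integrableOn_Icc hf.integrable_sq h01 h11
  set m := ∫ x in (0 : ℝ)..1, f x
  have h3 : 0 ≤ ∫ x in (0 : ℝ)..1, (f x - m) ^ 2 :=
    intervalIntegral.integral_nonneg zero_le_one fun x _ => sq_nonneg _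
  have h4 : ∫ x in (0 : ℝ)..1, (f x - m) ^ 2
      = ∫ x in (0 : ℝ)..1, (f x ^ 2 - (2 * m) * f x + m ^ 2) := by
    congr 1; ext x; ring
  rw [h4, intervalIntegral.integral_add (h2.sub (h1.const_mul _)) (by simp),
    intervalIntegral.integral_sub h2 (h1.const_mul _), intervalIntegral.integral_const_mul] at h3
  simp only [intervalIntegral.integral_const, sub_zero, smul_eq_mul, one_mul] at h3
  change 0 ≤ _ - 2 * m * m + m ^ 2 at h3
  linarith

lemma memLp_of_continuousOn {E : Type*} [NormedAddCommGroup E] {f : ℝ → E}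
    (hf : ContinuousOn f (Icc 0 1)) : MemLp f 2 (volume.restrict (Icc 0 1)) := by
  obtain ⟨C, hC⟩ := isCompact_Icc.exists_bound_of_continuousOn hf
  exact MemLp.of_bound (hf.aestronglyMeasurable_of_isCompact isCompact_Icc measurableSet_Icc) C
    ((ae_restrict_iff' measurableSet_Icc).2 (Eventually.of_forall hC))

/-- The Sobolev inequality: the `W^{2,2}`-distance bounds the `C¹`-distance. -/
lemma norm_vel_sub_le {γ η : ℝ → Plane} (hγ : IsW22 γ) (hη : IsW22 η) {x : ℝ}
    (hx : x ∈ Icc (0 : ℝ) 1) : ‖vel γ x - vel η x‖ ≤ 2 * w22Dist γ η := by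
  have h01 : (0 : ℝ) ∈ Icc (0 : ℝ) 1 := ⟨le_rfl, zero_le_one⟩
  have h11 : (1 : ℝ) ∈ Icc (0 : ℝ) 1 := ⟨zero_le_one, le_rfl⟩
  have hD : ContinuousOn (fun y => vel γ y - vel η y) (Icc 0 1) :=
    hγ.continuousOn_vel.sub hη.continuousOn_vel
  have hA : MemLp (fun y => acc γ y - acc η y) 2 (volume.restrict (Icc 0 1)) :=
    hγ.isW12_vel.memLp.sub hη.isW12_vel.memLp
  have hAn := memLp_intervalIntegrable hA.norm h01 h11
  set I := ∫ y in (0 : ℝ)..1, ‖acc γ y - acc η y‖ with hI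
  have hinc : ∀ y ∈ Icc (0 : ℝ) 1, ∀ z ∈ Icc (0 : ℝ) 1, y ≤ z →
      ‖(vel γ z - vel η z) - (vel γ y - vel η y)‖ ≤ I := by
    intro y hy z hz hyz
    have h1 := hγ.isW12_vel.integral_eq_sub hy hz hyz
    have h2 := hη.isW12_vel.integral_eq_sub hy hz hyz
    have h3 : (vel γ z - vel η z) - (vel γ y - vel η y)
        = ∫ t in y..z, (acc γ t - acc η t) := by
      rw [intervalIntegral.integral_sub (memLp_intervalIntegrable hγ.isW12_vel.memLp hy hz)
        (memLp_intervalIntegrable hη.isW12_vel.memLp hy hz), h1, h2]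
      abel
    rw [h3]
    refine (intervalIntegral.norm_integral_le_integral_norm hyz).trans ?_
    exact intervalIntegral.integral_mono_interval hy.1 hyz hz.2
      (Eventually.of_forall fun t => norm_nonneg _) hAn
  have hpt : ∀ y ∈ Icc (0 : ℝ) 1,
      ‖vel γ x - vel η x‖ ≤ ‖vel γ y - vel η y‖ + I := by
    intro y hy
    have hle : ‖(vel γ x - vel η x) - (vel γ y - vel η y)‖ ≤ I := by
      rcases le_total y x with h | h
      · exact hinc y hy x hx h
      · rw [norm_sub_rev]; exact hinc x hx y hy h
    have := norm_le_norm_add_norm_sub' (vel γ x - vel η x) (vel γ y - vel η y)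
    linarith
  have hDn : IntervalIntegrable (fun y => ‖vel γ y - vel η y‖) volume 0 1 :=
    hD.norm.intervalIntegrable_of_Icc zero_le_one
  have hmean : ‖vel γ x - vel η x‖
      ≤ ∫ y in (0 : ℝ)..1, (‖vel γ y - vel η y‖ + ‖acc γ y - acc η y‖) := by
    have h1 := intervalIntegral.integral_mono_on zero_le_one
      (intervalIntegrable_const (c := ‖vel γ x - vel η x‖)) (hDn.add intervalIntegrable_const)
      hpt
    rw [intervalIntegral.integral_add hDn intervalIntegrable_const] at h1
    simp only [intervalIntegral.integral_const, sub_zero, smul_eq_mul, one_mul] at h1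
    rw [intervalIntegral.integral_add hDn hAn]
    exact h1
  have hsum : MemLp (fun y => ‖vel γ y - vel η y‖ + ‖acc γ y - acc η y‖) 2
      (volume.restrict (Icc 0 1)) := (memLp_of_continuousOn hD).norm.add hA.norm
  have hcs := sq_integral_le_integral_sq hsum
  have hγη : ContinuousOn (fun y => γ y - η y) (Icc 0 1) := fun y hy =>
    (hγ.hasDerivWithinAt hy).continuousWithinAt.sub (hη.hasDerivWithinAt hy).continuousWithinAt
  have hint : IntervalIntegrable (fun y => ‖γ y - η y‖ ^ 2 + ‖vel γ y - vel η y‖ ^ 2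
      + ‖acc γ y - acc η y‖ ^ 2) volume 0 1 := by
    refine ((((hγη.norm.pow 2).intervalIntegrable_of_Icc zero_le_one).add
      ((hD.norm.pow 2).intervalIntegrable_of_Icc zero_le_one)).add ?_)
    exact intervalIntegrable_of_integrableOn_Icc hA.norm.integrable_sq h01 h11
  have hle := intervalIntegral.integral_mono_on zero_le_one
    (intervalIntegrable_of_integrableOn_Icc hsum.integrable_sq h01 h11) (hint.const_mul 2)
    (fun y _ => by
      nlinarith [sq_nonneg (‖vel γ y - vel η y‖ - ‖acc γ y - acc η y‖),
        sq_nonneg ‖γ y - η y‖])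
  rw [intervalIntegral.integral_const_mul] at hle
  have hw : w22Dist γ η ^ 2 = ∫ y in (0 : ℝ)..1, (‖γ y - η y‖ ^ 2 + ‖vel γ y - vel η y‖ ^ 2
      + ‖acc γ y - acc η y‖ ^ 2) := by
    rw [w22Dist, Real.sq_sqrt]
    exact intervalIntegral.integral_nonneg zero_le_one fun y _ => by positivity
  rw [← hw] at hle
  have hw0 : 0 ≤ w22Dist γ η := Real.sqrt_nonneg _
  refine hmean.trans (abs_le_of_sq_le_sq' ?_ (by positivity)).2
  nlinarith

/-! ### Curves with prescribed speed and tangent angle -/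

/-- The velocity with speed `w` and tangent angle `θ`. -/
def polarVel (w θ : ℝ → ℝ) (x : ℝ) : Plane := w x • dir (θ x)

/-- The acceleration of a curve with speed `w` and tangent angle `θ`, where `w'` and `θ'` are the
derivatives of `w` and `θ`. -/
def polarAcc (w w' θ θ' : ℝ → ℝ) (x : ℝ) : Plane :=
  w' x • dir (θ x) + (w x * θ' x) • dirPerp (θ x)

lemma isW12_polar {w w' θ θ' : ℝ → ℝ} (hw : IsW12 w w') (hθ : ∀ x, HasDerivAt θ (θ' x) x)
    (hθ' : Continuous θ') : IsW12 (polarVel w θ) (polarAcc w w' θ θ') := by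
  have hθc : Continuous θ := continuous_iff_continuousAt.2 fun x => (hθ x).continuousAt
  have hd : ∀ x, HasDerivAt (fun x => dir (θ x)) (θ' x • dirPerp (θ x)) x := fun x =>
    (hasDerivAt_dir (θ x)).scomp x (hθ x)
  have hdc : Continuous fun x => θ' x • dirPerp (θ x) :=
    hθ'.smul (continuous_dirPerp.comp hθc)
  have hC1 : ContDiff ℝ 1 (fun x => dir (θ x)) := by
    rw [contDiff_one_iff_deriv]
    refine ⟨fun x => (hd x).differentiableAt, ?_⟩
    have : deriv (fun x => dir (θ x)) = fun x => θ' x • dirPerp (θ x) :=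
      funext fun x => (hd x).deriv
    rw [this]; exact hdc
  refine ⟨hw.ac.smul hC1.contDiffOn.absolutelyContinuousOnInterval, ?_, ?_⟩
  · refine MemLp.add ?_ ?_
    · refine hw.memLp.of_le (hw.memLp.aestronglyMeasurable.smul
        (continuous_dir.comp hθc).aestronglyMeasurable) (Eventually.of_forall fun x => ?_)
      rw [norm_smul, norm_dir, mul_one]
    · refine memLp_of_continuousOn (ContinuousOn.fun_smul ?_ ?_)
      · exact hw.continuousOn.mul hθ'.continuousOn
      · exact (continuous_dirPerp.comp hθc).continuousOn
  · filter_upwards [hw.ae_deriv] with x hx hxm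
    refine ((hx hxm).smul (hd x)).congr_deriv ?_
    rw [polarAcc, smul_smul, add_comm]

lemma continuous_polarVel {w θ : ℝ → ℝ} (hw : Continuous w) (hθ : Continuous θ) :
    Continuous (polarVel w θ) := hw.smul (continuous_dir.comp hθ)

lemma norm_polarVel {w : ℝ → ℝ} (θ : ℝ → ℝ) {x : ℝ} (hw : 0 ≤ w x) :
    ‖polarVel w θ x‖ = w x := by
  rw [polarVel, norm_smul, norm_dir, mul_one, Real.norm_of_nonneg hw]

lemma bendingEnergy_polar {γ : ℝ → Plane} {w w' θ θ' : ℝ → ℝ} (hw : IsW12 w w')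
    (hpos : ∀ x ∈ Icc (0 : ℝ) 1, 0 < w x) (hθ : ∀ x, HasDerivAt θ (θ' x) x)
    (hθ' : Continuous θ') (hv : ∀ x ∈ Icc (0 : ℝ) 1, vel γ x = polarVel w θ x) :
    bendingEnergy γ = ∫ x in (0 : ℝ)..1, θ' x ^ 2 / w x := by
  refine integral_congr_of_Ioo zero_le_one ?_
  filter_upwards [(isW12_polar hw hθ hθ').ae_deriv] with x hx hxm
  have hxI := Ioo_subset_Icc_self hxm
  have hd : HasDerivAt (vel γ) (polarAcc w w' θ θ' x) x := by
    refine (hx hxm).congr_of_eventuallyEq ?_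
    filter_upwards [Icc_mem_nhds hxm.1 hxm.2] with y hy
    exact hv y hy
  have hwx := hpos x hxI
  have hn : ‖vel γ x‖ = w x := by rw [hv x hxI, norm_polarVel θ hwx.le]
  rw [energyDensity_eq hxm (norm_pos_iff.1 (by rw [hn]; exact hwx)) hd, hn, hv x hxI]
  have hcs := Real.sin_sq_add_cos_sq (θ x)
  have : polarVel w θ x 0 * polarAcc w w' θ θ' x 1 - polarVel w θ x 1 * polarAcc w w' θ θ' x 0
      = w x ^ 2 * θ' x := by
    simp [polarVel, polarAcc]
    linear_combination w x ^ 2 * θ' x * hcs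
  rw [this]
  field_simp

/-- A velocity field symmetric about `x = 1 / 2` integrates to a curve symmetric about the vertical
line over `1 / 2`, if its midpoint lies on this line. -/
lemma primitive_symmetric {V : ℝ → Plane} (hV : Continuous V)
    (hsymm : ∀ x ∈ Icc (0 : ℝ) 1, V (1 - x) = !₂[V x 0, -V x 1])
    (h2 : (∫ t in (0 : ℝ)..(1 / 2), V t) 0 = 1 / 2) :
    (∫ t in (0 : ℝ)..1, V t) = !₂[1, 0] ∧ ∀ x ∈ Icc (0 : ℝ) 1,
      (∫ t in (0 : ℝ)..(1 - x), V t) = !₂[1 - (∫ t in (0 : ℝ)..x, V t) 0,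
        (∫ t in (0 : ℝ)..x, V t) 1] := by
  have hint : ∀ a b, IntervalIntegrable V volume a b := fun a b => hV.intervalIntegrable a b
  have hVi : ∀ i, Continuous fun t => V t i := fun i =>
    (EuclideanSpace.proj (𝕜 := ℝ) i : Plane →L[ℝ] ℝ).continuous.comp hV
  have key : ∀ x ∈ Icc (0 : ℝ) 1, (∫ t in (0 : ℝ)..(1 - x), V t) = (∫ t in (0 : ℝ)..1, V t)
      - !₂[(∫ t in (0 : ℝ)..x, V t) 0, -(∫ t in (0 : ℝ)..x, V t) 1] := by
    intro x hx
    have h1 : ∫ t in (1 - x)..1, V t = ∫ t in (0 : ℝ)..x, V (1 - t) := by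
      have := intervalIntegral.integral_comp_sub_left (a := 0) (b := x) V 1
      rw [this, sub_zero]
    have h3 : ∫ t in (1 - x)..1, V t
        = !₂[(∫ t in (0 : ℝ)..x, V t) 0, -(∫ t in (0 : ℝ)..x, V t) 1] := by
      rw [h1]
      have h4 : ∫ t in (0 : ℝ)..x, V (1 - t) = ∫ t in (0 : ℝ)..x, (!₂[V t 0, -V t 1] : Plane) := by
        refine intervalIntegral.integral_congr fun t ht => ?_
        rw [uIcc_of_le hx.1] at ht
        exact hsymm t ⟨ht.1, ht.2.trans hx.2⟩
      rw [h4]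
      have hc : IntervalIntegrable (fun t => (!₂[V t 0, -V t 1] : Plane)) volume 0 x :=
        (continuous_plane_mk (hVi 0) (hVi 1).neg).intervalIntegrable 0 x
      refine plane_eq ?_ ?_
      · rw [intervalIntegral_apply hc, intervalIntegral_apply (hint 0 x)]; simp
      · rw [intervalIntegral_apply hc]
        simp only [Matrix.cons_val_one, Matrix.cons_val_zero]
        rw [intervalIntegral.integral_neg, intervalIntegral_apply (hint 0 x)]
    rw [← h3, ← intervalIntegral.integral_add_adjacent_intervals (hint 0 (1 - x)) (hint (1 - x) 1)]
    abel
  have h1 : (∫ t in (0 : ℝ)..1, V t) = !₂[1, 0] := by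
    have := key (1 / 2) (by norm_num)
    rw [show (1 : ℝ) - 1 / 2 = 1 / 2 by norm_num] at this
    have h3 : (∫ t in (0 : ℝ)..1, V t) = (∫ t in (0 : ℝ)..(1 / 2), V t)
      + !₂[(∫ t in (0 : ℝ)..(1 / 2), V t) 0, -(∫ t in (0 : ℝ)..(1 / 2), V t) 1] := by
      rw [eq_sub_iff_add_eq] at this
      exact this.symm
    rw [h3]
    refine plane_eq ?_ ?_
    · rw [PiLp.add_apply]
      simp only [Matrix.cons_val_zero]
      rw [h2]; norm_num
    · simp
  refine ⟨h1, fun x hx => ?_⟩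
  rw [key x hx, h1]
  refine plane_eq ?_ ?_ <;> simp

/-! ### The family of elasticae with a given parametrization -/

/-- A weight on `[0,1]`: the speed of a symmetric parametrization over `[0,1]` of a curve which
is normalized to have length `2`, with its weak derivative `W'`. Continuity is demanded on the whole
line, so that `W` may be integrated without reference to `[0,1]`. -/
structure IsWeight (W W' : ℝ → ℝ) : Prop where
  continuous : Continuous W
  isW12 : IsW12 W W'
  pos : ∀ x ∈ Icc (0 : ℝ) 1, 0 < W x
  symm : ∀ x ∈ Icc (0 : ℝ) 1, W (1 - x) = W x
  integral_eq : ∫ x in (0 : ℝ)..1, W x = 2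

/-- The normalized arclength belonging to a weight. -/
def weightPrimitive (W : ℝ → ℝ) (x : ℝ) : ℝ := ∫ t in (0 : ℝ)..x, W t

lemma hasDerivAt_weightPrimitive {W : ℝ → ℝ} (hW : Continuous W) (x : ℝ) :
    HasDerivAt (weightPrimitive W) (W x) x :=
  intervalIntegral.integral_hasDerivAt_right (hW.intervalIntegrable _ _)
    (hW.stronglyMeasurableAtFilter _ _) hW.continuousAt

lemma continuous_weightPrimitive {W : ℝ → ℝ} (hW : Continuous W) :
    Continuous (weightPrimitive W) :=
  continuous_iff_continuousAt.2 fun x => (hasDerivAt_weightPrimitive hW x).continuousAt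

lemma IsWeight.primitive_symm {W W' : ℝ → ℝ} (h : IsWeight W W') {x : ℝ}
    (hx : x ∈ Icc (0 : ℝ) 1) : weightPrimitive W (1 - x) = 2 - weightPrimitive W x := by
  have hint : ∀ a b, IntervalIntegrable W volume a b := fun a b =>
    h.continuous.intervalIntegrable a b
  have h1 : ∫ t in (1 - x)..1, W t = ∫ t in (0 : ℝ)..x, W (1 - t) := by
    rw [intervalIntegral.integral_comp_sub_left (a := 0) (b := x) W 1, sub_zero]
  have h2 : ∫ t in (0 : ℝ)..x, W (1 - t) = weightPrimitive W x := by
    refine intervalIntegral.integral_congr fun t ht => ?_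
    rw [uIcc_of_le hx.1] at ht
    exact h.symm t ⟨ht.1, ht.2.trans hx.2⟩
  rw [← h2, ← h1, ← h.integral_eq, weightPrimitive,
    ← intervalIntegral.integral_add_adjacent_intervals (hint 0 (1 - x)) (hint (1 - x) 1)]
  ring

lemma IsWeight.primitive_half {W W' : ℝ → ℝ} (h : IsWeight W W') :
    weightPrimitive W (1 / 2) = 1 := by
  have := h.primitive_symm (x := 1 / 2) (by norm_num)
  rw [show (1 : ℝ) - 1 / 2 = 1 / 2 by norm_num] at this
  linarith

lemma IsWeight.primitive_mono {W W' : ℝ → ℝ} (h : IsWeight W W') :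
    MonotoneOn (weightPrimitive W) (Icc 0 1) := by
  refine monotoneOn_of_deriv_nonneg (convex_Icc 0 1)
    (continuous_weightPrimitive h.continuous).continuousOn
    (fun x _ => (hasDerivAt_weightPrimitive h.continuous x).differentiableAt.differentiableWithinAt)
    fun x hx => ?_
  rw [(hasDerivAt_weightPrimitive h.continuous x).deriv]
  exact (h.pos x (interior_subset hx)).le

lemma weightPrimitive_zero (W : ℝ → ℝ) : weightPrimitive W 0 = 0 := intervalIntegral.integral_same

lemma IsWeight.primitive_one {W W' : ℝ → ℝ} (h : IsWeight W W') : weightPrimitive W 1 = 2 :=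
  h.integral_eq

lemma IsWeight.primitive_mem {W W' : ℝ → ℝ} (h : IsWeight W W') {x : ℝ}
    (hx : x ∈ Icc (0 : ℝ) 1) : weightPrimitive W x ∈ Icc (0 : ℝ) 2 := by
  have h0 := h.primitive_mono ⟨le_rfl, zero_le_one⟩ hx hx.1
  have h1 := h.primitive_mono hx ⟨zero_le_one, le_rfl⟩ hx.2
  rw [weightPrimitive_zero] at h0
  rw [h.primitive_one] at h1
  exact ⟨h0, h1⟩

lemma IsWeight.primitive_mem_half {W W' : ℝ → ℝ} (h : IsWeight W W') {x : ℝ}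
    (hx : x ∈ Icc (0 : ℝ) (1 / 2)) : weightPrimitive W x ∈ Icc (0 : ℝ) 1 := by
  refine ⟨(h.primitive_mem ⟨hx.1, hx.2.trans (by norm_num)⟩).1, ?_⟩
  rw [← h.primitive_half]
  exact h.primitive_mono ⟨hx.1, hx.2.trans (by norm_num)⟩ (by norm_num) hx.2

/-- Minus the derivative of the tangent angle of the symmetric cut-and-glued elastica,
parametrized over `[0,2]` with constant speed. It is continuous across the tip. -/
def elasticaRate (σ X : ℝ) : ℝ := σ * pendulumRate (σ * min X (2 - X))

/-- The tangent angle of the symmetric cut-and-glued elastica with half length `σ` (in units of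
the pendulum), parametrized over `[0,2]` with constant speed. -/
def elasticaAngle (σ X : ℝ) : ℝ := pendulumAngle σ - ∫ t in (0 : ℝ)..X, elasticaRate σ t

lemma continuous_elasticaRate (σ : ℝ) : Continuous (elasticaRate σ) := by
  have := continuous_pendulumRate
  unfold elasticaRate
  fun_prop

lemma hasDerivAt_elasticaAngle (σ X : ℝ) :
    HasDerivAt (elasticaAngle σ) (-elasticaRate σ X) X :=
  (intervalIntegral.integral_hasDerivAt_right ((continuous_elasticaRate σ).intervalIntegrable _ _)
    ((continuous_elasticaRate σ).stronglyMeasurableAtFilter _ _)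
    (continuous_elasticaRate σ).continuousAt).const_sub _

lemma continuous_elasticaAngle (σ : ℝ) : Continuous (elasticaAngle σ) :=
  continuous_iff_continuousAt.2 fun x => (hasDerivAt_elasticaAngle σ x).continuousAt

lemma elasticaRate_symm (σ X : ℝ) : elasticaRate σ (2 - X) = elasticaRate σ X := by
  unfold elasticaRate
  rw [sub_sub_cancel, min_comm]

lemma elasticaAngle_eq {σ X : ℝ} (h0 : 0 ≤ X) (h1 : X ≤ 1) :
    elasticaAngle σ X = pendulumAngle σ - pendulumAngle (σ * X) := by
  have hd : ∀ t, HasDerivAt (fun t => pendulumAngle (σ * t)) (σ * pendulumRate (σ * t)) t := by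
    intro t
    refine ((hasDerivAt_pendulumAngle (σ * t)).comp t ((hasDerivAt_id t).const_mul σ)).congr_deriv ?_
    simp; ring
  have h2 : ∫ t in (0 : ℝ)..X, elasticaRate σ t = ∫ t in (0 : ℝ)..X, σ * pendulumRate (σ * t) := by
    refine intervalIntegral.integral_congr fun t ht => ?_
    rw [uIcc_of_le h0] at ht
    simp only [elasticaRate]
    rw [min_eq_left (by linarith [ht.2])]
  have hc : Continuous fun t => σ * pendulumRate (σ * t) := by
    have := continuous_pendulumRate
    fun_prop
  rw [elasticaAngle, h2, intervalIntegral.integral_eq_sub_of_hasDerivAt (fun t _ => hd t)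
    (hc.intervalIntegrable _ _)]
  simp [pendulumAngle_zero]

/-- The tangent angle is odd about the tip. -/
lemma elasticaAngle_symm (σ X : ℝ) : elasticaAngle σ (2 - X) = -elasticaAngle σ X := by
  have hd : ∀ t, HasDerivAt (fun t => elasticaAngle σ (2 - t) + elasticaAngle σ t) 0 t := by
    intro t
    refine (((hasDerivAt_elasticaAngle σ (2 - t)).comp t
      ((hasDerivAt_id t).const_sub 2)).add (hasDerivAt_elasticaAngle σ t)).congr_deriv ?_
    rw [elasticaRate_symm]; simp
  have h := is_const_of_deriv_eq_zero (fun t => (hd t).differentiableAt)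
    (fun t => (hd t).deriv) X 1
  rw [show (2 : ℝ) - 1 = 1 by norm_num, elasticaAngle_eq zero_le_one le_rfl] at h
  simp at h
  linarith

/-- The length of half of the elastica, scaled so that its endpoint and its tip have horizontal
distance `1 / 2`. -/
def elasticaScale (σ : ℝ) : ℝ := σ / (2 * tipWidth (pendulumAngle σ))

/-- The velocity of the symmetric cut-and-glued elastica parametrized with the weight `W`. -/
def elasticaVel (σ : ℝ) (W : ℝ → ℝ) : ℝ → Plane :=
  polarVel (fun x => elasticaScale σ * W x) (fun x => elasticaAngle σ (weightPrimitive W x))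

/-- The symmetric cut-and-glued elastica parametrized with the weight `W`. -/
def elasticaCurve (σ : ℝ) (W : ℝ → ℝ) (x : ℝ) : Plane := ∫ t in (0 : ℝ)..x, elasticaVel σ W t

/-- Minus the derivative of the tangent angle of `elasticaCurve`. -/
def elasticaTurn (σ : ℝ) (W : ℝ → ℝ) (x : ℝ) : ℝ :=
  elasticaRate σ (weightPrimitive W x) * W x

/-- A swing that yields a curve with its tip in the upper half plane over `1 / 2`. -/
structure IsTipSwing (σ : ℝ) : Prop where
  isSwing : IsSwing σ
  lt_pi : pendulumAngle σ < Real.pi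
  width_pos : 0 < tipWidth (pendulumAngle σ)

lemma IsTipSwing.angle_mem {σ : ℝ} (h : IsTipSwing σ) : pendulumAngle σ ∈ Ioo 0 Real.pi :=
  ⟨h.isSwing.angle_pos, h.lt_pi⟩

lemma IsTipSwing.scale_pos {σ : ℝ} (h : IsTipSwing σ) : 0 < elasticaScale σ :=
  div_pos h.isSwing.1 (mul_pos two_pos h.width_pos)

section

variable {σ : ℝ} {W W' : ℝ → ℝ}

lemma IsW12.const_mul {f g : ℝ → ℝ} (h : IsW12 f g) (c : ℝ) :
    IsW12 (fun x => c * f x) (fun x => c * g x) where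
  ac := h.ac.const_mul c
  memLp := h.memLp.const_mul c
  ae_deriv := by
    filter_upwards [h.ae_deriv] with x hx hxm
    exact (hx hxm).const_mul c

lemma hasDerivAt_elasticaAngle_comp (hW : IsWeight W W') (x : ℝ) :
    HasDerivAt (fun x => elasticaAngle σ (weightPrimitive W x)) (-elasticaTurn σ W x) x := by
  refine ((hasDerivAt_elasticaAngle σ _).comp x
    (hasDerivAt_weightPrimitive hW.continuous x)).congr_deriv ?_
  simp [elasticaTurn]

lemma continuous_elasticaTurn (hW : IsWeight W W') : Continuous fun x => -elasticaTurn σ W x :=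
  ((continuous_elasticaRate σ).comp (continuous_weightPrimitive hW.continuous)).mul
    hW.continuous |>.neg

lemma continuous_elasticaVel (hW : IsWeight W W') : Continuous (elasticaVel σ W) :=
  continuous_polarVel (continuous_const.mul hW.continuous)
    ((continuous_elasticaAngle σ).comp (continuous_weightPrimitive hW.continuous))

/-- The acceleration of `elasticaCurve`. -/
def elasticaAcc (σ : ℝ) (W W' : ℝ → ℝ) : ℝ → Plane :=
  polarAcc (fun x => elasticaScale σ * W x) (fun x => elasticaScale σ * W' x)
    (fun x => elasticaAngle σ (weightPrimitive W x)) (fun x => -elasticaTurn σ W x)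

lemma isW12_elasticaVel (hW : IsWeight W W') : IsW12 (elasticaVel σ W) (elasticaAcc σ W W') :=
  isW12_polar (hW.isW12.const_mul _) (hasDerivAt_elasticaAngle_comp hW)
    (continuous_elasticaTurn hW)

lemma vel_elasticaCurve (hW : IsWeight W W') {x : ℝ} (hx : x ∈ Icc (0 : ℝ) 1) :
    vel (elasticaCurve σ W) x = elasticaVel σ W x :=
  vel_primitive (continuous_elasticaVel hW) hx

lemma norm_elasticaVel (hσ : IsTipSwing σ) (hW : IsWeight W W') {x : ℝ}
    (hx : x ∈ Icc (0 : ℝ) 1) : ‖elasticaVel σ W x‖ = elasticaScale σ * W x :=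
  norm_polarVel _ (mul_pos hσ.scale_pos (hW.pos x hx)).le

lemma isW22Imm_elasticaCurve (hσ : IsTipSwing σ) (hW : IsWeight W W') :
    IsW22Imm (elasticaCurve σ W) := by
  refine ⟨isW22_primitive (continuous_elasticaVel hW) (isW12_elasticaVel hW), fun x hx => ?_⟩
  rw [vel_elasticaCurve hW hx, ← norm_pos_iff, norm_elasticaVel hσ hW hx]
  exact mul_pos hσ.scale_pos (hW.pos x hx)

lemma elasticaVel_symm (hW : IsWeight W W') {x : ℝ} (hx : x ∈ Icc (0 : ℝ) 1) :
    elasticaVel σ W (1 - x) = !₂[elasticaVel σ W x 0, -elasticaVel σ W x 1] := by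
  unfold elasticaVel polarVel
  beta_reduce
  rw [hW.symm x hx, hW.primitive_symm hx, elasticaAngle_symm]
  refine plane_eq ?_ ?_ <;> simp

lemma IsSwing.integral_rate_sq (hσ : IsSwing σ) :
    ∫ t in (0 : ℝ)..σ, pendulumRate t ^ 2 = rootSineIntegral (pendulumAngle σ) := by
  have hc := continuous_pendulumRate
  have h1 : ∫ t in (0 : ℝ)..σ, pendulumRate t ^ 2
      = ∫ t in (0 : ℝ)..σ, √(Real.sin (pendulumAngle t)) * pendulumRate t := by
    refine intervalIntegral.integral_congr fun t ht => ?_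
    rw [uIcc_of_le hσ.1.le] at ht
    rw [← hσ.rate_eq ht, sq]
  rw [h1, intervalIntegral.integral_eq_sub_of_hasDerivAt
    (f := fun t => rootSineIntegral (pendulumAngle t))
    (fun t _ => (hasDerivAt_rootSineIntegral _).comp t (hasDerivAt_pendulumAngle t))]
  · simp [pendulumAngle_zero, rootSineIntegral_zero]
  · refine Continuous.intervalIntegrable ?_ _ _
    exact (continuous_sqrt_sin.comp continuous_pendulumAngle).mul hc

/-- The energy of the elastica does not depend on the parametrization. -/
lemma bendingEnergy_of_elasticaVel (hσ : IsTipSwing σ) (hW : IsWeight W W') {γ : ℝ → Plane}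
    (hv : ∀ x ∈ Icc (0 : ℝ) 1, vel γ x = elasticaVel σ W x) :
    bendingEnergy γ
      = 4 * (rootSineIntegral (pendulumAngle σ) * tipWidth (pendulumAngle σ)) := by
  have hσ0 := hσ.isSwing.1
  have hg := hσ.width_pos
  rw [bendingEnergy_polar (hW.isW12.const_mul _)
    (fun x hx => mul_pos hσ.scale_pos (hW.pos x hx)) (hasDerivAt_elasticaAngle_comp hW)
    (continuous_elasticaTurn hW) hv]
  have h1 : ∫ x in (0 : ℝ)..1, (-elasticaTurn σ W x) ^ 2 / (elasticaScale σ * W x)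
      = ∫ x in (0 : ℝ)..1, ((fun X => elasticaRate σ X ^ 2 / elasticaScale σ)
          ∘ weightPrimitive W) x * W x := by
    refine intervalIntegral.integral_congr fun x hx => ?_
    rw [uIcc_of_le zero_le_one] at hx
    have h1 := hW.pos x hx
    have h2 := hσ.scale_pos
    simp only [elasticaTurn, Function.comp]
    field_simp
  have hcr := continuous_elasticaRate σ
  have hcr2 : Continuous fun X => elasticaRate σ X ^ 2 / elasticaScale σ :=
    (hcr.pow 2).div_const _
  rw [h1, intervalIntegral.integral_comp_mul_deriv
    (fun x _ => hasDerivAt_weightPrimitive hW.continuous x) hW.continuous.continuousOn hcr2,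
    weightPrimitive_zero, hW.primitive_one,
    ← intervalIntegral.integral_add_adjacent_intervals (hcr2.intervalIntegrable 0 1)
      (hcr2.intervalIntegrable 1 2)]
  have h2 : ∫ X in (1 : ℝ)..2, elasticaRate σ X ^ 2 / elasticaScale σ
      = ∫ X in (0 : ℝ)..1, elasticaRate σ X ^ 2 / elasticaScale σ := by
    have := intervalIntegral.integral_comp_sub_left (a := 1) (b := 2)
      (fun X => elasticaRate σ X ^ 2 / elasticaScale σ) 2
    simp only [elasticaRate_symm] at this
    rw [this]; norm_num
  have h3 : ∫ X in (0 : ℝ)..1, elasticaRate σ X ^ 2 / elasticaScale σ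
      = σ ^ 2 / elasticaScale σ * ∫ X in (0 : ℝ)..1, pendulumRate (σ * X) ^ 2 := by
    rw [← intervalIntegral.integral_const_mul]
    refine intervalIntegral.integral_congr fun X hX => ?_
    rw [uIcc_of_le zero_le_one] at hX
    simp only [elasticaRate]
    rw [min_eq_left (by linarith [hX.2])]; ring
  have h4 := intervalIntegral.integral_comp_mul_left (a := 0) (b := 1)
    (fun t => pendulumRate t ^ 2) hσ0.ne'
  rw [mul_zero, mul_one, hσ.isSwing.integral_rate_sq] at h4
  rw [h2, h3, h4, elasticaScale, smul_eq_mul]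
  field_simp
  ring

/-- The position on the elastica with initial tangent angle `Φ` at the time `τ`. -/
def elasticaPos (Φ τ : ℝ) : Plane :=
  !₂[2 * pendulumRate τ * Real.cos Φ + rootSineIntegral (pendulumAngle τ) * Real.sin Φ,
    2 * pendulumRate τ * Real.sin Φ - rootSineIntegral (pendulumAngle τ) * Real.cos Φ]

lemma IsSwing.hasDerivAt_elasticaPos (hσ : IsSwing σ) (Φ : ℝ) {τ : ℝ} (hτ : τ ∈ Icc 0 σ) :
    HasDerivAt (elasticaPos Φ) (dir (Φ - pendulumAngle τ)) τ := by
  have hS : HasDerivAt (fun τ => rootSineIntegral (pendulumAngle τ))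
      (Real.sin (pendulumAngle τ)) τ := by
    refine ((hasDerivAt_rootSineIntegral _).comp τ (hasDerivAt_pendulumAngle τ)).congr_deriv ?_
    rw [← hσ.rate_eq hτ, ← sq, pendulumRate_sq]
  rw [hasDerivAt_plane]
  intro i
  fin_cases i
  · refine ((((hasDerivAt_pendulumRate τ).const_mul 2).mul_const (Real.cos Φ)).add
      (hS.mul_const (Real.sin Φ))).congr_deriv ?_
    simp [Real.cos_sub]; ring
  · refine ((((hasDerivAt_pendulumRate τ).const_mul 2).mul_const (Real.sin Φ)).sub
      (hS.mul_const (Real.cos Φ))).congr_deriv ?_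
    simp [Real.sin_sub]; ring

lemma elasticaPos_zero (Φ : ℝ) : elasticaPos Φ 0 = 0 := by
  refine plane_eq ?_ ?_ <;>
    simp [elasticaPos, pendulumRate_zero, pendulumAngle_zero, rootSineIntegral_zero]

lemma IsSwing.elasticaPos_tip (hσ : IsSwing σ) : elasticaPos (pendulumAngle σ) σ
    = !₂[tipWidth (pendulumAngle σ), tipHeight (pendulumAngle σ)] := by
  have hk := hσ.rate_eq ⟨hσ.1.le, le_rfl⟩
  unfold elasticaPos tipWidth tipHeight
  rw [hk]
  refine plane_eq ?_ ?_ <;> simp; ring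

lemma elasticaCurve_eq (hσ : IsTipSwing σ) (hW : IsWeight W W') {x : ℝ}
    (hx : x ∈ Icc (0 : ℝ) (1 / 2)) :
    elasticaCurve σ W x = (1 / (2 * tipWidth (pendulumAngle σ))) •
      elasticaPos (pendulumAngle σ) (σ * weightPrimitive W x) := by
  have hσ0 := hσ.isSwing.1
  have hg := hσ.width_pos
  have hd : ∀ t ∈ uIcc 0 x, HasDerivAt (fun t => (1 / (2 * tipWidth (pendulumAngle σ))) •
      elasticaPos (pendulumAngle σ) (σ * weightPrimitive W t)) (elasticaVel σ W t) t := by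
    intro t ht
    rw [uIcc_of_le hx.1] at ht
    have hX := hW.primitive_mem_half ⟨ht.1, ht.2.trans hx.2⟩
    have h1 := (hσ.isSwing.hasDerivAt_elasticaPos (pendulumAngle σ)
      (τ := σ * weightPrimitive W t) ⟨mul_nonneg hσ0.le hX.1, by nlinarith [hX.2]⟩).scomp t
      ((hasDerivAt_weightPrimitive hW.continuous t).const_mul σ)
    refine (h1.const_smul (1 / (2 * tipWidth (pendulumAngle σ)))).congr_deriv ?_
    rw [elasticaVel, polarVel, elasticaAngle_eq hX.1 hX.2, smul_smul, elasticaScale]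
    congr 1; field_simp
  rw [elasticaCurve, intervalIntegral.integral_eq_sub_of_hasDerivAt hd
    ((continuous_elasticaVel hW).intervalIntegrable _ _)]
  simp [weightPrimitive_zero, elasticaPos_zero]

lemma elasticaCurve_half (hσ : IsTipSwing σ) (hW : IsWeight W W') :
    elasticaCurve σ W (1 / 2) = !₂[1 / 2,
      tipHeight (pendulumAngle σ) / (2 * tipWidth (pendulumAngle σ))] := by
  have hg := hσ.width_pos
  rw [elasticaCurve_eq hσ hW (by norm_num), hW.primitive_half, mul_one, hσ.isSwing.elasticaPos_tip]
  refine plane_eq ?_ ?_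
  · simp; field_simp
  · simp; field_simp

lemma elasticaCurve_symmetric (hσ : IsTipSwing σ) (hW : IsWeight W W') :
    elasticaCurve σ W 1 = !₂[1, 0] ∧ ∀ x ∈ Icc (0 : ℝ) 1,
      elasticaCurve σ W (1 - x) = !₂[1 - elasticaCurve σ W x 0, elasticaCurve σ W x 1] := by
  refine primitive_symmetric (continuous_elasticaVel hW) (fun x hx => elasticaVel_symm hW hx) ?_
  have := elasticaCurve_half hσ hW
  rw [elasticaCurve] at this
  rw [this]; simp

end

/-! ### Curves above the cone -/

lemma le_of_hasDerivAt_nonneg {f f' : ℝ → ℝ} {a b : ℝ} (hab : a ≤ b)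
    (hf : ∀ t ∈ Icc a b, HasDerivAt f (f' t) t) (hf' : ∀ t ∈ Icc a b, 0 ≤ f' t) : f a ≤ f b := by
  have : MonotoneOn f (Icc a b) := by
    refine monotoneOn_of_deriv_nonneg (convex_Icc a b)
      (fun t ht => (hf t ht).continuousAt.continuousWithinAt)
      (fun t ht => (hf t (interior_subset ht)).differentiableAt.differentiableWithinAt)
      fun t ht => ?_
    rw [(hf t (interior_subset ht)).deriv]
    exact hf' t (interior_subset ht)
  exact this ⟨le_rfl, hab⟩ ⟨hab, le_rfl⟩ hab

lemma le_of_hasDerivAt_nonpos {f f' : ℝ → ℝ} {a b : ℝ} (hab : a ≤ b)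
    (hf : ∀ t ∈ Icc a b, HasDerivAt f (f' t) t) (hf' : ∀ t ∈ Icc a b, f' t ≤ 0) : f b ≤ f a := by
  have := le_of_hasDerivAt_nonneg (f := fun t => -f t) hab (fun t ht => (hf t ht).neg)
    (fun t ht => neg_nonneg.2 (hf' t ht))
  linarith

section Cone

variable {ψ : ℝ → ℝ}

lemma cone_tip_pos (hψ : IsObstacle ψ) (hcone : IsSymmetricCone ψ) : 0 < ψ (1 / 2) := by
  obtain ⟨⟨a, b, hab⟩, hsym⟩ := hcone
  have hb : b < 0 := by
    have h1 := hψ.neg_left 0 le_rfl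
    rw [hab 0 (by norm_num)] at h1
    linarith
  obtain ⟨x, hx, hpos⟩ := hψ.exists_pos
  obtain ⟨y, hy0, hy1, hy⟩ : ∃ y, 0 ≤ y ∧ y ≤ 1 / 2 ∧ 0 < ψ y := by
    rcases le_total x (1 / 2) with h | h
    · exact ⟨x, hx.1, h, hpos⟩
    · exact ⟨1 - x, by linarith [hx.2], by linarith, by rwa [← hsym x]⟩
  rw [hab y hy1] at hy
  rw [hab _ le_rfl]
  have ha : 0 < a := by
    by_contra h
    push Not at h
    nlinarith
  nlinarith

lemma cone_le_chord (hψ : IsObstacle ψ) (hcone : IsSymmetricCone ψ) {x : ℝ} (h1 : x ≤ 1 / 2) :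
    ψ x ≤ 2 * x * ψ (1 / 2) := by
  obtain ⟨⟨a, b, hab⟩, -⟩ := hcone
  have h2 := hψ.neg_left 0 le_rfl
  rw [hab 0 (by norm_num)] at h2
  rw [hab x h1, hab _ le_rfl]
  nlinarith

lemma cone_le_tip (hψ : IsObstacle ψ) (hcone : IsSymmetricCone ψ) (x : ℝ) :
    ψ x ≤ ψ (1 / 2) := by
  have hpos := cone_tip_pos hψ hcone
  have key : ∀ y ≤ 1 / 2, ψ y ≤ ψ (1 / 2) := fun y hy => by
    have := cone_le_chord hψ hcone hy
    nlinarith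
  rcases le_total x (1 / 2) with h | h
  · exact key x h
  · rw [hcone.2 x]; exact key _ (by linarith)

end Cone

/-- The left half of the elastica runs in the upper half plane, and where its abscissa is positive, it
lies above the chord from its endpoint to the tip and does not pass the abscissa of the tip. -/
lemma IsTipSwing.elasticaPos_bounds {σ h τ : ℝ} (hσ : IsTipSwing σ) (hh : 0 < h)
    (htip : tipHeight (pendulumAngle σ) = 2 * h * tipWidth (pendulumAngle σ))
    (hτ : τ ∈ Icc 0 σ) :
    0 ≤ elasticaPos (pendulumAngle σ) τ 1 ∧ (elasticaPos (pendulumAngle σ) τ 0 ≤ 0 ∨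
      elasticaPos (pendulumAngle σ) τ 0 ≤ tipWidth (pendulumAngle σ) ∧
      2 * h * elasticaPos (pendulumAngle σ) τ 0 ≤ elasticaPos (pendulumAngle σ) τ 1) := by
  set Φ := pendulumAngle σ with hΦ
  have hpi := Real.pi_pos
  have hpos0 : ∀ t ∈ Icc 0 σ, HasDerivAt (fun t => elasticaPos Φ t 0)
      (Real.cos (Φ - pendulumAngle t)) t := fun t ht =>
    hasDerivAt_plane.1 (hσ.isSwing.hasDerivAt_elasticaPos Φ ht) 0
  have hpos1 : ∀ t ∈ Icc 0 σ, HasDerivAt (fun t => elasticaPos Φ t 1)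
      (Real.sin (Φ - pendulumAngle t)) t := fun t ht =>
    hasDerivAt_plane.1 (hσ.isSwing.hasDerivAt_elasticaPos Φ ht) 1
  have hmono := hσ.isSwing.strictMonoOn.monotoneOn
  have hθ0 : ∀ t ∈ Icc 0 σ, 0 ≤ Φ - pendulumAngle t := fun t ht => by
    linarith [hσ.isSwing.angle_le ht]
  have hθπ : ∀ t ∈ Icc 0 σ, Φ - pendulumAngle t ≤ Real.pi := fun t ht => by
    linarith [hσ.isSwing.angle_nonneg ht, hσ.lt_pi]
  have hsub1 : Icc 0 τ ⊆ Icc 0 σ := Icc_subset_Icc_right hτ.2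
  have hsub2 : Icc τ σ ⊆ Icc 0 σ := Icc_subset_Icc_left hτ.1
  have htipeq := hσ.isSwing.elasticaPos_tip
  refine ⟨?_, ?_⟩
  · have := le_of_hasDerivAt_nonneg hτ.1 (fun t ht => hpos1 t (hsub1 ht)) (fun t ht =>
      Real.sin_nonneg_of_nonneg_of_le_pi (hθ0 t (hsub1 ht)) (hθπ t (hsub1 ht)))
    simpa [elasticaPos_zero] using this
  rcases le_or_gt (Real.pi / 2) (Φ - pendulumAngle τ) with hge | hlt
  · left
    have := le_of_hasDerivAt_nonpos hτ.1 (fun t ht => hpos0 t (hsub1 ht)) (fun t ht => by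
      have h1 := hmono (hsub1 ht) hτ ht.2
      exact Real.cos_nonpos_of_pi_div_two_le_of_le (by linarith)
        (by linarith [hθπ t (hsub1 ht)]))
    simpa [elasticaPos_zero] using this
  right
  refine ⟨?_, ?_⟩
  · have := le_of_hasDerivAt_nonneg hτ.2 (fun t ht => hpos0 t (hsub2 ht)) (fun t ht => by
      have h1 := hmono hτ (hsub2 ht) ht.1
      exact Real.cos_nonneg_of_mem_Icc ⟨by linarith [hθ0 t (hsub2 ht)], by linarith⟩)
    simpa [hΦ, htipeq] using this
  -- the signed distance from the chord increases as long as the tangent is steeper than the chord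
  set β := Real.arctan (2 * h) with hβ
  have hβ0 : 0 < β := Real.arctan_pos.2 (by linarith)
  have hβ2 : β < Real.pi / 2 := Real.arctan_lt_pi_div_two _
  have hc : 0 < Real.cos β := Real.cos_arctan_pos _
  have hsc : Real.sin β = 2 * h * Real.cos β := by
    have := Real.tan_arctan (2 * h)
    rwa [← hβ, Real.tan_eq_sin_div_cos, div_eq_iff hc.ne'] at this
  have hz : ∀ t ∈ Icc 0 σ, HasDerivAt
      (fun t => elasticaPos Φ t 1 - 2 * h * elasticaPos Φ t 0)
      (Real.sin (Φ - pendulumAngle t - β) / Real.cos β) t := by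
    intro t ht
    refine ((hpos1 t ht).sub ((hpos0 t ht).const_mul (2 * h))).congr_deriv ?_
    rw [Real.sin_sub _ β, hsc]
    field_simp
  have hgoal : 0 ≤ elasticaPos Φ τ 1 - 2 * h * elasticaPos Φ τ 0 := by
    rcases le_total β (Φ - pendulumAngle τ) with hge | hle
    · have := le_of_hasDerivAt_nonneg hτ.1 (fun t ht => hz t (hsub1 ht)) (fun t ht => by
        have h1 := hmono (hsub1 ht) hτ ht.2
        exact div_nonneg (Real.sin_nonneg_of_nonneg_of_le_pi (by linarith)
          (by linarith [hθπ t (hsub1 ht)])) hc.le)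
      simpa [elasticaPos_zero] using this
    · have := le_of_hasDerivAt_nonpos hτ.2 (fun t ht => hz t (hsub2 ht)) (fun t ht => by
        have h1 := hmono hτ (hsub2 ht) ht.1
        exact div_nonpos_of_nonpos_of_nonneg (Real.sin_nonpos_of_nonpos_of_neg_pi_le
          (by linarith) (by linarith [hθ0 t (hsub2 ht)])) hc.le)
      rw [hΦ, htipeq] at this
      simp only [Matrix.cons_val_one, Matrix.cons_val_zero] at this
      rw [htip] at this
      linarith
  linarith

/-- An elastica whose tip is not below the tip of the cone is admissible. -/
lemma elasticaCurve_mem {ψ : ℝ → ℝ} (hψ : IsObstacle ψ) (hcone : IsSymmetricCone ψ)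
    {σ h : ℝ} {W W' : ℝ → ℝ} (hσ : IsTipSwing σ) (hW : IsWeight W W') (hh : ψ (1 / 2) ≤ h)
    (htip : tipHeight (pendulumAngle σ) = 2 * h * tipWidth (pendulumAngle σ)) :
    elasticaCurve σ W ∈ admissibleSym ψ := by
  have htp := cone_tip_pos hψ hcone
  have hg := hσ.width_pos
  obtain ⟨hone, hsymm⟩ := elasticaCurve_symmetric hσ hW
  have hhalf : ∀ x ∈ Icc (0 : ℝ) (1 / 2), ψ (elasticaCurve σ W x 0) ≤ elasticaCurve σ W x 1 := by
    intro x hx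
    have hX := hW.primitive_mem_half hx
    obtain ⟨h1, h2⟩ := hσ.elasticaPos_bounds (htp.trans_le hh) htip
      (τ := σ * weightPrimitive W x)
      ⟨mul_nonneg hσ.isSwing.1.le hX.1, by nlinarith [hX.2, hσ.isSwing.1]⟩
    rw [elasticaCurve_eq hσ hW hx]
    simp only [PiLp.smul_apply, smul_eq_mul]
    set p := elasticaPos (pendulumAngle σ) (σ * weightPrimitive W x)
    set c := 1 / (2 * tipWidth (pendulumAngle σ)) with hc
    have hc0 : 0 < c := by positivity
    rcases le_or_gt (p 0) 0 with hneg | hpos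
    · exact (hψ.neg_left _ (mul_nonpos_of_nonneg_of_nonpos hc0.le hneg)).le.trans
        (mul_nonneg hc0.le h1)
    · obtain ⟨h3, h4⟩ := h2.resolve_left (not_le.2 hpos)
      have h5 : c * p 0 ≤ 1 / 2 := by
        rw [hc]; field_simp; exact h3
      refine (cone_le_chord hψ hcone h5).trans ?_
      have h6 : p 0 * (2 * ψ (1 / 2)) ≤ p 1 := by nlinarith
      nlinarith [mul_le_mul_of_nonneg_left h6 hc0.le]
  refine ⟨⟨isW22Imm_elasticaCurve hσ hW, ?_, hone, ?_⟩, hsymm⟩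
  · rw [elasticaCurve, intervalIntegral.integral_same]
    exact plane_eq (by simp) (by simp)
  · intro x hx
    rcases le_total x (1 / 2) with h | h
    · exact hhalf x ⟨hx.1, h⟩
    · have h1 := hhalf (1 - x) ⟨by linarith [hx.2], by linarith⟩
      rw [hsymm x hx] at h1
      simp only [Matrix.cons_val_one, Matrix.cons_val_zero] at h1
      rwa [hcone.2]

/-! ### Large circular arcs -/

/-- Almost full circles through the two endpoints have arbitrarily small energy: their radius is
large, while their total curvature stays below `2 π`. -/
lemma exists_small_energy {ψ : ℝ → ℝ} (hψ : IsObstacle ψ) (hcone : IsSymmetricCone ψ) {E : ℝ}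
    (hE : 0 < E) : ∃ γ ∈ admissibleSym ψ, bendingEnergy γ < E := by
  have hpi := Real.pi_pos
  obtain ⟨M, hM0, hMψ, hME⟩ : ∃ M : ℝ, 0 < M ∧ ψ (1 / 2) ≤ M ∧ 4 * Real.pi / M < E := by
    refine ⟨max 1 (max (ψ (1 / 2)) (4 * Real.pi / E + 1)), by positivity,
      (le_max_left _ _).trans (le_max_right _ _), ?_⟩
    rw [div_lt_iff₀ (by positivity), ← div_lt_iff₀' hE]
    exact (lt_add_one _).trans_le ((le_max_right _ _).trans (le_max_right _ _))
  set ε := Real.arctan (1 / M) with hε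
  have hε0 : 0 < ε := Real.arctan_pos.2 (by positivity)
  have hε2 : ε < Real.pi / 2 := Real.arctan_lt_pi_div_two _
  have hcε : 0 < Real.cos ε := Real.cos_arctan_pos _
  have hsε : 0 < Real.sin ε := Real.sin_pos_of_pos_of_lt_pi hε0 (by linarith)
  have htε : Real.cos ε = M * Real.sin ε := by
    have := Real.tan_arctan (1 / M)
    rw [← hε, Real.tan_eq_sin_div_cos, div_eq_iff hcε.ne'] at this
    rw [this]; field_simp
  -- half of the opening angle of the arc
  set α := Real.pi - ε with hα
  have hsα : Real.sin α = Real.sin ε := Real.sin_pi_sub ε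
  have hcα : Real.cos α = -Real.cos ε := Real.cos_pi_sub ε
  have hα0 : 0 < α := by linarith
  set r := α / Real.sin ε with hr
  have hr0 : 0 < r := by positivity
  set θ : ℝ → ℝ := fun x => α * (1 - 2 * x) with hθ
  have hθd : ∀ x, HasDerivAt θ (-(2 * α)) x := by
    intro x
    refine ((((hasDerivAt_id x).const_mul 2).const_sub 1).const_mul α).congr_deriv ?_
    simp; ring
  have hθc : Continuous θ := continuous_iff_continuousAt.2 fun x => (hθd x).continuousAt
  have hw : IsW12 (fun _ : ℝ => r) (fun _ => 0) :=
    ⟨((LipschitzWith.const r).lipschitzOnWith (s := _)).absolutelyContinuousOnInterval,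
      memLp_of_continuousOn continuousOn_const,
      Eventually.of_forall fun x _ => hasDerivAt_const x r⟩
  set V := polarVel (fun _ => r) θ with hV
  have hVc : Continuous V := continuous_polarVel continuous_const hθc
  have hpos : ∀ x, (∫ t in (0 : ℝ)..x, V t)
      = (1 / (2 * Real.sin ε)) • !₂[Real.sin α - Real.sin (θ x), Real.cos (θ x) - Real.cos α] := by
    intro x
    have hd : ∀ t, HasDerivAt (fun t => (1 / (2 * Real.sin ε)) •
        (!₂[Real.sin α - Real.sin (θ t), Real.cos (θ t) - Real.cos α] : Plane)) (V t) t := by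
      intro t
      rw [hasDerivAt_plane]
      intro i
      fin_cases i
      · refine (((hθd t).sin.const_sub (Real.sin α)).const_mul (1 / (2 * Real.sin ε))).congr_deriv ?_
        simp [hV, polarVel, hr]; field_simp
      · refine (((hθd t).cos.sub_const (Real.cos α)).const_mul (1 / (2 * Real.sin ε))).congr_deriv ?_
        simp [hV, polarVel, hr]; field_simp
    rw [intervalIntegral.integral_eq_sub_of_hasDerivAt (fun t _ => hd t)
      (hVc.intervalIntegrable _ _)]
    have h0 : θ 0 = α := by simp [hθ]
    rw [h0]
    refine plane_eq ?_ ?_ <;> simp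
  have hθ1 : ∀ x, θ (1 - x) = -θ x := fun x => by simp only [hθ]; ring
  obtain ⟨hone, hsymm⟩ := primitive_symmetric hVc (fun x _ => by
      simp only [hV, polarVel]
      rw [hθ1]
      refine plane_eq ?_ ?_ <;> simp) (by
      have : θ (1 / 2) = 0 := by simp [hθ]
      rw [hpos, this]
      simp [hsα]; field_simp)
  have hvel : ∀ x ∈ Icc (0 : ℝ) 1, vel (fun x => ∫ t in (0 : ℝ)..x, V t) x = V x := fun x hx =>
    vel_primitive hVc hx
  refine ⟨fun x => ∫ t in (0 : ℝ)..x, V t, ⟨⟨⟨isW22_primitive hVc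
    (isW12_polar hw hθd continuous_const), fun x hx => ?_⟩, ?_, hone, fun x hx => ?_⟩, hsymm⟩, ?_⟩
  · rw [hvel x hx, ← norm_pos_iff, hV, norm_polarVel θ (w := fun _ => r) (x := x) hr0.le]
    exact hr0
  · simp only [intervalIntegral.integral_same]
    exact plane_eq (by simp) (by simp)
  · beta_reduce
    rw [hpos x]
    have hθx : |θ x| ≤ α := by
      simp only [hθ]
      rw [abs_mul, abs_of_pos hα0]
      have : |1 - 2 * x| ≤ 1 := abs_le.2 ⟨by linarith [hx.2], by linarith [hx.1]⟩
      nlinarith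
    have hcos : Real.cos α ≤ Real.cos (θ x) := by
      rw [← Real.cos_abs (θ x)]
      exact Real.cos_le_cos_of_nonneg_of_le_pi (abs_nonneg _) (by linarith) hθx
    simp only [PiLp.smul_apply, smul_eq_mul, Matrix.cons_val_zero, Matrix.cons_val_one]
    have hc0 : 0 < 1 / (2 * Real.sin ε) := by positivity
    have hnn : 0 ≤ 1 / (2 * Real.sin ε) * (Real.cos (θ x) - Real.cos α) :=
      mul_nonneg hc0.le (by linarith)
    -- over `(0,1)` the arc consists of its upper part, where the angle is less than `ε`
    rcases le_or_gt |θ x| ε with hle | hgt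
    · refine (cone_le_tip hψ hcone _).trans (hMψ.trans ?_)
      have h1 : Real.cos ε ≤ Real.cos (θ x) := by
        rw [← Real.cos_abs (θ x)]
        exact Real.cos_le_cos_of_nonneg_of_le_pi (abs_nonneg _) (by linarith) hle
      rw [hcα, one_div, inv_mul_eq_div, le_div_iff₀ (by positivity)]
      linarith
    · have hsin : Real.sin ε ≤ Real.sin |θ x| := by
        rcases le_total |θ x| (Real.pi / 2) with h2 | h2
        · exact Real.sin_le_sin_of_le_of_le_pi_div_two (by linarith) h2 hgt.le
        · rw [← Real.sin_pi_sub |θ x|]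
          exact Real.sin_le_sin_of_le_of_le_pi_div_two (by linarith) (by linarith) (by linarith)
      refine le_trans (le_of_lt ?_) hnn
      rcases le_total 0 (θ x) with h0 | h0
      · rw [abs_of_nonneg h0] at hsin
        exact hψ.neg_left _ (mul_nonpos_of_nonneg_of_nonpos hc0.le (by linarith))
      · rw [abs_of_nonpos h0, Real.sin_neg] at hsin
        refine hψ.neg_right _ ?_
        rw [ge_iff_le, one_div, inv_mul_eq_div, le_div_iff₀ (by positivity)]
        linarith
  · rw [bendingEnergy_polar hw (fun _ _ => hr0) hθd continuous_const hvel]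
    simp only [intervalIntegral.integral_const, sub_zero, one_smul]
    have h1 : (-(2 * α)) ^ 2 / r = 4 * α * Real.sin ε := by
      rw [hr]; field_simp; ring
    have h2 : Real.sin ε ≤ 1 / M := by
      rw [le_div_iff₀ hM0, mul_comm, ← htε]; exact Real.cos_le_one _
    rw [h1]
    refine lt_of_le_of_lt ?_ hME
    have h3 : 4 * α * Real.sin ε ≤ 4 * Real.pi * (1 / M) := by
      refine mul_le_mul (by linarith) h2 hsε.le (by linarith)
    calc _ ≤ _ := h3
      _ = _ := by ring

/-! ### Continuity of the family of elasticae in `W^{2,2}` -/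

lemma abs_elasticaRate_le {σ : ℝ} (hσ : 0 ≤ σ) (X : ℝ) : |elasticaRate σ X| ≤ σ := by
  rw [elasticaRate, abs_mul, abs_of_nonneg hσ]
  exact mul_le_of_le_one_right hσ (abs_pendulumRate_le_one _)

lemma abs_elasticaRate_sub_le {σ τ : ℝ} (hσ : 0 ≤ σ) {X : ℝ} (hX : X ∈ Icc (0 : ℝ) 2) :
    |elasticaRate τ X - elasticaRate σ X| ≤ (1 + σ) * |τ - σ| := by
  have hm : |min X (2 - X)| ≤ 1 := by
    rw [abs_le]
    refine ⟨le_min (by linarith [hX.1]) (by linarith [hX.2]), ?_⟩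
    rcases le_total X 1 with h | h
    · exact (min_le_left _ _).trans h
    · exact (min_le_right _ _).trans (by linarith)
  have h1 := abs_pendulumRate_sub_le (τ * min X (2 - X)) (σ * min X (2 - X))
  rw [← sub_mul, abs_mul] at h1
  have h2 : |pendulumRate (τ * min X (2 - X)) - pendulumRate (σ * min X (2 - X))| ≤ |τ - σ| :=
    h1.trans (mul_le_of_le_one_right (abs_nonneg _) hm)
  have h3 := abs_pendulumRate_le_one (τ * min X (2 - X))
  have h4 : elasticaRate τ X - elasticaRate σ X
      = (τ - σ) * pendulumRate (τ * min X (2 - X))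
        + σ * (pendulumRate (τ * min X (2 - X)) - pendulumRate (σ * min X (2 - X))) := by
    unfold elasticaRate; ring
  rw [h4]
  refine (abs_add_le _ _).trans ?_
  rw [abs_mul, abs_mul, abs_of_nonneg hσ]
  nlinarith [mul_le_mul_of_nonneg_left h3 (abs_nonneg (τ - σ)),
    mul_le_mul_of_nonneg_left h2 hσ]

lemma abs_elasticaAngle_sub_le {σ τ : ℝ} (hσ : 0 ≤ σ) {X : ℝ} (hX : X ∈ Icc (0 : ℝ) 2) :
    |elasticaAngle τ X - elasticaAngle σ X| ≤ (3 + 2 * σ) * |τ - σ| := by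
  have h1 : ‖∫ t in (0 : ℝ)..X, (elasticaRate τ t - elasticaRate σ t)‖
      ≤ (1 + σ) * |τ - σ| * |X - 0| := by
    refine intervalIntegral.norm_integral_le_of_norm_le_const fun t ht => ?_
    rw [uIoc_of_le hX.1] at ht
    exact abs_elasticaRate_sub_le hσ ⟨ht.1.le, ht.2.trans hX.2⟩
  rw [intervalIntegral.integral_sub ((continuous_elasticaRate τ).intervalIntegrable _ _)
    ((continuous_elasticaRate σ).intervalIntegrable _ _), sub_zero, abs_of_nonneg hX.1,
    Real.norm_eq_abs] at h1
  have h2 := abs_pendulumAngle_sub_le τ σ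
  have h3 : elasticaAngle τ X - elasticaAngle σ X = (pendulumAngle τ - pendulumAngle σ)
      - ((∫ t in (0 : ℝ)..X, elasticaRate τ t) - ∫ t in (0 : ℝ)..X, elasticaRate σ t) := by
    unfold elasticaAngle; ring
  rw [h3]
  refine (abs_sub _ _).trans ?_
  have h4 : (1 + σ) * |τ - σ| * X ≤ (1 + σ) * |τ - σ| * 2 :=
    mul_le_mul_of_nonneg_left hX.2 (by positivity)
  nlinarith

/-- A modulus of continuity for the family of elasticae. -/
def elasticaModulus (σ τ : ℝ) : ℝ :=
  |elasticaScale τ - elasticaScale σ| * (1 + τ)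
    + elasticaScale σ * ((3 + 2 * σ) * (1 + σ) + (1 + σ)) * |τ - σ|

lemma tendsto_elasticaModulus {σ : ℝ} (hσ : IsTipSwing σ) :
    Tendsto (elasticaModulus σ) (𝓝 σ) (𝓝 0) := by
  have hs : ContinuousAt elasticaScale σ := by
    unfold elasticaScale
    refine continuousAt_id.div ?_ (mul_pos two_pos hσ.width_pos).ne'
    exact continuousAt_const.mul
      (continuous_tipWidth.continuousAt.comp continuous_pendulumAngle.continuousAt)
  have hc : ContinuousAt (elasticaModulus σ) σ := by
    unfold elasticaModulus
    refine ((hs.sub continuousAt_const).abs.mul (continuousAt_const.add continuousAt_id)).add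
      (continuousAt_const.mul (continuousAt_id.sub continuousAt_const).abs)
  have := hc.tendsto
  simpa [elasticaModulus] using this

section

variable {σ τ : ℝ} {W W' : ℝ → ℝ}

lemma norm_smul_dir_sub_le (a b θ θ' : ℝ) :
    ‖a • dir θ - b • dir θ'‖ ≤ |a - b| + |b| * |θ - θ'| := by
  have : a • dir θ - b • dir θ' = (a - b) • dir θ + b • (dir θ - dir θ') := by module
  rw [this]
  refine (norm_add_le _ _).trans ?_
  rw [norm_smul, norm_smul, norm_dir, mul_one, Real.norm_eq_abs, Real.norm_eq_abs]
  gcongr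
  exact norm_dir_sub_le _ _

lemma norm_smul_dirPerp_sub_le (a b θ θ' : ℝ) :
    ‖a • dirPerp θ - b • dirPerp θ'‖ ≤ |a - b| + |b| * |θ - θ'| := by
  have : a • dirPerp θ - b • dirPerp θ'
      = (a - b) • dirPerp θ + b • (dirPerp θ - dirPerp θ') := by module
  rw [this]
  refine (norm_add_le _ _).trans ?_
  rw [norm_smul, norm_smul, norm_dirPerp, mul_one, Real.norm_eq_abs, Real.norm_eq_abs]
  gcongr
  exact norm_dirPerp_sub_le _ _

lemma norm_elasticaVel_sub_le (hσ : IsTipSwing σ) (hτ : IsTipSwing τ) (hW : IsWeight W W')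
    {x : ℝ} (hx : x ∈ Icc (0 : ℝ) 1) :
    ‖elasticaVel τ W x - elasticaVel σ W x‖ ≤ elasticaModulus σ τ * W x := by
  have hX := hW.primitive_mem hx
  have hw := hW.pos x hx
  have hs := hσ.scale_pos
  have h0 := hσ.isSwing.1
  have h0' := hτ.isSwing.1
  have h1 := norm_smul_dir_sub_le (elasticaScale τ * W x) (elasticaScale σ * W x)
    (elasticaAngle τ (weightPrimitive W x)) (elasticaAngle σ (weightPrimitive W x))
  have h2 := abs_elasticaAngle_sub_le (τ := τ) h0.le hX
  rw [← sub_mul, abs_mul, abs_of_pos hw, abs_of_pos (mul_pos hs hw)] at h1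
  refine h1.trans ?_
  have h3 := mul_le_mul_of_nonneg_left h2 (mul_pos hs hw).le
  have h4 : 0 ≤ |elasticaScale τ - elasticaScale σ| * τ * W x := by positivity
  have h5 : 0 ≤ elasticaScale σ * ((3 + 2 * σ) * σ + (1 + σ)) * |τ - σ| * W x := by positivity
  unfold elasticaModulus
  nlinarith

lemma norm_elasticaAcc_sub_le (hσ : IsTipSwing σ) (hτ : IsTipSwing τ) (hW : IsWeight W W')
    {x : ℝ} (hx : x ∈ Icc (0 : ℝ) 1) :
    ‖elasticaAcc τ W W' x - elasticaAcc σ W W' x‖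
      ≤ elasticaModulus σ τ * (|W' x| + W x ^ 2) := by
  have hX := hW.primitive_mem hx
  have hw := hW.pos x hx
  have hs := hσ.scale_pos
  have h0 := hσ.isSwing.1
  have h0' := hτ.isSwing.1
  set X := weightPrimitive W x with hXdef
  set d := |τ - σ| with hd
  set e := |elasticaScale τ - elasticaScale σ| with he
  have hd0 : 0 ≤ d := abs_nonneg _
  have he0 : 0 ≤ e := abs_nonneg _
  have hang := abs_elasticaAngle_sub_le (τ := τ) h0.le hX
  have hrate := abs_elasticaRate_sub_le (τ := τ) h0.le hX
  have hr1 := abs_elasticaRate_le h0.le X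
  have hr2 := abs_elasticaRate_le h0'.le X
  have hA := norm_smul_dir_sub_le (elasticaScale τ * W' x) (elasticaScale σ * W' x)
    (elasticaAngle τ X) (elasticaAngle σ X)
  have hB := norm_smul_dirPerp_sub_le (elasticaScale τ * W x * -elasticaTurn τ W x)
    (elasticaScale σ * W x * -elasticaTurn σ W x) (elasticaAngle τ X) (elasticaAngle σ X)
  have hsplit : elasticaAcc τ W W' x - elasticaAcc σ W W' x
      = ((elasticaScale τ * W' x) • dir (elasticaAngle τ X)
          - (elasticaScale σ * W' x) • dir (elasticaAngle σ X))
        + ((elasticaScale τ * W x * -elasticaTurn τ W x) • dirPerp (elasticaAngle τ X)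
          - (elasticaScale σ * W x * -elasticaTurn σ W x) • dirPerp (elasticaAngle σ X)) := by
    simp only [elasticaAcc, polarAcc, ← hXdef]; module
  rw [hsplit]
  refine (norm_add_le _ _).trans ?_
  have hA' : |elasticaScale τ * W' x - elasticaScale σ * W' x| = e * |W' x| := by
    rw [← sub_mul, abs_mul]
  have hA'' : |elasticaScale σ * W' x| = elasticaScale σ * |W' x| := by
    rw [abs_mul, abs_of_pos hs]
  have hB' : |elasticaScale τ * W x * -elasticaTurn τ W x
      - elasticaScale σ * W x * -elasticaTurn σ W x|
      ≤ (e * τ + elasticaScale σ * ((1 + σ) * d)) * W x ^ 2 := by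
    have : elasticaScale τ * W x * -elasticaTurn τ W x
        - elasticaScale σ * W x * -elasticaTurn σ W x
        = -(((elasticaScale τ - elasticaScale σ) * elasticaRate τ X
          + elasticaScale σ * (elasticaRate τ X - elasticaRate σ X)) * W x ^ 2) := by
      simp only [elasticaTurn, ← hXdef]; ring
    rw [this, abs_neg, abs_mul, abs_of_nonneg (sq_nonneg (W x))]
    refine mul_le_mul_of_nonneg_right ((abs_add_le _ _).trans ?_) (sq_nonneg _)
    rw [abs_mul, abs_mul, abs_of_pos hs]
    gcongr
  have hB'' : |elasticaScale σ * W x * -elasticaTurn σ W x| ≤ elasticaScale σ * σ * W x ^ 2 := by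
    have : elasticaScale σ * W x * -elasticaTurn σ W x
        = -(elasticaScale σ * elasticaRate σ X * W x ^ 2) := by
      simp only [elasticaTurn, ← hXdef]; ring
    rw [this, abs_neg, abs_mul, abs_mul, abs_of_pos hs, abs_of_nonneg (sq_nonneg (W x))]
    gcongr
  rw [hA', hA''] at hA
  have hA3 : elasticaScale σ * |W' x| * |elasticaAngle τ X - elasticaAngle σ X|
      ≤ elasticaScale σ * |W' x| * ((3 + 2 * σ) * d) :=
    mul_le_mul_of_nonneg_left hang (by positivity)
  have hB3 : |elasticaScale σ * W x * -elasticaTurn σ W x|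
        * |elasticaAngle τ X - elasticaAngle σ X|
      ≤ elasticaScale σ * σ * W x ^ 2 * ((3 + 2 * σ) * d) :=
    mul_le_mul hB'' hang (abs_nonneg _) (by positivity)
  have hr : 0 ≤ e * τ * |W' x| := by positivity
  have hr' : 0 ≤ elasticaScale σ * ((3 + 2 * σ) * σ + (1 + σ)) * d * |W' x| := by positivity
  have hr'' : 0 ≤ e * W x ^ 2 := by positivity
  have hr''' : 0 ≤ elasticaScale σ * (3 + 2 * σ) * d * W x ^ 2 := by positivity
  unfold elasticaModulus
  rw [← hd, ← he]
  nlinarith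

/-- The elasticae with a fixed weight depend continuously on the length of the swing. -/
lemma exists_w22Dist_le (hσ : IsTipSwing σ) (hW : IsWeight W W') {γ : ℝ → Plane}
    (hγ : ∀ x ∈ Icc (0 : ℝ) 1, γ x = elasticaCurve σ W x) :
    ∃ J : ℝ, ∀ τ, IsTipSwing τ →
      w22Dist (elasticaCurve τ W) γ ≤ elasticaModulus σ τ * J := by
  have h01 : (0 : ℝ) ∈ Icc (0 : ℝ) 1 := ⟨le_rfl, zero_le_one⟩
  have h11 : (1 : ℝ) ∈ Icc (0 : ℝ) 1 := ⟨zero_le_one, le_rfl⟩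
  have hvelγ : ∀ x ∈ Icc (0 : ℝ) 1, vel γ x = elasticaVel σ W x := by
    intro x hx
    rw [← vel_elasticaCurve hW hx]
    exact derivWithin_congr hγ (hγ x hx)
  obtain ⟨M, hM⟩ := isCompact_Icc.exists_bound_of_continuousOn
    (hW.continuous.continuousOn (s := Icc 0 1))
  have hWM : ∀ x ∈ Icc (0 : ℝ) 1, W x ≤ M := fun x hx => (le_abs_self _).trans (hM x hx)
  have hM0 : 0 ≤ M := (hW.pos 0 h01).le.trans (hWM 0 h01)
  set b : ℝ → ℝ := fun x => M ^ 2 + M ^ 2 + (|W' x| + M ^ 2) ^ 2 with hb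
  have hbint : IntervalIntegrable b volume 0 1 := by
    have h1 : MemLp (fun x => |W' x| + M ^ 2) 2 (volume.restrict (Icc 0 1)) :=
      hW.isW12.memLp.norm.add (memLp_of_continuousOn continuousOn_const)
    exact intervalIntegrable_const.add
      (intervalIntegrable_of_integrableOn_Icc h1.integrable_sq h01 h11)
  refine ⟨√(∫ x in (0 : ℝ)..1, b x), fun τ hτ => ?_⟩
  set a := elasticaModulus σ τ with ha
  have ha0 : 0 ≤ a := by
    have := hσ.scale_pos
    have h0 := hσ.isSwing.1
    have h0' := hτ.isSwing.1
    rw [ha]; unfold elasticaModulus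
    positivity
  have hvle : ∀ x ∈ Icc (0 : ℝ) 1, ‖elasticaVel τ W x - elasticaVel σ W x‖ ≤ a * M :=
    fun x hx => (norm_elasticaVel_sub_le hσ hτ hW hx).trans
      (mul_le_mul_of_nonneg_left (hWM x hx) ha0)
  have hpos : ∀ x ∈ Icc (0 : ℝ) 1, ‖elasticaCurve τ W x - γ x‖ ≤ a * M := by
    intro x hx
    have h1 : elasticaCurve τ W x - γ x
        = ∫ t in (0 : ℝ)..x, (elasticaVel τ W t - elasticaVel σ W t) := by
      rw [hγ x hx, intervalIntegral.integral_sub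
        ((continuous_elasticaVel hW).intervalIntegrable _ _)
        ((continuous_elasticaVel hW).intervalIntegrable _ _)]
      rfl
    rw [h1]
    have h2 : ‖∫ t in (0 : ℝ)..x, (elasticaVel τ W t - elasticaVel σ W t)‖ ≤ a * M * |x - 0| := by
      refine intervalIntegral.norm_integral_le_of_norm_le_const fun t ht => ?_
      rw [uIoc_of_le hx.1] at ht
      exact hvle t ⟨ht.1.le, ht.2.trans hx.2⟩
    refine h2.trans (mul_le_of_le_one_right (mul_nonneg ha0 hM0) ?_)
    rw [sub_zero, abs_of_nonneg hx.1]; exact hx.2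
  have hae := acc_ae_eq (γ := elasticaCurve τ W) (fun x hx => vel_elasticaCurve hW hx)
    (isW12_elasticaVel hW)
  have hae' := acc_ae_eq hvelγ (isW12_elasticaVel hW)
  have hint : ∫ x in (0 : ℝ)..1, (‖elasticaCurve τ W x - γ x‖ ^ 2
      + ‖vel (elasticaCurve τ W) x - vel γ x‖ ^ 2
      + ‖acc (elasticaCurve τ W) x - acc γ x‖ ^ 2) ≤ ∫ x in (0 : ℝ)..1, a ^ 2 * b x := by
    rw [intervalIntegral_eq_setIntegral_Icc, intervalIntegral_eq_setIntegral_Icc]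
    refine integral_mono_of_nonneg (Eventually.of_forall fun x => by positivity) ?_ ?_
    · exact (intervalIntegrable_iff_integrableOn_Icc_of_le zero_le_one).1
        (hbint.const_mul (a ^ 2))
    · refine ae_restrict_Icc_of_Ioo ?_
      filter_upwards [hae, hae'] with x h1 h2 hxm
      have hx := Ioo_subset_Icc_self hxm
      beta_reduce
      rw [h1 hxm, h2 hxm, vel_elasticaCurve hW hx, hvelγ x hx]
      have e1 := hpos x hx
      have e2 := hvle x hx
      have e3 : ‖elasticaAcc τ W W' x - elasticaAcc σ W W' x‖ ≤ a * (|W' x| + M ^ 2) := by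
        refine (norm_elasticaAcc_sub_le hσ hτ hW hx).trans (mul_le_mul_of_nonneg_left ?_ ha0)
        have := pow_le_pow_left₀ (hW.pos x hx).le (hWM x hx) 2
        linarith
      have e1' := pow_le_pow_left₀ (norm_nonneg _) e1 2
      have e2' := pow_le_pow_left₀ (norm_nonneg _) e2 2
      have e3' := pow_le_pow_left₀ (norm_nonneg _) e3 2
      rw [mul_pow] at e1' e2' e3'
      simp only [hb]
      linarith
  rw [w22Dist]
  refine (Real.sqrt_le_sqrt hint).trans (le_of_eq ?_)
  rw [intervalIntegral.integral_const_mul, Real.sqrt_mul (sq_nonneg a), Real.sqrt_sq ha0]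

end

/-! ### Arclength -/

lemma IsW22Imm.strictMonoOn_arclength {γ : ℝ → Plane} (h : IsW22Imm γ) :
    StrictMonoOn (arclength γ) (Icc 0 1) := by
  intro x hx y hy hxy
  have hc := h.1.continuousOn_vel.norm
  have hint : ∀ a ∈ Icc (0 : ℝ) 1, ∀ b ∈ Icc (0 : ℝ) 1,
      IntervalIntegrable (fun t => ‖vel γ t‖) volume a b := fun a ha b hb =>
    (hc.mono (uIcc_subset_Icc ha hb)).intervalIntegrable
  have h0 : (0 : ℝ) ∈ Icc (0 : ℝ) 1 := ⟨le_rfl, zero_le_one⟩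
  have h1 : 0 < ∫ t in x..y, ‖vel γ t‖ :=
    intervalIntegral.intervalIntegral_pos_of_pos_on (hint x hx y hy)
      (fun t ht => norm_pos_iff.2 (h.2 t ⟨hx.1.trans ht.1.le, ht.2.le.trans hy.2⟩)) hxy
  have h2 := intervalIntegral.integral_add_adjacent_intervals (hint 0 h0 x hx) (hint x hx y hy)
  unfold arclength
  linarith

lemma IsW22Imm.paramOfArclength_arclength {γ : ℝ → Plane} (h : IsW22Imm γ) {x : ℝ}
    (hx : x ∈ Icc (0 : ℝ) 1) : paramOfArclength γ (arclength γ x) = x :=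
  h.strictMonoOn_arclength.injOn.leftInvOn_invFunOn hx

lemma arclength_zero (γ : ℝ → Plane) : arclength γ 0 = 0 := intervalIntegral.integral_same

lemma vel_symm {γ : ℝ → Plane} (h : IsW22 γ)
    (hs : ∀ x ∈ Icc (0 : ℝ) 1, γ (1 - x) = !₂[1 - γ x 0, γ x 1]) {x : ℝ}
    (hx : x ∈ Icc (0 : ℝ) 1) : vel γ (1 - x) = !₂[vel γ x 0, -vel γ x 1] := by
  have hx' : 1 - x ∈ Icc (0 : ℝ) 1 := ⟨by linarith [hx.2], by linarith [hx.1]⟩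
  have h1 : HasDerivWithinAt (fun y => γ (1 - y)) ((-1 : ℝ) • vel γ (1 - x)) (Icc 0 1) x :=
    (h.hasDerivWithinAt hx').scomp x ((hasDerivAt_id x).const_sub 1).hasDerivWithinAt
      (fun y hy => ⟨by simpa using hy.2, by simpa using hy.1⟩)
  have h2 := hasDerivWithinAt_plane.1 (h.hasDerivWithinAt hx)
  have h3 : HasDerivWithinAt (fun y => γ (1 - y)) !₂[-vel γ x 0, vel γ x 1] (Icc 0 1) x := by
    refine HasDerivWithinAt.congr (f := fun y => !₂[1 - γ y 0, γ y 1]) ?_ hs (hs x hx)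
    rw [hasDerivWithinAt_plane]
    intro i; fin_cases i
    · exact (h2 0).const_sub 1
    · exact h2 1
  have h4 := (uniqueDiffOn_Icc zero_lt_one x hx).eq_deriv _ h1 h3
  have h5 : vel γ (1 - x) = -((-1 : ℝ) • vel γ (1 - x)) := by simp
  rw [h5, h4]
  refine plane_eq ?_ ?_ <;> simp

lemma norm_vel_symm {γ : ℝ → Plane} (h : IsW22 γ)
    (hs : ∀ x ∈ Icc (0 : ℝ) 1, γ (1 - x) = !₂[1 - γ x 0, γ x 1]) {x : ℝ}
    (hx : x ∈ Icc (0 : ℝ) 1) : ‖vel γ (1 - x)‖ = ‖vel γ x‖ := by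
  rw [vel_symm h hs hx, ← sq_eq_sq₀ (norm_nonneg _) (norm_nonneg _), norm_sq_plane, norm_sq_plane]
  simp

lemma vel_half_one {γ : ℝ → Plane} (h : IsW22 γ)
    (hs : ∀ x ∈ Icc (0 : ℝ) 1, γ (1 - x) = !₂[1 - γ x 0, γ x 1]) : vel γ (1 / 2) 1 = 0 := by
  have h1 := vel_symm h hs (x := 1 / 2) (by norm_num)
  rw [show (1 : ℝ) - 1 / 2 = 1 / 2 by norm_num] at h1
  have h2 := congrArg (fun v : Plane => v 1) h1
  simp at h2
  norm_num at h2 ⊢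
  linarith

/-! ### Existence of symmetric cut-and-glued elasticae -/

lemma contDiff_pendulumRate : ContDiff ℝ 2 pendulumRate := by
  have hφ : ContDiff ℝ 1 pendulumAngle := by
    rw [contDiff_one_iff_deriv]
    refine ⟨fun x => (hasDerivAt_pendulumAngle x).differentiableAt, ?_⟩
    rw [show deriv pendulumAngle = pendulumRate from
      funext fun x => (hasDerivAt_pendulumAngle x).deriv]
    exact continuous_pendulumRate
  rw [show (2 : WithTop ℕ∞) = 1 + 1 by norm_num, contDiff_succ_iff_deriv]
  refine ⟨fun x => (hasDerivAt_pendulumRate x).differentiableAt, by simp, ?_⟩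
  rw [show deriv pendulumRate = fun x => Real.cos (pendulumAngle x) / 2 from
    funext fun x => (hasDerivAt_pendulumRate x).deriv]
  exact (Real.contDiff_cos.comp hφ).div_const 2

lemma isWeight_two : IsWeight (fun _ => 2) (fun _ => 0) where
  continuous := continuous_const
  isW12 := ⟨((LipschitzWith.const (2 : ℝ)).lipschitzOnWith (s := _)).absolutelyContinuousOnInterval,
    memLp_of_continuousOn continuousOn_const, Eventually.of_forall fun x _ => hasDerivAt_const x 2⟩
  pos := fun _ _ => two_pos
  symm := fun _ _ => rfl
  integral_eq := by simp

/-- The elastica with its tip on the tip of the cone, parametrized with constant speed, is a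
symmetric cut-and-glued free elastica. -/
lemma isSCF_elasticaCurve {ψ : ℝ → ℝ} (hψ : IsObstacle ψ) (hcone : IsSymmetricCone ψ) {σ : ℝ}
    (hσ : IsTipSwing σ)
    (htip : tipHeight (pendulumAngle σ) = 2 * ψ (1 / 2) * tipWidth (pendulumAngle σ)) :
    IsSCF ψ (elasticaCurve σ fun _ => 2) := by
  have hW := isWeight_two
  have hg := hσ.width_pos
  have hσ0 := hσ.isSwing.1
  have hsc := hσ.scale_pos
  set γ := elasticaCurve σ fun _ => 2 with hγ
  set c := 2 * tipWidth (pendulumAngle σ) with hc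
  have hc0 : 0 < c := by positivity
  have himm : IsW22Imm γ := isW22Imm_elasticaCurve hσ hW
  have hvel : ∀ x ∈ Icc (0 : ℝ) 1, vel γ x = elasticaVel σ (fun _ => 2) x := fun x hx =>
    vel_elasticaCurve hW hx
  have hnorm : ∀ x ∈ Icc (0 : ℝ) 1, ‖vel γ x‖ = 2 * σ / c := fun x hx => by
    rw [hvel x hx, norm_elasticaVel hσ hW hx, elasticaScale]; ring
  have harc : ∀ x ∈ Icc (0 : ℝ) 1, arclength γ x = 2 * σ / c * x := by
    intro x hx
    have : arclength γ x = ∫ t in (0 : ℝ)..x, 2 * σ / c := by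
      refine intervalIntegral.integral_congr fun t ht => ?_
      rw [uIcc_of_le hx.1] at ht
      exact hnorm t ⟨ht.1, ht.2.trans hx.2⟩
    rw [this]; simp; ring
  have hL : curveLength γ / 2 = σ / c := by
    rw [curveLength, harc 1 ⟨zero_le_one, le_rfl⟩]; ring
  have hparam : ∀ s ∈ Icc 0 (σ / c), paramOfArclength γ s = c * s / (2 * σ) ∧
      c * s / (2 * σ) ∈ Icc (0 : ℝ) (1 / 2) := by
    intro s hs
    have hmem : c * s / (2 * σ) ∈ Icc (0 : ℝ) (1 / 2) := by
      refine ⟨div_nonneg (mul_nonneg hc0.le hs.1) (by positivity), ?_⟩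
      have := (le_div_iff₀ hc0).1 hs.2
      rw [div_le_iff₀ (by positivity)]; linarith
    have hmem' : c * s / (2 * σ) ∈ Icc (0 : ℝ) 1 := ⟨hmem.1, hmem.2.trans (by norm_num)⟩
    refine ⟨?_, hmem⟩
    have h1 := himm.paramOfArclength_arclength hmem'
    rw [harc _ hmem'] at h1
    rwa [show 2 * σ / c * (c * s / (2 * σ)) = s by field_simp] at h1
  have hprim : ∀ x, weightPrimitive (fun _ => (2 : ℝ)) x = 2 * x := fun x => by
    simp [weightPrimitive, mul_comm]
  have hT : ∀ x ∈ Icc (0 : ℝ) 1, unitTangent γ x = dir (elasticaAngle σ (2 * x)) := by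
    intro x hx
    rw [unitTangent, hnorm x hx, hvel x hx, elasticaVel, polarVel, smul_smul, hprim,
      elasticaScale]
    have : (2 * σ / c)⁻¹ * (σ / (2 * tipWidth (pendulumAngle σ)) * 2) = 1 := by
      rw [← hc]; field_simp
    rw [this, one_smul]
  have hT' : ∀ x ∈ Icc (0 : ℝ) 1, derivWithin (unitTangent γ) (Icc 0 1) x
      = (-(2 * elasticaRate σ (2 * x))) • dirPerp (elasticaAngle σ (2 * x)) := by
    intro x hx
    have h1 : HasDerivAt (fun x => elasticaAngle σ (2 * x)) (-(2 * elasticaRate σ (2 * x))) x := by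
      refine ((hasDerivAt_elasticaAngle σ (2 * x)).comp x
        ((hasDerivAt_id x).const_mul 2)).congr_deriv ?_
      simp; ring
    have h2 := ((hasDerivAt_dir (elasticaAngle σ (2 * x))).scomp x h1).hasDerivWithinAt
      (s := Icc 0 1)
    exact (h2.congr hT (hT x hx)).derivWithin (uniqueDiffOn_Icc zero_lt_one x hx)
  have hk : ∀ s ∈ Icc 0 (σ / c), signedCurvature γ s = -(c * pendulumRate (c * s)) := by
    intro s hs
    obtain ⟨hp, hm⟩ := hparam s hs
    have hm' : c * s / (2 * σ) ∈ Icc (0 : ℝ) 1 := ⟨hm.1, hm.2.trans (by norm_num)⟩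
    rw [signedCurvature, hp]
    set x := c * s / (2 * σ) with hx
    have hn : unitNormal γ x = dirPerp (elasticaAngle σ (2 * x)) := by
      rw [unitNormal, hT x hm']; rfl
    have hrate : elasticaRate σ (2 * x) = σ * pendulumRate (c * s) := by
      rw [elasticaRate, min_eq_left (by linarith [hm.2])]
      congr 2
      rw [hx]; field_simp
    rw [hn, curvatureVec, hnorm x hm', hT' x hm', inner_smul_left, inner_smul_left,
      real_inner_self_eq_norm_sq, norm_dirPerp, hrate]
    simp
    field_simp
  have hkd : ∀ s, HasDerivAt (fun s => -(c * pendulumRate (c * s)))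
      (-(c ^ 2 * Real.cos (pendulumAngle (c * s)) / 2)) s := by
    intro s
    refine (((hasDerivAt_pendulumRate (c * s)).comp s
      ((hasDerivAt_id s).const_mul c)).const_mul c).neg.congr_deriv ?_
    simp; ring
  have hkd2 : ∀ s, HasDerivAt (fun s => -(c ^ 2 * Real.cos (pendulumAngle (c * s)) / 2))
      (c ^ 3 * pendulumRate (c * s) ^ 3 / 2) s := by
    intro s
    have h1 : HasDerivAt (fun s => pendulumAngle (c * s)) (c * pendulumRate (c * s)) s := by
      refine ((hasDerivAt_pendulumAngle (c * s)).comp s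
        ((hasDerivAt_id s).const_mul c)).congr_deriv ?_
      simp; ring
    refine (((h1.cos.const_mul (c ^ 2)).div_const 2).neg).congr_deriv ?_
    rw [pow_succ (pendulumRate (c * s)) 2, pendulumRate_sq]; ring
  have heq : ∀ s ∈ Ioo 0 (σ / c),
      signedCurvature γ =ᶠ[𝓝 s] fun s => -(c * pendulumRate (c * s)) := by
    intro s hs
    filter_upwards [Icc_mem_nhds hs.1 hs.2] with t ht
    exact hk t ht
  refine ⟨elasticaCurve_mem hψ hcone hσ hW le_rfl htip, ?_, ?_, ?_, ?_, ?_⟩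
  · rw [hL]
    have h1 : ContDiff ℝ 2 fun s => -(c * pendulumRate (c * s)) :=
      (contDiff_const.mul (contDiff_pendulumRate.comp (contDiff_const.mul contDiff_id))).neg
    exact h1.contDiffOn.congr fun s hs => hk s (Ioo_subset_Icc_self hs)
  · rw [hL]
    intro s hs
    have h1 : deriv (signedCurvature γ)
        =ᶠ[𝓝 s] fun s => -(c ^ 2 * Real.cos (pendulumAngle (c * s)) / 2) := by
      filter_upwards [Ioo_mem_nhds hs.1 hs.2] with t ht
      rw [(heq t ht).deriv_eq, (hkd t).deriv]
    rw [h1.deriv_eq, (hkd2 s).deriv, hk s (Ioo_subset_Icc_self hs)]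
    ring
  · rw [hk 0 ⟨le_rfl, by positivity⟩]; simp [pendulumRate_zero]
  · rw [hL]
    intro s hs
    rw [hk s (Ioo_subset_Icc_self hs), neg_lt_zero]
    refine mul_pos hc0 (hσ.isSwing.2 _ ⟨mul_pos hc0 hs.1, ?_⟩)
    have := (lt_div_iff₀ hc0).1 hs.2
    linarith
  · rw [hL, arclengthParam, (hparam (σ / c) ⟨by positivity, le_rfl⟩).1]
    have h1 : c * (σ / c) / (2 * σ) = 1 / 2 := by field_simp
    rw [h1, hγ, elasticaCurve_half hσ hW, htip]
    congr 3
    field_simp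

/-! ### Free elasticae are solutions of the pendulum equation -/

lemma hasDerivWithinAt_Ici_of_continuousOn {E : Type*} [NormedAddCommGroup E] [NormedSpace ℝ E]
    {f f' : ℝ → E} {l : ℝ} (hf : ContinuousOn f (Icc 0 l))
    (hd : ∀ x ∈ Ioo 0 l, HasDerivAt f (f' x) x) (hf' : ContinuousOn f' (Icc 0 l)) :
    ∀ x ∈ Ico 0 l, HasDerivWithinAt f (f' x) (Ici x) x := by
  intro x hx
  rcases hx.1.eq_or_lt with rfl | h0
  · have hmem : Ioo 0 l ∈ 𝓝[>] (0 : ℝ) := Ioo_mem_nhdsGT hx.2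
    refine hasDerivWithinAt_Ici_of_tendsto_deriv (s := Ioo 0 l)
      (fun y hy => (hd y hy).differentiableAt.differentiableWithinAt)
      ((hf 0 ⟨le_rfl, hx.2.le⟩).mono Ioo_subset_Icc_self) hmem ?_
    have h1 : Tendsto f' (𝓝[>] 0) (𝓝 (f' 0)) := by
      refine (hf' 0 ⟨le_rfl, hx.2.le⟩).tendsto.mono_left ?_
      exact (nhdsWithin_le_iff.2 (mem_of_superset hmem Ioo_subset_Icc_self))
    refine h1.congr' ?_
    filter_upwards [hmem] with y hy
    exact (hd y hy).deriv.symm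
  · exact (hd x ⟨h0, hx.2⟩).hasDerivWithinAt

lemma exists_eq_dir {v : Plane} (hv : ‖v‖ = 1) : ∃ θ, v = dir θ := by
  have h1 : v 0 ^ 2 + v 1 ^ 2 = 1 := by rw [← norm_sq_plane, hv, one_pow]
  have hn : ‖(⟨v 0, v 1⟩ : ℂ)‖ = 1 := by
    rw [← sq_eq_sq₀ (norm_nonneg _) zero_le_one, Complex.sq_norm, Complex.normSq_mk]
    linarith
  have h0 : (⟨v 0, v 1⟩ : ℂ) ≠ 0 := norm_pos_iff.1 (by rw [hn]; exact one_pos)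
  refine ⟨Complex.arg ⟨v 0, v 1⟩, plane_eq ?_ ?_⟩
  · rw [dir_zero, Complex.cos_arg h0, hn, div_one]
  · rw [dir_one, Complex.sin_arg, hn, div_one]

lemma eq_of_hasDerivAt_zero {f : ℝ → ℝ} {l : ℝ} (hd : ∀ x ∈ Ioo 0 l, HasDerivAt f 0 x) :
    ∀ x ∈ Ioo 0 l, f x = f (l / 2) := by
  intro x hx
  have hl : l / 2 ∈ Ioo 0 l := ⟨by linarith [hx.1, hx.2], by linarith [hx.1, hx.2]⟩
  exact isOpen_Ioo.is_const_of_deriv_eq_zero isPreconnected_Ioo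
    (fun y hy => (hd y hy).differentiableAt.differentiableWithinAt)
    (fun y hy => (hd y hy).deriv) hx hl

/-- A curve with curvature `k < 0` solving the equation `2 k'' + k³ = 0` of free elasticae, whose
curvature vanishes at the starting point, is a scaled and rotated pendulum curve. The parameter is
arbitrary, with speed `w`; `k₁` is the arclength derivative of `k`. The hypothesis on the curvature
at `0` only concerns the one-sided derivative of the tangent, if this exists. The reason is that
the vector with the coordinates `k² t₀ - 2 k₁ t₁` and `k² t₁ + 2 k₁ t₀`, for the unit tangent `t`,
is conserved. -/
lemma elastica_eq_pendulum {w k k₁ : ℝ → ℝ} {T : ℝ → Plane} {l : ℝ} (hl : 0 < l)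
    (hw : Continuous w) (hw0 : ∀ x ∈ Icc 0 l, 0 < w x) (hT : ContinuousOn T (Icc 0 l))
    (hT1 : ∀ x ∈ Icc 0 l, ‖T x‖ = 1)
    (hT' : ∀ x ∈ Ioo 0 l, HasDerivAt T ((w x * k x) • (!₂[-(T x 1), T x 0] : Plane)) x)
    (hk : ∀ x ∈ Ioo 0 l, HasDerivAt k (w x * k₁ x) x)
    (hk₁ : ∀ x ∈ Ioo 0 l, HasDerivAt k₁ (-(w x * k x ^ 3 / 2)) x)
    (hneg : ∀ x ∈ Ioo 0 l, k x < 0)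
    (hzero : ∀ κ, HasDerivWithinAt T ((w 0 * κ) • (!₂[-(T 0 1), T 0 0] : Plane)) (Ici 0) 0 →
      κ = 0) :
    ∃ c θ₀ : ℝ, 0 < c ∧
      (∀ x ∈ Icc 0 l, T x = dir (θ₀ - pendulumAngle (c * ∫ t in (0 : ℝ)..x, w t))) ∧
      ∀ x ∈ Ioo 0 l, k x = -(c * pendulumRate (c * ∫ t in (0 : ℝ)..x, w t)) := by
  have h0l : (0 : ℝ) ∈ Icc 0 l := ⟨le_rfl, hl.le⟩
  have hmid : l / 2 ∈ Ioo 0 l := ⟨by linarith, by linarith⟩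
  have hTc : ∀ i, ContinuousOn (fun x => T x i) (Icc 0 l) := fun i =>
    (EuclideanSpace.proj (𝕜 := ℝ) i : Plane →L[ℝ] ℝ).continuous.comp_continuousOn hT
  have hunit : ∀ x ∈ Icc 0 l, T x 0 ^ 2 + T x 1 ^ 2 = 1 := fun x hx => by
    rw [← norm_sq_plane, hT1 x hx, one_pow]
  have ht0 : ∀ x ∈ Ioo 0 l, HasDerivAt (fun x => T x 0) (-(w x * k x * T x 1)) x := fun x hx =>
    (hasDerivAt_plane.1 (hT' x hx) 0).congr_deriv (by simp)
  have ht1 : ∀ x ∈ Ioo 0 l, HasDerivAt (fun x => T x 1) (w x * k x * T x 0) x := fun x hx =>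
    (hasDerivAt_plane.1 (hT' x hx) 1).congr_deriv (by simp)
  obtain ⟨A, hA⟩ : ∃ A, ∀ x ∈ Ioo 0 l, k x ^ 2 * T x 0 - 2 * k₁ x * T x 1 = A :=
    ⟨_, eq_of_hasDerivAt_zero (f := fun x => k x ^ 2 * T x 0 - 2 * k₁ x * T x 1) fun x hx =>
      ((((hk x hx).pow 2).mul (ht0 x hx)).sub
        (((hk₁ x hx).const_mul 2).mul (ht1 x hx))).congr_deriv (by simp; ring)⟩
  obtain ⟨B, hB⟩ : ∃ B, ∀ x ∈ Ioo 0 l, k x ^ 2 * T x 1 + 2 * k₁ x * T x 0 = B :=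
    ⟨_, eq_of_hasDerivAt_zero (f := fun x => k x ^ 2 * T x 1 + 2 * k₁ x * T x 0) fun x hx =>
      ((((hk x hx).pow 2).mul (ht1 x hx)).add
        (((hk₁ x hx).const_mul 2).mul (ht0 x hx))).congr_deriv (by simp; ring)⟩
  set q : ℝ → ℝ := fun x => A * T x 0 + B * T x 1 with hq
  have hqc : ContinuousOn q (Icc 0 l) := ((hTc 0).const_mul A).add ((hTc 1).const_mul B)
  have hqk : ∀ x ∈ Ioo 0 l, q x = k x ^ 2 := fun x hx => by
    have h1 := hunit x (Ioo_subset_Icc_self hx)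
    simp only [hq]
    linear_combination (-T x 0) * hA x hx - T x 1 * hB x hx + k x ^ 2 * h1
  have hk1 : ∀ x ∈ Ioo 0 l, 2 * k₁ x = B * T x 0 - A * T x 1 := fun x hx => by
    have h1 := hunit x (Ioo_subset_Icc_self hx)
    linear_combination T x 0 * hB x hx - T x 1 * hA x hx - 2 * k₁ x * h1
  -- the continuous representative of the curvature on the closed interval
  set ke : ℝ → ℝ := fun x => -√(q x) with hke
  have hkec : ContinuousOn ke (Icc 0 l) := hqc.sqrt.neg
  have hkek : ∀ x ∈ Ioo 0 l, k x = ke x := fun x hx => by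
    simp only [hke]
    rw [hqk x hx, Real.sqrt_sq_eq_abs, abs_of_neg (hneg x hx), neg_neg]
  have hTd : ∀ x ∈ Ico 0 l,
      HasDerivWithinAt T ((w x * ke x) • (!₂[-(T x 1), T x 0] : Plane)) (Ici x) x := by
    refine hasDerivWithinAt_Ici_of_continuousOn
      (f' := fun x => (w x * ke x) • (!₂[-(T x 1), T x 0] : Plane)) hT (fun x hx => ?_) ?_
    · rw [← hkek x hx]; exact hT' x hx
    · refine (hw.continuousOn.mul hkec).fun_smul ?_
      have : Continuous fun v : Plane => (!₂[-(v 1), v 0] : Plane) :=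
        continuous_plane_mk (by fun_prop) (by fun_prop)
      exact this.comp_continuousOn hT
  have hke0 : ke 0 = 0 := hzero _ (hTd 0 ⟨le_rfl, hl⟩)
  obtain ⟨θ₀, hθ₀⟩ := exists_eq_dir (hT1 0 h0l)
  have hq0 : A * Real.cos θ₀ + B * Real.sin θ₀ = 0 := by
    have hnn : 0 ≤ q 0 := by
      have h1 : Tendsto q (𝓝[Ioo 0 l] 0) (𝓝 (q 0)) := (hqc 0 h0l).mono Ioo_subset_Icc_self
      have : (𝓝[Ioo 0 l] (0 : ℝ)).NeBot := left_nhdsWithin_Ioo_neBot hl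
      refine ge_of_tendsto h1 (eventually_nhdsWithin_of_forall fun x hx => ?_)
      rw [hqk x hx]; positivity
    have h1 : √(q 0) = 0 := neg_eq_zero.1 hke0
    have h2 := (Real.sqrt_eq_zero hnn).1 h1
    simpa [hq, hθ₀] using h2
  set a := B * Real.cos θ₀ - A * Real.sin θ₀ with ha
  have hcs := Real.sin_sq_add_cos_sq θ₀
  have hAa : A = -(a * Real.sin θ₀) := by
    rw [ha]; linear_combination (-A) * hcs + Real.cos θ₀ * hq0
  have hBa : B = a * Real.cos θ₀ := by
    rw [ha]; linear_combination (-B) * hcs + Real.sin θ₀ * hq0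
  have hked : ∀ x ∈ Ioo 0 l, HasDerivAt ke
      (w x * (a / 2 * (Real.cos θ₀ * T x 0 + Real.sin θ₀ * T x 1))) x := fun x hx => by
    have h1 : k =ᶠ[𝓝 x] ke := by
      filter_upwards [Ioo_mem_nhds hx.1 hx.2] with y hy
      exact hkek y hy
    refine ((hk x hx).congr_of_eventuallyEq h1.symm).congr_deriv ?_
    have h2 := hk1 x hx
    rw [hAa, hBa] at h2
    rw [show k₁ x = (2 * k₁ x) / 2 by ring, h2]; ring
  have hdc : ContinuousOn (fun x => Real.cos θ₀ * T x 0 + Real.sin θ₀ * T x 1) (Icc 0 l) :=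
    ((hTc 0).const_mul _).add ((hTc 1).const_mul _)
  -- `a / 2` is the arclength derivative of the curvature at `0`, where the negative curvature vanishes
  have ha0 : a < 0 := by
    rcases lt_trichotomy a 0 with h | h | h
    · exact h
    · exfalso
      rw [h] at hAa hBa
      have h1 := hqk _ hmid
      have h2 := hneg _ hmid
      simp only [hq, hAa, hBa] at h1
      have h3 : 0 < k (l / 2) ^ 2 := by nlinarith
      linarith
    · exfalso
      have hev : ∀ᶠ x in 𝓝[≥] (0 : ℝ), 0 < Real.cos θ₀ * T x 0 + Real.sin θ₀ * T x 1 := by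
        have h1 := (hdc 0 h0l).tendsto
        rw [nhdsWithin_Icc_eq_nhdsGE hl] at h1
        refine h1.eventually_const_lt ?_
        rw [hθ₀, dir_zero, dir_one]; nlinarith
      obtain ⟨d, hd0, hd⟩ := (mem_nhdsGE_iff_exists_Icc_subset).1 hev
      have hd0' : (0 : ℝ) < d := hd0
      set m := min d (l / 2) with hm
      have hm0 : 0 < m := lt_min hd0' hmid.1
      have hml : m < l := (min_le_right _ _).trans_lt hmid.2
      have hmono : StrictMonoOn ke (Icc 0 m) := by
        refine strictMonoOn_of_deriv_pos (convex_Icc 0 m)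
          (hkec.mono (Icc_subset_Icc_right hml.le)) fun x hx => ?_
        rw [interior_Icc] at hx
        have hxl : x ∈ Ioo 0 l := ⟨hx.1, hx.2.trans hml⟩
        rw [(hked x hxl).deriv]
        have h1 : 0 < Real.cos θ₀ * T x 0 + Real.sin θ₀ * T x 1 :=
          hd ⟨hx.1.le, hx.2.le.trans (min_le_left _ _)⟩
        exact mul_pos (hw0 x (Ioo_subset_Icc_self hxl)) (by positivity)
      have h1 := hmono ⟨le_rfl, hm0.le⟩ ⟨hm0.le, le_rfl⟩ hm0
      rw [hke0, ← hkek m ⟨hm0, hml⟩] at h1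
      linarith [hneg m ⟨hm0, hml⟩]
  set c := √(-a) with hc
  have hc0 : 0 < c := Real.sqrt_pos.2 (by linarith)
  have hc2 : c ^ 2 = -a := Real.sq_sqrt (by linarith)
  -- the lift of the tangent angle
  set g : ℝ → ℝ := fun x => w x * (c * IccExtend hl.le (fun y : Icc 0 l => -(ke y) / c) x) with hg
  have hgc : Continuous g := by
    refine hw.mul (continuous_const.mul (Continuous.Icc_extend' ?_))
    exact (continuousOn_iff_continuous_domRestrict.1 hkec).neg.div_const c
  have hgx : ∀ x ∈ Icc 0 l, g x = -(w x * ke x) := fun x hx => by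
    simp only [hg]
    rw [IccExtend_of_mem hl.le _ hx]
    field_simp
  set Ψ : ℝ → ℝ := fun x => ∫ t in (0 : ℝ)..x, g t with hΨ
  have hΨd : ∀ x, HasDerivAt Ψ (g x) x := fun x =>
    intervalIntegral.integral_hasDerivAt_right (hgc.intervalIntegrable _ _)
      (hgc.stronglyMeasurableAtFilter _ _) hgc.continuousAt
  have hΨ0 : Ψ 0 = 0 := intervalIntegral.integral_same
  have hΨc : Continuous Ψ := continuous_iff_continuousAt.2 fun x => (hΨd x).continuousAt
  have hE : ∀ x ∈ Icc 0 l, T x 0 * Real.cos (θ₀ - Ψ x) + T x 1 * Real.sin (θ₀ - Ψ x) = 1 := by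
    have h1 := constant_of_has_deriv_right_zero (a := 0) (b := l)
      (f := fun x => T x 0 * Real.cos (θ₀ - Ψ x) + T x 1 * Real.sin (θ₀ - Ψ x))
      (((hTc 0).mul (by fun_prop)).add ((hTc 1).mul (by fun_prop))) (fun x hx => by
        have e0 := hasDerivWithinAt_plane.1 (hTd x hx) 0
        have e1 := hasDerivWithinAt_plane.1 (hTd x hx) 1
        have e2 := ((hΨd x).const_sub θ₀).hasDerivWithinAt (s := Ici x)
        refine ((e0.mul e2.cos).add (e1.mul e2.sin)).congr_deriv ?_
        rw [hgx x ⟨hx.1, hx.2.le⟩]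
        simp; ring)
    intro x hx
    have h2 : T x 0 * Real.cos (θ₀ - Ψ x) + T x 1 * Real.sin (θ₀ - Ψ x)
      = T 0 0 * Real.cos (θ₀ - Ψ 0) + T 0 1 * Real.sin (θ₀ - Ψ 0) := h1 x hx
    rw [h2, hΨ0, hθ₀, dir_zero, dir_one, sub_zero]
    linarith
  have hTΨ : ∀ x ∈ Icc 0 l, T x = dir (θ₀ - Ψ x) := by
    intro x hx
    have h1 := hE x hx
    have h2 := hunit x hx
    have h3 := Real.sin_sq_add_cos_sq (θ₀ - Ψ x)
    have h4 : (T x 0 - Real.cos (θ₀ - Ψ x)) ^ 2 + (T x 1 - Real.sin (θ₀ - Ψ x)) ^ 2 = 0 := by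
      linear_combination h2 + h3 - 2 * h1
    refine plane_eq ?_ ?_
    · rw [dir_zero]; nlinarith
    · rw [dir_one]; nlinarith
  have hP := pendulum_unique (a := Ψ) (b := fun x => -(ke x) / c) (r := fun x => c * w x)
    (R := fun x => c * ∫ t in (0 : ℝ)..x, w t) (l := l)
    (M := c * (isCompact_Icc.exists_bound_of_continuousOn (hw.continuousOn (s := Icc 0 l))).choose)
    (fun t ht => by
      have := (isCompact_Icc.exists_bound_of_continuousOn
        (hw.continuousOn (s := Icc 0 l))).choose_spec t ⟨ht.1, ht.2.le⟩
      rw [abs_mul, abs_of_pos hc0]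
      exact mul_le_mul_of_nonneg_left this hc0.le)
    (fun t => (intervalIntegral.integral_hasDerivAt_right (hw.intervalIntegrable _ _)
      (hw.stronglyMeasurableAtFilter _ _) hw.continuousAt).const_mul c)
    (by simp) hΨc.continuousOn (hkec.neg.div_const c)
    (fun t ht => by
      refine (hΨd t).hasDerivWithinAt.congr_deriv ?_
      rw [hgx t ⟨ht.1, ht.2.le⟩]
      field_simp)
    (fun t ht => by
      have h1 := hasDerivWithinAt_Ici_of_continuousOn hkec hked
        (hw.continuousOn.mul (hdc.const_mul (a / 2))) t ht
      refine (h1.neg.div_const c).congr_deriv ?_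
      rw [hTΨ t ⟨ht.1, ht.2.le⟩, dir_zero, dir_one, ← Real.cos_sub, sub_sub_cancel,
        show a = -c ^ 2 by linarith]
      field_simp)
    hΨ0 (by simp [hke0])
  refine ⟨c, θ₀, hc0, fun x hx => ?_, fun x hx => ?_⟩
  · rw [hTΨ x hx, (hP x hx).1]
  · have h1 := (hP x (Ioo_subset_Icc_self hx)).2
    rw [hkek x hx, ← h1]
    field_simp

/-! ### The structure of symmetric cut-and-glued elasticae -/

/-- The speed of a curve, extended continuously from `[0,1]` to the real line. -/
def curveSpeed (γ : ℝ → Plane) (x : ℝ) : ℝ := ‖vel γ (projIcc 0 1 zero_le_one x)‖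

lemma curveSpeed_eq (γ : ℝ → Plane) {x : ℝ} (hx : x ∈ Icc (0 : ℝ) 1) :
    curveSpeed γ x = ‖vel γ x‖ := by
  rw [curveSpeed, projIcc_of_mem zero_le_one hx]

lemma IsW22.continuous_curveSpeed {γ : ℝ → Plane} (h : IsW22 γ) : Continuous (curveSpeed γ) := by
  have h1 : Continuous fun y : Icc (0 : ℝ) 1 => vel γ y :=
    continuousOn_iff_continuous_domRestrict.1 h.continuousOn_vel
  exact (h1.comp continuous_projIcc).norm

lemma arclength_eq (γ : ℝ → Plane) {x : ℝ} (hx : x ∈ Icc (0 : ℝ) 1) :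
    arclength γ x = ∫ t in (0 : ℝ)..x, curveSpeed γ t := by
  refine intervalIntegral.integral_congr fun t ht => ?_
  rw [uIcc_of_le hx.1] at ht
  exact (curveSpeed_eq γ ⟨ht.1, ht.2.trans hx.2⟩).symm

lemma IsW22Imm.curveLength_pos {γ : ℝ → Plane} (h : IsW22Imm γ) : 0 < curveLength γ := by
  have := h.strictMonoOn_arclength ⟨le_rfl, zero_le_one⟩ ⟨zero_le_one, le_rfl⟩ zero_lt_one
  rwa [arclength_zero] at this

/-- The normalized speed of a symmetric curve is a weight. -/
lemma IsW22Imm.isWeight_curveSpeed {γ : ℝ → Plane} (h : IsW22Imm γ)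
    (hs : ∀ x ∈ Icc (0 : ℝ) 1, γ (1 - x) = !₂[1 - γ x 0, γ x 1]) :
    IsWeight (fun x => 2 / curveLength γ * curveSpeed γ x) (fun x => 2 / curveLength γ *
      ((vel γ x 0 * acc γ x 0 + vel γ x 1 * acc γ x 1) / ‖vel γ x‖)) := by
  have hL := h.curveLength_pos
  have hV := h.1.isW12_vel
  have hVc := h.1.continuousOn_vel
  refine ⟨continuous_const.mul h.1.continuous_curveSpeed, IsW12.const_mul ⟨?_, ?_, ?_⟩ _,
    fun x hx => ?_, fun x hx => ?_, ?_⟩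
  · exact absolutelyContinuous_congr (hV.ac.comp_lipschitzOnWith (s := univ)
      (lipschitzWith_one_norm.lipschitzOnWith) (mapsTo_univ _ _))
      fun x hx => curveSpeed_eq γ hx
  · refine hV.memLp.of_le ?_ (ae_restrict_Icc_of_Ioo (Eventually.of_forall fun x hx => ?_))
    · have hvm : ∀ i, AEStronglyMeasurable (fun x => vel γ x i) (volume.restrict (Icc 0 1)) :=
        fun i => (hV.apply i).continuousOn.aestronglyMeasurable measurableSet_Icc
      have ham : ∀ i, AEStronglyMeasurable (fun x => acc γ x i) (volume.restrict (Icc 0 1)) :=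
        fun i => (hV.apply i).memLp.aestronglyMeasurable
      have hnm : AEStronglyMeasurable (fun x => ‖vel γ x‖⁻¹) (volume.restrict (Icc 0 1)) :=
        (hVc.norm.inv₀ fun x hx => (norm_pos_iff.2 (h.2 x hx)).ne').aestronglyMeasurable
          measurableSet_Icc
      exact (((hvm 0).mul (ham 0)).add ((hvm 1).mul (ham 1))).mul hnm
    · have hn : 0 < ‖vel γ x‖ := norm_pos_iff.2 (h.2 x (Ioo_subset_Icc_self hx))
      rw [Real.norm_eq_abs, abs_div, abs_of_pos hn, div_le_iff₀ hn]
      refine abs_le_of_sq_le_sq ?_ (by positivity)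
      rw [mul_pow, norm_sq_plane, norm_sq_plane]
      nlinarith [sq_nonneg (vel γ x 0 * acc γ x 1 - vel γ x 1 * acc γ x 0)]
  · filter_upwards [hV.ae_deriv] with x hx hxm
    refine (hasDerivAt_norm_plane (h.2 x (Ioo_subset_Icc_self hxm))
      (hx hxm)).congr_of_eventuallyEq ?_
    filter_upwards [Icc_mem_nhds hxm.1 hxm.2] with y hy
    exact curveSpeed_eq γ hy
  · rw [curveSpeed_eq γ hx]
    exact mul_pos (by positivity) (norm_pos_iff.2 (h.2 x hx))
  · rw [curveSpeed_eq γ hx, curveSpeed_eq γ ⟨by linarith [hx.2], by linarith [hx.1]⟩,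
      norm_vel_symm h.1 hs hx]
  · rw [intervalIntegral.integral_const_mul, ← arclength_eq γ ⟨zero_le_one, le_rfl⟩]
    change 2 / curveLength γ * curveLength γ = 2
    field_simp

/-- The tangent of a symmetric cut-and-glued elastica is that of a pendulum curve. -/
lemma IsSCF.exists_tangent_eq {ψ : ℝ → ℝ} {γ : ℝ → Plane} (h : IsSCF ψ γ) :
    ∃ c θ₀ : ℝ, 0 < c ∧
      (∀ x ∈ Icc (0 : ℝ) (1 / 2),
        vel γ x = curveSpeed γ x • dir (θ₀ - pendulumAngle (c * arclength γ x))) ∧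
      ∀ s ∈ Ioo 0 (curveLength γ / 2), 0 < pendulumRate (c * s) := by
  have himm : IsW22Imm γ := h.mem_sym.1.1
  have hs := h.mem_sym.2
  have hL := himm.curveLength_pos
  have hsc := himm.1.continuous_curveSpeed
  have hsub : Icc (0 : ℝ) (1 / 2) ⊆ Icc 0 1 := Icc_subset_Icc_right (by norm_num)
  set s : ℝ → ℝ := fun x => ∫ t in (0 : ℝ)..x, curveSpeed γ t with hsdef
  have hsd : ∀ x, HasDerivAt s (curveSpeed γ x) x := fun x =>
    intervalIntegral.integral_hasDerivAt_right (hsc.intervalIntegrable _ _)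
      (hsc.stronglyMeasurableAtFilter _ _) hsc.continuousAt
  have hsa : ∀ x ∈ Icc (0 : ℝ) 1, s x = arclength γ x := fun x hx => (arclength_eq γ hx).symm
  have hhalf : s (1 / 2) = curveLength γ / 2 := by
    have h1 := (himm.isWeight_curveSpeed hs).primitive_half
    rw [weightPrimitive, intervalIntegral.integral_const_mul] at h1
    change 2 / curveLength γ * s (1 / 2) = 1 at h1
    field_simp at h1
    linarith
  have hs0 : s 0 = 0 := intervalIntegral.integral_same
  have hsmem : ∀ x ∈ Ioo (0 : ℝ) (1 / 2), s x ∈ Ioo 0 (curveLength γ / 2) := by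
    intro x hx
    have hx1 : x ∈ Icc (0 : ℝ) 1 := hsub (Ioo_subset_Icc_self hx)
    have e1 := himm.strictMonoOn_arclength ⟨le_rfl, zero_le_one⟩ hx1 hx.1
    have e2 := himm.strictMonoOn_arclength hx1 (by norm_num : (1 / 2 : ℝ) ∈ Icc (0 : ℝ) 1) hx.2
    rw [← hsa _ hx1, arclength_zero] at e1
    rw [← hsa _ hx1, ← hsa _ (by norm_num), hhalf] at e2
    exact ⟨e1, e2⟩
  have hTunit : ∀ x ∈ Icc (0 : ℝ) 1, ‖unitTangent γ x‖ = 1 := fun x hx => by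
    rw [unitTangent, norm_smul, norm_inv, norm_norm,
      inv_mul_cancel₀ (norm_pos_iff.2 (himm.2 x hx)).ne']
  have hTc : ContinuousOn (unitTangent γ) (Icc 0 1) :=
    (himm.1.continuousOn_vel.norm.inv₀ fun x hx => (norm_pos_iff.2 (himm.2 x hx)).ne').smul
      himm.1.continuousOn_vel
  have hkx : ∀ x ∈ Icc (0 : ℝ) 1, signedCurvature γ (s x)
      = ‖vel γ x‖⁻¹ * (-(derivWithin (unitTangent γ) (Icc 0 1) x 0) * unitTangent γ x 1
        + derivWithin (unitTangent γ) (Icc 0 1) x 1 * unitTangent γ x 0) := by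
    intro x hx
    rw [signedCurvature, hsa x hx, himm.paramOfArclength_arclength hx, curvatureVec,
      inner_smul_left, PiLp.inner_apply, Fin.sum_univ_two]
    have hr : ∀ D : Plane, (starRingEnd ℝ) ‖vel γ x‖⁻¹
        * (inner ℝ (D 0) (unitNormal γ x 0) + inner ℝ (D 1) (unitNormal γ x 1))
        = ‖vel γ x‖⁻¹ * (-(D 0) * unitTangent γ x 1 + D 1 * unitTangent γ x 0) := fun D => by
      simp only [unitNormal, conj_trivial, RCLike.inner_apply, Matrix.cons_val_zero,
        Matrix.cons_val_one]
      ring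
    exact hr _
  have hdk : ∀ x ∈ Ioo (0 : ℝ) (1 / 2), HasDerivAt (signedCurvature γ)
      (deriv (signedCurvature γ) (s x)) (s x) := fun x hx =>
    ((h.contDiffOn.differentiableOn (by norm_num)).differentiableAt
      (isOpen_Ioo.mem_nhds (hsmem x hx))).hasDerivAt
  have hdk1 : ∀ x ∈ Ioo (0 : ℝ) (1 / 2), HasDerivAt (deriv (signedCurvature γ))
      (-(signedCurvature γ (s x) ^ 3 / 2)) (s x) := by
    intro x hx
    have h1 : DifferentiableOn ℝ (deriv (signedCurvature γ)) (Ioo 0 (curveLength γ / 2)) :=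
      (h.contDiffOn.deriv_of_isOpen (m := 1) isOpen_Ioo (by norm_num)).differentiableOn
        (by norm_num)
    refine (h1.differentiableAt (isOpen_Ioo.mem_nhds (hsmem x hx))).hasDerivAt.congr_deriv ?_
    linarith [h.elastica _ (hsmem x hx)]
  obtain ⟨c, θ₀, hc, hT, hk⟩ := elastica_eq_pendulum (w := curveSpeed γ)
    (k := fun x => signedCurvature γ (s x)) (k₁ := fun x => deriv (signedCurvature γ) (s x))
    (T := unitTangent γ) (l := 1 / 2) (by norm_num) hsc
    (fun x hx => by
      rw [curveSpeed_eq γ (hsub hx)]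
      exact norm_pos_iff.2 (himm.2 x (hsub hx)))
    (hTc.mono hsub) (fun x hx => hTunit x (hsub hx))
    (fun x hx => by
      have hx1 : x ∈ Icc (0 : ℝ) 1 := hsub (Ioo_subset_Icc_self hx)
      have hn := norm_pos_iff.2 (himm.2 x hx1)
      have hneg := h.curvature_neg _ (hsmem x hx)
      have hI : Icc (0 : ℝ) 1 ∈ 𝓝 x := Icc_mem_nhds hx.1 (hx.2.trans (by norm_num))
      -- a nonzero curvature forces the tangent to be differentiable
      have hd : HasDerivAt (unitTangent γ) (derivWithin (unitTangent γ) (Icc 0 1) x) x := by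
        refine (DifferentiableWithinAt.hasDerivWithinAt ?_).hasDerivAt hI
        by_contra hnd
        rw [hkx x hx1, derivWithin_zero_of_not_differentiableWithinAt hnd] at hneg
        simp at hneg
      have hunit : unitTangent γ x 0 ^ 2 + unitTangent γ x 1 ^ 2 = 1 := by
        rw [← norm_sq_plane, hTunit x hx1, one_pow]
      set D := derivWithin (unitTangent γ) (Icc 0 1) x with hD
      have horth : unitTangent γ x 0 * D 0 + unitTangent γ x 1 * D 1 = 0 := by
        have h1 := hasDerivAt_plane.1 hd
        have h2 := ((h1 0).pow 2).add ((h1 1).pow 2)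
        have h3 : HasDerivAt (fun y => unitTangent γ y 0 ^ 2 + unitTangent γ y 1 ^ 2) 0 x := by
          refine (hasDerivAt_const x (1 : ℝ)).congr_of_eventuallyEq ?_
          filter_upwards [hI] with y hy
          rw [← norm_sq_plane, hTunit y hy, one_pow]
        have h4 := h2.unique h3
        simp at h4
        linarith
      refine hd.congr_deriv ?_
      rw [hkx x hx1, curveSpeed_eq γ hx1, ← mul_assoc, mul_inv_cancel₀ hn.ne', one_mul]
      refine plane_eq ?_ ?_
      · simp
        linear_combination (-D 0) * hunit + unitTangent γ x 0 * horth
      · simp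
        linear_combination (-D 1) * hunit + unitTangent γ x 1 * horth)
    (fun x hx => ((hdk x hx).comp x (hsd x)).congr_deriv (by ring))
    (fun x hx => ((hdk1 x hx).comp x (hsd x)).congr_deriv (by ring))
    (fun x hx => h.curvature_neg _ (hsmem x hx))
    (fun κ hκ => by
      have h0 : (0 : ℝ) ∈ Icc (0 : ℝ) 1 := ⟨le_rfl, zero_le_one⟩
      have hn := norm_pos_iff.2 (himm.2 0 h0)
      have h1 := (hκ.mono (Icc_subset_Ici_self : Icc (0 : ℝ) 1 ⊆ Ici 0)).derivWithin
        (uniqueDiffOn_Icc zero_lt_one 0 h0)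
      have h2 := hkx 0 h0
      have hunit : unitTangent γ 0 0 ^ 2 + unitTangent γ 0 1 ^ 2 = 1 := by
        rw [← norm_sq_plane, hTunit 0 h0, one_pow]
      rw [hs0, h.curvature_zero, h1, curveSpeed_eq γ h0] at h2
      simp at h2
      rcases h2 with h2 | h2
      · exact absurd h2 (himm.2 0 h0)
      · have h3 : ‖vel γ 0‖ * κ = 0 := by
          linear_combination h2 - ‖vel γ 0‖ * κ * hunit
        exact (mul_eq_zero.1 h3).resolve_left hn.ne')
  refine ⟨c, θ₀, hc, fun x hx => ?_, fun t ht => ?_⟩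
  · have hn := norm_pos_iff.2 (himm.2 x (hsub hx))
    rw [← hsa x (hsub hx), ← hT x hx, curveSpeed_eq γ (hsub hx), unitTangent, smul_smul,
      mul_inv_cancel₀ hn.ne', one_smul]
  · have hcont : ContinuousOn s (Icc 0 (1 / 2)) := fun x _ => (hsd x).continuousAt.continuousWithinAt
    have h1 := intermediate_value_Ioo (by norm_num : (0 : ℝ) ≤ 1 / 2) hcont
    rw [hs0, hhalf] at h1
    obtain ⟨x, hx, rfl⟩ := h1 ht
    have h2 := h.curvature_neg _ (hsmem x hx)
    have h3 : signedCurvature γ (s x) = -(c * pendulumRate (c * s x)) := hk x hx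
    rw [h3] at h2
    by_contra hle
    nlinarith [not_lt.1 hle]

/-- A symmetric cut-and-glued elastica is, up to its parametrization, the curve `elasticaCurve`
whose tip is the tip of the cone. -/
lemma IsSCF.exists_eq_elasticaCurve {ψ : ℝ → ℝ} (hψ : IsObstacle ψ) (hcone : IsSymmetricCone ψ)
    {γ : ℝ → Plane} (h : IsSCF ψ γ) :
    ∃ (σ : ℝ) (W W' : ℝ → ℝ), IsTipSwing σ ∧ IsWeight W W' ∧
      tipHeight (pendulumAngle σ) = 2 * ψ (1 / 2) * tipWidth (pendulumAngle σ) ∧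
      (∀ x ∈ Icc (0 : ℝ) 1, vel γ x = elasticaVel σ W x) ∧
      ∀ x ∈ Icc (0 : ℝ) 1, γ x = elasticaCurve σ W x := by
  have himm : IsW22Imm γ := h.mem_sym.1.1
  have hs := h.mem_sym.2
  have hL := himm.curveLength_pos
  have hsub : Icc (0 : ℝ) (1 / 2) ⊆ Icc 0 1 := Icc_subset_Icc_right (by norm_num)
  have hhalfmem : (1 / 2 : ℝ) ∈ Icc (0 : ℝ) (1 / 2) := by norm_num
  have hW := himm.isWeight_curveSpeed hs
  have hh := cone_tip_pos hψ hcone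
  obtain ⟨c, θ₀, hc, hv, hpos⟩ := h.exists_tangent_eq
  have hprim : ∀ x ∈ Icc (0 : ℝ) 1,
      weightPrimitive (fun x => 2 / curveLength γ * curveSpeed γ x) x
        = 2 / curveLength γ * arclength γ x := fun x hx => by
    rw [weightPrimitive, intervalIntegral.integral_const_mul, arclength_eq γ hx]
  have hhalf : arclength γ (1 / 2) = curveLength γ / 2 := by
    have h1 := hprim (1 / 2) (hsub hhalfmem)
    rw [hW.primitive_half] at h1
    field_simp at h1
    linarith
  set W := fun x => 2 / curveLength γ * curveSpeed γ x with hWdef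
  set σ := c * curveLength γ / 2 with hσdef
  have hσs : ∀ x ∈ Icc (0 : ℝ) 1, c * arclength γ x = σ * weightPrimitive W x := fun x hx => by
    rw [hprim x hx, hσdef]; field_simp
  have hswing : IsSwing σ := by
    refine ⟨by positivity, fun t ht => ?_⟩
    have h1 := hpos (t / c) ⟨div_pos ht.1 hc, by
      rw [div_lt_iff₀ hc]; have := ht.2; rw [hσdef] at this; linarith⟩
    rwa [mul_div_cancel₀ _ hc.ne'] at h1
  set Φ := pendulumAngle σ with hΦ
  have hsin : Real.sin (θ₀ - Φ) = 0 := by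
    have h1 := vel_half_one himm.1 hs
    rw [hv _ hhalfmem, hσs _ (hsub hhalfmem), hW.primitive_half, mul_one] at h1
    have h2 : 0 < curveSpeed γ (1 / 2) := by
      rw [curveSpeed_eq γ (hsub hhalfmem)]
      exact norm_pos_iff.2 (himm.2 _ (hsub hhalfmem))
    rw [PiLp.smul_apply, dir_one, smul_eq_mul] at h1
    exact (mul_eq_zero.1 h1).resolve_left h2.ne'
  set e := Real.cos (θ₀ - Φ) with he
  have he2 : e ^ 2 = 1 := by
    have := Real.sin_sq_add_cos_sq (θ₀ - Φ)
    rw [hsin] at this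
    rw [he]; linarith
  have hcosθ : Real.cos θ₀ = e * Real.cos Φ := by
    have := Real.cos_add (θ₀ - Φ) Φ
    rwa [sub_add_cancel, hsin, zero_mul, sub_zero] at this
  have hsinθ : Real.sin θ₀ = e * Real.sin Φ := by
    have := Real.sin_add (θ₀ - Φ) Φ
    rwa [sub_add_cancel, hsin, zero_mul, zero_add] at this
  have hγ0 : γ 0 = 0 := by
    rw [h.mem_sym.1.2.1]; exact plane_eq (by simp) (by simp)
  have h01 : (0 : ℝ) ∈ Icc (0 : ℝ) 1 := ⟨le_rfl, zero_le_one⟩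
  have htip : γ (1 / 2) = (1 / c) • elasticaPos θ₀ σ := by
    have h1 : ∫ x in (0 : ℝ)..(1 / 2), vel γ x = γ (1 / 2) - γ 0 :=
      himm.1.eq_integral_vel h01 (hsub hhalfmem) (by norm_num)
    have hd : ∀ x ∈ uIcc (0 : ℝ) (1 / 2), HasDerivAt
        (fun x => (1 / c) • elasticaPos θ₀ (σ * weightPrimitive W x))
        (curveSpeed γ x • dir (θ₀ - pendulumAngle (σ * weightPrimitive W x))) x := by
      intro x hx
      rw [uIcc_of_le (by norm_num)] at hx
      have hX := hW.primitive_mem_half hx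
      have h1 := (hswing.hasDerivAt_elasticaPos θ₀
        (τ := σ * weightPrimitive W x) ⟨mul_nonneg hswing.1.le hX.1, by
          nlinarith [hX.2, hswing.1]⟩).scomp x
        ((hasDerivAt_weightPrimitive hW.continuous x).const_mul σ)
      refine (h1.const_smul (1 / c)).congr_deriv ?_
      rw [smul_smul, hσdef, hWdef]
      congr 1; field_simp
    have h2 : ∫ x in (0 : ℝ)..(1 / 2), vel γ x = ∫ x in (0 : ℝ)..(1 / 2),
        curveSpeed γ x • dir (θ₀ - pendulumAngle (σ * weightPrimitive W x)) := by
      refine intervalIntegral.integral_congr fun x hx => ?_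
      rw [uIcc_of_le (by norm_num)] at hx
      beta_reduce
      rw [hv x hx, hσs x (hsub hx)]
    have hcont : Continuous fun x =>
        curveSpeed γ x • dir (θ₀ - pendulumAngle (σ * weightPrimitive W x)) :=
      himm.1.continuous_curveSpeed.smul (continuous_dir.comp (continuous_const.sub
        (continuous_pendulumAngle.comp
          (continuous_const.mul (continuous_weightPrimitive hW.continuous)))))
    rw [intervalIntegral.integral_eq_sub_of_hasDerivAt hd (hcont.intervalIntegrable _ _),
      hW.primitive_half, weightPrimitive_zero, mul_zero, mul_one, elasticaPos_zero, smul_zero,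
      sub_zero] at h2
    rw [← h2, h1, hγ0, sub_zero]
  have hpose : elasticaPos θ₀ σ = e • (!₂[tipWidth Φ, tipHeight Φ] : Plane) := by
    rw [← hswing.elasticaPos_tip]
    unfold elasticaPos
    rw [hcosθ, hsinθ]
    refine plane_eq ?_ ?_ <;> simp <;> ring
  have htip' : (1 / c * e) * tipWidth Φ = 1 / 2 ∧ (1 / c * e) * tipHeight Φ = ψ (1 / 2) := by
    have h1 := h.tip
    rw [← hhalf, arclengthParam, himm.paramOfArclength_arclength (hsub hhalfmem), htip, hpose,
      smul_smul] at h1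
    have e0 := congrArg (fun v : Plane => v 0) h1
    have e1 := congrArg (fun v : Plane => v 1) h1
    simp only [PiLp.smul_apply, smul_eq_mul, Matrix.cons_val_zero, Matrix.cons_val_one] at e0 e1
    exact ⟨e0, e1⟩
  have hf : 0 < tipHeight Φ := tipHeight_pos hswing.angle_pos hswing.angle_le_pi
  have he1 : e = 1 := by
    rcases (sq_eq_sq_iff_eq_or_eq_neg (b := (1 : ℝ))).1 (by rw [he2, one_pow]) with h1 | h1
    · exact h1
    · exfalso
      have h2 := htip'.2
      rw [h1] at h2
      have : 0 < 1 / c * tipHeight Φ := by positivity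
      linarith
  rw [he1, mul_one] at htip'
  have hg : tipWidth Φ = c / 2 := by
    have := htip'.1
    field_simp at this
    linarith
  have hg0 : 0 < tipWidth Φ := by rw [hg]; positivity
  have hσ : IsTipSwing σ := by
    refine ⟨hswing, lt_of_le_of_ne hswing.angle_le_pi fun h1 => ?_, hg0⟩
    rw [← hΦ] at h1
    rw [h1] at hg0
    simp [tipWidth] at hg0
  have hvel : ∀ x ∈ Icc (0 : ℝ) (1 / 2), vel γ x = elasticaVel σ W x := by
    intro x hx
    have hX := hW.primitive_mem_half hx
    have hdir : ∀ t, dir (θ₀ - t) = dir (Φ - t) := fun t => by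
      refine plane_eq ?_ ?_
      · simp only [dir_zero, Real.cos_sub, hcosθ, hsinθ, he1, one_mul]
      · simp only [dir_one, Real.sin_sub, hcosθ, hsinθ, he1, one_mul]
    rw [hv x hx, hσs x (hsub hx), elasticaVel, polarVel, elasticaAngle_eq hX.1 hX.2, hdir,
      elasticaScale, ← hΦ, hg]
    congr 1
    rw [hσdef, hWdef]; field_simp
  have hvel' : ∀ x ∈ Icc (0 : ℝ) 1, vel γ x = elasticaVel σ W x := by
    intro x hx
    rcases le_total x (1 / 2) with h1 | h1
    · exact hvel x ⟨hx.1, h1⟩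
    · have hx' : 1 - x ∈ Icc (0 : ℝ) (1 / 2) := ⟨by linarith [hx.2], by linarith⟩
      have h2 := vel_symm himm.1 hs (hsub hx')
      have h3 := elasticaVel_symm (σ := σ) hW (hsub hx')
      rw [sub_sub_cancel] at h2 h3
      rw [h2, h3, hvel _ hx']
  refine ⟨σ, W, _, hσ, hW, ?_, hvel', fun x hx => ?_⟩
  · have := htip'.2
    rw [← hΦ, hg]
    field_simp at this
    linarith
  · have h1 := himm.1.eq_integral_vel h01 hx hx.1
    rw [hγ0, sub_zero] at h1
    rw [← h1]
    refine intervalIntegral.integral_congr fun t ht => ?_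
    rw [uIcc_of_le hx.1] at ht
    exact hvel' t ⟨ht.1, ht.2.trans hx.2⟩

/-! ### Calibration: a lower bound for the energy of symmetric graphs -/

lemma abs_wedge_le (v a : Plane) : |v 0 * a 1 - v 1 * a 0| ≤ ‖v‖ * ‖a‖ := by
  refine abs_le_of_sq_le_sq ?_ (by positivity)
  rw [mul_pow, norm_sq_plane, norm_sq_plane]
  nlinarith [sq_nonneg (v 0 * a 0 + v 1 * a 1)]

/-- The density of the bending energy in coordinates, in terms of the velocity and the
acceleration. -/
def energyDensity (γ : ℝ → Plane) (x : ℝ) : ℝ :=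
  (vel γ x 0 * acc γ x 1 - vel γ x 1 * acc γ x 0) ^ 2 / ‖vel γ x‖ ^ 5

lemma IsW22Imm.integrableOn_energyDensity {γ : ℝ → Plane} (h : IsW22Imm γ) :
    IntegrableOn (energyDensity γ) (Icc 0 1) := by
  have hV := h.1.isW12_vel
  have hVc := h.1.continuousOn_vel
  have hvm : ∀ i, AEStronglyMeasurable (fun x => vel γ x i) (volume.restrict (Icc 0 1)) :=
    fun i => (hV.apply i).continuousOn.aestronglyMeasurable measurableSet_Icc
  have ham : ∀ i, AEStronglyMeasurable (fun x => acc γ x i) (volume.restrict (Icc 0 1)) :=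
    fun i => (hV.apply i).memLp.aestronglyMeasurable
  obtain ⟨M, hM⟩ := isCompact_Icc.exists_bound_of_continuousOn hVc
  have hω : MemLp (fun x => vel γ x 0 * acc γ x 1 - vel γ x 1 * acc γ x 0) 2
      (volume.restrict (Icc 0 1)) := by
    refine hV.memLp.of_le_mul (c := M) (((hvm 0).mul (ham 1)).sub ((hvm 1).mul (ham 0)))
      (ae_restrict_Icc_of_Ioo (Eventually.of_forall fun x hx => ?_))
    rw [Real.norm_eq_abs]
    exact (abs_wedge_le _ _).trans
      (mul_le_mul_of_nonneg_right (hM x (Ioo_subset_Icc_self hx)) (norm_nonneg _))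
  have hn : ContinuousOn (fun x => (‖vel γ x‖ ^ 5)⁻¹) (Icc 0 1) :=
    (hVc.norm.pow 5).inv₀ fun x hx => (pow_pos (norm_pos_iff.2 (h.2 x hx)) 5).ne'
  exact IntegrableOn.mul_continuousOn (K := Icc 0 1) hω.integrable_sq hn isCompact_Icc

lemma IsW22Imm.curvature_ae_eq {γ : ℝ → Plane} (h : IsW22Imm γ) :
    ∀ᵐ x, x ∈ Ioo (0 : ℝ) 1 → ‖curvatureVec γ x‖ ^ 2 * ‖vel γ x‖ = energyDensity γ x := by
  filter_upwards [h.1.isW12_vel.ae_deriv] with x hx hxm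
  exact energyDensity_eq hxm (h.2 x (Ioo_subset_Icc_self hxm)) (hx hxm)

/-- By symmetry, both halves of a symmetric curve carry the same energy. -/
lemma bendingEnergy_symm {γ : ℝ → Plane} (h : IsW22Imm γ)
    (hs : ∀ x ∈ Icc (0 : ℝ) 1, γ (1 - x) = !₂[1 - γ x 0, γ x 1]) :
    bendingEnergy γ = 2 * ∫ x in (0 : ℝ)..(1 / 2), energyDensity γ x := by
  have hV := h.1.isW12_vel
  set D : ℝ → ℝ := fun x => ‖curvatureVec γ x‖ ^ 2 * ‖vel γ x‖ with hD
  have hI : ∀ a ∈ Icc (0 : ℝ) 1, ∀ b ∈ Icc (0 : ℝ) 1, IntervalIntegrable D volume a b :=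
    fun a ha b hb => intervalIntegrable_of_integrableOn_Icc
      (h.integrableOn_energyDensity.congr
        ((ae_restrict_Icc_of_Ioo h.curvature_ae_eq).mono fun x hx => hx.symm)) ha hb
  have hsymm : ∀ᵐ x, x ∈ Ioo (0 : ℝ) (1 / 2) → D (1 - x) = energyDensity γ x := by
    filter_upwards [hV.ae_deriv] with x hx hxm'
    have hxm : x ∈ Ioo (0 : ℝ) 1 := ⟨hxm'.1, hxm'.2.trans (by norm_num)⟩
    have hxI := Ioo_subset_Icc_self hxm
    have hx1 : 1 - x ∈ Ioo (0 : ℝ) 1 := ⟨by linarith [hxm.2], by linarith [hxm.1]⟩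
    have ha := hasDerivAt_plane.1 (hx hxm)
    have hd : HasDerivAt (vel γ) !₂[-acc γ x 0, acc γ x 1] (1 - x) := by
      have h1 : HasDerivAt (fun y => (!₂[vel γ (1 - y) 0, -vel γ (1 - y) 1] : Plane))
          !₂[-acc γ x 0, acc γ x 1] (1 - x) := by
        have h2 : ∀ i, HasDerivAt (fun y => vel γ (1 - y) i) (-acc γ x i) (1 - x) := fun i => by
          have h3 : HasDerivAt (fun y => vel γ y i) (acc γ x i) (1 - (1 - x)) := by
            rw [sub_sub_cancel]; exact ha i
          exact (h3.comp (1 - x) ((hasDerivAt_id (1 - x)).const_sub 1)).congr_deriv (by simp)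
        rw [hasDerivAt_plane]
        intro i; fin_cases i
        · exact h2 0
        · exact (h2 1).neg.congr_deriv (by simp)
      refine h1.congr_of_eventuallyEq ?_
      filter_upwards [Icc_mem_nhds hx1.1 hx1.2] with y hy
      have := vel_symm h.1 hs (x := 1 - y) ⟨by linarith [hy.2], by linarith [hy.1]⟩
      rwa [sub_sub_cancel] at this
    simp only [hD, energyDensity]
    rw [energyDensity_eq hx1 (h.2 _ (Ioo_subset_Icc_self hx1)) hd, norm_vel_symm h.1 hs hxI,
      vel_symm h.1 hs hxI]
    simp
  have h2 : ∫ x in (1 / 2 : ℝ)..1, D x = ∫ x in (0 : ℝ)..(1 / 2), D (1 - x) := by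
    rw [intervalIntegral.integral_comp_sub_left (a := 0) (b := 1 / 2) D 1]; norm_num
  have h3 : ∫ x in (0 : ℝ)..(1 / 2), D x = ∫ x in (0 : ℝ)..(1 / 2), energyDensity γ x := by
    refine integral_congr_of_Ioo (by norm_num) ?_
    filter_upwards [h.curvature_ae_eq] with x hx hxm
    exact hx ⟨hxm.1, hxm.2.trans (by norm_num)⟩
  rw [bendingEnergy, ← intervalIntegral.integral_add_adjacent_intervals
    (hI 0 (by norm_num) (1 / 2) (by norm_num)) (hI (1 / 2) (by norm_num) 1 (by norm_num)), h2, h3,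
    integral_congr_of_Ioo (by norm_num) hsymm]
  ring

lemma hasDerivAt_arctan_slope {V : ℝ → Plane} {a : Plane} {x : ℝ} (h0 : 0 < V x 0)
    (ha : HasDerivAt V a x) :
    HasDerivAt (fun x => Real.arctan (V x 1 / V x 0))
      ((V x 0 * a 1 - V x 1 * a 0) / ‖V x‖ ^ 2) x := by
  have ha' := hasDerivAt_plane.1 ha
  refine ((ha' 1).div (ha' 0) h0.ne').arctan.congr_deriv ?_
  rw [norm_sq_plane]
  simp only [Pi.div_apply]
  field_simp

lemma lipschitzWith_arctan : LipschitzWith 1 Real.arctan := by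
  refine lipschitzWith_of_nnnorm_deriv_le Real.differentiable_arctan fun x => ?_
  rw [← NNReal.coe_le_coe, coe_nnnorm, Real.deriv_arctan, Real.norm_eq_abs,
    abs_of_pos (by positivity), NNReal.coe_one, div_le_one (by positivity)]
  nlinarith [sq_nonneg x]

lemma lipschitzWith_rootSineIntegral : LipschitzWith 1 rootSineIntegral := by
  refine lipschitzWith_of_nnnorm_deriv_le
    (fun x => (hasDerivAt_rootSineIntegral x).differentiableAt) fun x => ?_
  rw [(hasDerivAt_rootSineIntegral x).deriv, ← NNReal.coe_le_coe, coe_nnnorm, Real.norm_eq_abs,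
    abs_of_nonneg (Real.sqrt_nonneg _), NNReal.coe_one, Real.sqrt_le_one]
  exact Real.sin_le_one x

/-- The tangent angle of a graph of class `W^{2,2}` is absolutely continuous. -/
lemma absolutelyContinuous_arctan_slope {V G : ℝ → Plane} (h : IsW12 V G)
    (h0 : ∀ x ∈ Icc (0 : ℝ) 1, 0 < V x 0) :
    AbsolutelyContinuousOnInterval (fun x => Real.arctan (V x 1 / V x 0)) 0 1 := by
  obtain ⟨x₀, hx₀, hmin⟩ := isCompact_Icc.exists_isMinOn (nonempty_Icc.2 zero_le_one)
    (h.apply 0).continuousOn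
  set m := V x₀ 0 with hm
  have hm0 : 0 < m := h0 x₀ hx₀
  have hinv : LipschitzOnWith ⟨(m ^ 2)⁻¹, by positivity⟩ (fun y : ℝ => y⁻¹) (Ici m) := by
    refine LipschitzOnWith.of_dist_le_mul fun y hy z hz => ?_
    have hy0 : 0 < y := hm0.trans_le hy
    have hz0 : 0 < z := hm0.trans_le hz
    have hyz : m ^ 2 ≤ y * z := by
      rw [sq]; exact mul_le_mul hy hz hm0.le hy0.le
    rw [Real.dist_eq, Real.dist_eq, inv_sub_inv hy0.ne' hz0.ne', abs_div, abs_sub_comm z y,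
      abs_of_pos (mul_pos hy0 hz0), div_eq_inv_mul]
    exact mul_le_mul_of_nonneg_right (inv_anti₀ (by positivity) hyz) (abs_nonneg _)
  have h1 := (h.apply 0).ac.comp_lipschitzOnWith hinv fun x hx => by
    rw [uIcc_of_le zero_le_one] at hx
    exact hmin hx
  have h2 := (h.apply 1).ac.fun_mul h1
  exact h2.comp_lipschitzOnWith (F := Real.arctan) (s := univ)
    lipschitzWith_arctan.lipschitzOnWith (mapsTo_univ _ _)

lemma eq_norm_smul_dir_arctan {v : Plane} (h0 : 0 < v 0) :
    v = ‖v‖ • dir (Real.arctan (v 1 / v 0)) := by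
  have hs : √(1 + (v 1 / v 0) ^ 2) = ‖v‖ / v 0 := by
    rw [← Real.sqrt_sq (div_nonneg (norm_nonneg v) h0.le), div_pow, div_pow, norm_sq_plane]
    congr 1; field_simp
  have hn : 0 < ‖v‖ := norm_pos_iff.2 fun h => by rw [h] at h0; simp at h0
  refine plane_eq ?_ ?_
  · rw [PiLp.smul_apply, dir_zero, Real.cos_arctan, hs, smul_eq_mul]; field_simp
  · rw [PiLp.smul_apply, dir_one, Real.sin_arctan, hs, smul_eq_mul]; field_simp

/-- Let `Θ` be the largest tangent angle of the left half of a symmetric graph. Integrating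
`θ'² / |γ'| + λ² |γ'| sin (Θ - θ) ≥ - 2 λ √(sin (Θ - θ)) θ'` bounds the energy from below. -/
lemma exists_calibration {γ : ℝ → Plane} {h : ℝ} (hγ : IsW22Imm γ)
    (hs : ∀ x ∈ Icc (0 : ℝ) 1, γ (1 - x) = !₂[1 - γ x 0, γ x 1]) (hγ0 : γ 0 = 0) (hh : 0 < h)
    (hy : h ≤ γ (1 / 2) 1) (hgraph : ∀ x ∈ Icc (0 : ℝ) (1 / 2), 0 < vel γ x 0) :
    ∃ Θ ∈ Ioo 0 (Real.pi / 2), ∀ l, 0 ≤ l →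
      2 * l * rootSineIntegral Θ - l ^ 2 * (1 / 2 * Real.sin Θ - h * Real.cos Θ)
        ≤ ∫ x in (0 : ℝ)..(1 / 2), energyDensity γ x := by
  have hV := hγ.1.isW12_vel
  have hVc := hγ.1.continuousOn_vel
  have hsub : Icc (0 : ℝ) (1 / 2) ⊆ Icc 0 1 := Icc_subset_Icc_right (by norm_num)
  have hhalf : (1 / 2 : ℝ) ∈ Icc (0 : ℝ) (1 / 2) := by norm_num
  have h01 : (0 : ℝ) ∈ Icc (0 : ℝ) 1 := ⟨le_rfl, zero_le_one⟩
  have hpos : ∀ x ∈ Icc (0 : ℝ) 1, 0 < vel γ x 0 := by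
    intro x hx
    rcases le_total x (1 / 2) with h1 | h1
    · exact hgraph x ⟨hx.1, h1⟩
    · have hx' : 1 - x ∈ Icc (0 : ℝ) (1 / 2) := ⟨by linarith [hx.2], by linarith⟩
      have h2 := vel_symm hγ.1 hs (hsub hx')
      rw [sub_sub_cancel] at h2
      rw [h2]
      exact hgraph _ hx'
  set θ : ℝ → ℝ := fun x => Real.arctan (vel γ x 1 / vel γ x 0) with hθ
  have hθac : AbsolutelyContinuousOnInterval θ 0 1 := absolutelyContinuous_arctan_slope hV hpos
  have hθc : ContinuousOn θ (Icc 0 1) := by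
    have := hθac.continuousOn
    rwa [uIcc_of_le zero_le_one] at this
  obtain ⟨x₀, hx₀, hmax⟩ := isCompact_Icc.exists_isMaxOn (s := Icc (0 : ℝ) (1 / 2)) ⟨_, hhalf⟩
    (hθc.mono hsub)
  have hmax' : ∀ x ∈ Icc (0 : ℝ) (1 / 2), θ x ≤ θ x₀ := fun x hx => hmax hx
  set Θ := θ x₀ with hΘ
  have hγi : ∀ i, ∫ x in (0 : ℝ)..(1 / 2), vel γ x i = γ (1 / 2) i := fun i => by
    rw [← intervalIntegral_apply
      ((hVc.mono hsub).intervalIntegrable_of_Icc (by norm_num : (0 : ℝ) ≤ 1 / 2)),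
      hγ.1.eq_integral_vel h01 (hsub hhalf) (by norm_num), hγ0, sub_zero]
  have hci : ∀ i, IntervalIntegrable (fun x => vel γ x i) volume 0 (1 / 2) := fun i =>
    ((hV.apply i).continuousOn.mono hsub).intervalIntegrable_of_Icc (by norm_num)
  have hγ1 : γ (1 / 2) 0 = 1 / 2 := by
    have h1 := hs (1 / 2) (hsub hhalf)
    rw [show (1 : ℝ) - 1 / 2 = 1 / 2 by norm_num] at h1
    have h2 := congrArg (fun v : Plane => v 0) h1
    simp only [Matrix.cons_val_zero] at h2
    linarith
  have hΘ1 : Θ < Real.pi / 2 := Real.arctan_lt_pi_div_two _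
  have hΘ0 : 0 < Θ := by
    by_contra hle
    have h1 : ∫ x in (0 : ℝ)..(1 / 2), vel γ x 1 ≤ 0 := by
      rw [← neg_nonneg, ← intervalIntegral.integral_neg]
      refine intervalIntegral.integral_nonneg (by norm_num) fun x hx => ?_
      rw [neg_nonneg]
      by_contra hv
      have h2 : 0 < θ x := Real.arctan_pos.2 (div_pos (not_le.1 hv) (hgraph x hx))
      linarith [hmax' x hx, not_lt.1 hle]
    rw [hγi] at h1
    linarith
  have hθhalf : θ (1 / 2) = 0 := by
    simp only [hθ]
    rw [vel_half_one hγ.1 hs, zero_div, Real.arctan_zero]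
  refine ⟨Θ, ⟨hΘ0, hΘ1⟩, fun l hl => ?_⟩
  have hsin : ∀ x ∈ Icc (0 : ℝ) (1 / 2), 0 ≤ Real.sin (Θ - θ x) := fun x hx => by
    refine Real.sin_nonneg_of_nonneg_of_le_pi (sub_nonneg.2 (hmax' x hx)) ?_
    have : -(Real.pi / 2) < θ x := Real.neg_pi_div_two_lt_arctan _
    linarith
  have hrot : ∀ x ∈ Icc (0 : ℝ) (1 / 2), Real.sin Θ * vel γ x 0 - Real.cos Θ * vel γ x 1
      = ‖vel γ x‖ * Real.sin (Θ - θ x) := fun x hx => by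
    have h1 : vel γ x = ‖vel γ x‖ • dir (θ x) := eq_norm_smul_dir_arctan (hgraph x hx)
    have e0 := congrArg (fun v : Plane => v 0) h1
    have e1 := congrArg (fun v : Plane => v 1) h1
    simp only [PiLp.smul_apply, smul_eq_mul, dir_zero, dir_one] at e0 e1
    rw [Real.sin_sub]
    linear_combination Real.sin Θ * e0 - Real.cos Θ * e1
  -- the energy density together with the null Lagrangian
  set F : ℝ → ℝ := fun x => energyDensity γ x
    + l ^ 2 * (Real.sin Θ * vel γ x 0 - Real.cos Θ * vel γ x 1) with hF
  have hED : ∀ a ∈ Icc (0 : ℝ) 1, ∀ b ∈ Icc (0 : ℝ) 1,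
      IntervalIntegrable (energyDensity γ) volume a b := fun a ha b hb =>
    intervalIntegrable_of_integrableOn_Icc hγ.integrableOn_energyDensity ha hb
  have hFi : ∀ a ∈ Icc (0 : ℝ) 1, ∀ b ∈ Icc (0 : ℝ) 1, IntervalIntegrable F volume a b := by
    intro a ha b hb
    refine (hED a ha b hb).add (ContinuousOn.intervalIntegrable ?_)
    exact ((((hV.apply 0).continuousOn.const_mul _).sub
      ((hV.apply 1).continuousOn.const_mul _)).const_mul _).mono (uIcc_subset_Icc ha hb)
  have hgap : ∀ x, 0 ≤ energyDensity γ x := fun x => by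
    unfold energyDensity; positivity
  have hF0 : ∀ x ∈ Icc (0 : ℝ) (1 / 2), 0 ≤ F x := fun x hx => by
    simp only [hF]
    rw [hrot x hx]
    have := hgap x
    have := hsin x hx
    positivity
  set H : ℝ → ℝ := fun x => rootSineIntegral (Θ - θ x) with hH
  set H' : ℝ → ℝ := fun x => -(√(Real.sin (Θ - θ x))
    * ((vel γ x 0 * acc γ x 1 - vel γ x 1 * acc γ x 0) / ‖vel γ x‖ ^ 2)) with hH'
  have hHac : AbsolutelyContinuousOnInterval H 0 1 := by
    refine hθac.comp_lipschitzOnWith (F := fun t => rootSineIntegral (Θ - t)) (s := univ)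
      (K := 1 * 1) ?_ (mapsTo_univ _ _)
    refine (lipschitzWith_rootSineIntegral.comp (LipschitzWith.of_dist_le_mul
      fun a b => ?_)).lipschitzOnWith
    rw [dist_sub_left]; simp
  have hHd : ∀ᵐ x, x ∈ Ioo (0 : ℝ) 1 → HasDerivAt H (H' x) x := by
    filter_upwards [hV.ae_deriv] with x hx hxm
    have h1 := hasDerivAt_arctan_slope (hpos x (Ioo_subset_Icc_self hxm)) (hx hxm)
    refine ((hasDerivAt_rootSineIntegral (Θ - θ x)).comp x
      (h1.const_sub Θ)).congr_deriv ?_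
    simp only [hH']; ring
  have hHint : ∫ x in x₀..(1 / 2), H' x = rootSineIntegral Θ := by
    rw [integral_eq_sub_of_ac hHac hHd (hsub hx₀) (hsub hhalf) hx₀.2]
    simp only [hH]
    rw [hθhalf, sub_zero, ← hΘ, sub_self, rootSineIntegral_zero, sub_zero]
  have hHi : IntervalIntegrable H' volume x₀ (1 / 2) := by
    have hω : IntegrableOn (fun x => vel γ x 0 * acc γ x 1 - vel γ x 1 * acc γ x 0)
        (Icc 0 1) := by
      have h1 : ∀ i j, IntegrableOn (fun x => vel γ x i * acc γ x j) (Icc 0 1) := fun i j =>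
        IntegrableOn.continuousOn_mul (K := Icc 0 1) (hV.apply i).continuousOn
          ((hV.apply j).memLp.integrable one_le_two) isCompact_Icc
      exact (h1 0 1).sub (h1 1 0)
    have h2 : ContinuousOn (fun x => -(√(Real.sin (Θ - θ x)) / ‖vel γ x‖ ^ 2)) (Icc 0 1) := by
      refine (ContinuousOn.div ?_ (hVc.norm.pow 2) fun x hx =>
        (pow_pos (norm_pos_iff.2 (hγ.2 x hx)) 2).ne').neg
      exact continuous_sqrt_sin.comp_continuousOn (continuousOn_const.sub hθc)
    have h3 := IntegrableOn.continuousOn_mul (K := Icc 0 1) h2 hω isCompact_Icc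
    refine intervalIntegrable_of_integrableOn_Icc (h3.congr_fun (fun x _ => ?_)
      measurableSet_Icc) (hsub hx₀) (hsub hhalf)
    simp only [hH']; ring
  have hpt : ∀ x ∈ Icc (0 : ℝ) (1 / 2), 2 * l * H' x ≤ F x := fun x hx => by
    have hn : 0 < ‖vel γ x‖ := norm_pos_iff.2 (hγ.2 x (hsub hx))
    simp only [hF, hH', energyDensity]
    rw [hrot x hx]
    set ω := vel γ x 0 * acc γ x 1 - vel γ x 1 * acc γ x 0
    set n := ‖vel γ x‖
    set r := √(Real.sin (Θ - θ x)) with hr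
    have hr2 : Real.sin (Θ - θ x) = r ^ 2 := (Real.sq_sqrt (hsin x hx)).symm
    have h1 : ω ^ 2 / n ^ 5 + l ^ 2 * (n * Real.sin (Θ - θ x)) - 2 * l * -(r * (ω / n ^ 2))
        = n * (ω / n ^ 3 + l * r) ^ 2 := by
      rw [hr2]; field_simp; ring
    have h2 : 0 ≤ n * (ω / n ^ 3 + l * r) ^ 2 := by positivity
    linarith
  have hlow : 2 * l * rootSineIntegral Θ ≤ ∫ x in (0 : ℝ)..(1 / 2), F x := by
    rw [← intervalIntegral.integral_add_adjacent_intervals (hFi 0 h01 x₀ (hsub hx₀))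
      (hFi x₀ (hsub hx₀) (1 / 2) (hsub hhalf)), ← hHint, ← intervalIntegral.integral_const_mul]
    have h1 : 0 ≤ ∫ x in (0 : ℝ)..x₀, F x :=
      intervalIntegral.integral_nonneg hx₀.1 fun x hx => hF0 x ⟨hx.1, hx.2.trans hx₀.2⟩
    have h2 : ∫ x in x₀..(1 / 2), 2 * l * H' x ≤ ∫ x in x₀..(1 / 2), F x :=
      intervalIntegral.integral_mono_on hx₀.2 (hHi.const_mul _)
        (hFi x₀ (hsub hx₀) (1 / 2) (hsub hhalf)) fun x hx => hpt x ⟨hx₀.1.trans hx.1, hx.2⟩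
    linarith
  have hFint : ∫ x in (0 : ℝ)..(1 / 2), F x = (∫ x in (0 : ℝ)..(1 / 2), energyDensity γ x)
      + l ^ 2 * (Real.sin Θ * (1 / 2) - Real.cos Θ * γ (1 / 2) 1) := by
    rw [intervalIntegral.integral_add (hED 0 h01 _ (hsub hhalf))
      (((hci 0).const_mul _).sub ((hci 1).const_mul _) |>.const_mul _),
      intervalIntegral.integral_const_mul, intervalIntegral.integral_sub ((hci 0).const_mul _)
      ((hci 1).const_mul _), intervalIntegral.integral_const_mul,
      intervalIntegral.integral_const_mul, hγi, hγi, hγ1]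
  rw [hFint] at hlow
  have hcos : 0 < Real.cos Θ := Real.cos_pos_of_mem_Ioo ⟨by linarith, hΘ1⟩
  have h3 := mul_le_mul_of_nonneg_left (mul_le_mul_of_nonneg_left hy hcos.le) (sq_nonneg l)
  linarith

/-- A symmetric graph above the tip of the elastica with initial angle `Φ < π / 2` has at least the
energy of this elastica. -/
lemma energy_le_of_graph {γ : ℝ → Plane} {h Φ : ℝ} (hγ : IsW22Imm γ)
    (hs : ∀ x ∈ Icc (0 : ℝ) 1, γ (1 - x) = !₂[1 - γ x 0, γ x 1]) (hγ0 : γ 0 = 0) (hh : 0 < h)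
    (hy : h ≤ γ (1 / 2) 1) (hgraph : ∀ x ∈ Icc (0 : ℝ) (1 / 2), 0 < vel γ x 0)
    (hΦ : Φ ∈ Ioo 0 (Real.pi / 2)) (hg : 0 < tipWidth Φ)
    (htip : tipHeight Φ = 2 * h * tipWidth Φ) :
    4 * (rootSineIntegral Φ * tipWidth Φ) ≤ bendingEnergy γ := by
  obtain ⟨Θ, hΘ, hcal⟩ := exists_calibration hγ hs hγ0 hh hy hgraph
  have hS := rootSineIntegral_pos hΦ.1 (by linarith [hΦ.2, Real.pi_pos])
  have hSΘ := rootSineIntegral_pos hΘ.1 (by linarith [hΘ.2, Real.pi_pos])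
  have hkey := rootSineIntegral_mul_le_sq hΦ hΘ
  rw [bendingEnergy_symm hγ hs]
  -- for `Θ = Φ` the multiplier below is the one that makes the calibration exact
  set P := 2 * (rootSineIntegral Φ * tipWidth Φ) with hP
  have hP0 : 0 < P := by positivity
  set c := 1 / 2 * Real.sin Θ - h * Real.cos Θ with hc
  have hPc : P * c ≤ rootSineIntegral Θ ^ 2 := by
    refine le_trans (le_of_eq ?_) hkey
    rw [hP, hc, htip]; ring
  have h1 := hcal (P / rootSineIntegral Θ) (by positivity)
  have h2 : 2 * (P / rootSineIntegral Θ) * rootSineIntegral Θ = 2 * P := by field_simp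
  have h3 : (P / rootSineIntegral Θ) ^ 2 * c ≤ P := by
    rw [div_pow, div_mul_eq_mul_div, div_le_iff₀ (by positivity)]
    nlinarith
  rw [h2] at h1
  linarith

/-! ### Uniqueness up to reparametrization -/

/-- The elastica `elasticaCurve` parametrized over `[0,2]` with constant speed. -/
def elasticaShape (σ X : ℝ) : Plane := ∫ t in (0 : ℝ)..X, elasticaScale σ • dir (elasticaAngle σ t)

lemma elasticaCurve_eq_shape {W W' : ℝ → ℝ} (σ : ℝ) (hW : IsWeight W W') (x : ℝ) :
    elasticaCurve σ W x = elasticaShape σ (weightPrimitive W x) := by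
  have hc : Continuous fun t => elasticaScale σ • dir (elasticaAngle σ t) :=
    continuous_polarVel (w := fun _ => elasticaScale σ) continuous_const
      (continuous_elasticaAngle σ)
  have hd : ∀ t, HasDerivAt (fun t => elasticaShape σ (weightPrimitive W t))
      (elasticaVel σ W t) t := fun t => by
    refine ((hasDerivAt_primitive hc _).scomp t
      (hasDerivAt_weightPrimitive hW.continuous t)).congr_deriv ?_
    rw [smul_smul, mul_comm]; rfl
  rw [elasticaCurve, intervalIntegral.integral_eq_sub_of_hasDerivAt (fun t _ => hd t)
    ((continuous_elasticaVel hW).intervalIntegrable _ _), weightPrimitive_zero]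
  simp [elasticaShape]

lemma arclength_of_vel_eq {γ : ℝ → Plane} {σ : ℝ} {W W' : ℝ → ℝ} (hσ : IsTipSwing σ)
    (hW : IsWeight W W') (hv : ∀ x ∈ Icc (0 : ℝ) 1, vel γ x = elasticaVel σ W x) {x : ℝ}
    (hx : x ∈ Icc (0 : ℝ) 1) : arclength γ x = elasticaScale σ * weightPrimitive W x := by
  rw [arclength, weightPrimitive, ← intervalIntegral.integral_const_mul]
  refine intervalIntegral.integral_congr fun t ht => ?_
  rw [uIcc_of_le hx.1] at ht
  have ht' : t ∈ Icc (0 : ℝ) 1 := ⟨ht.1, ht.2.trans hx.2⟩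
  rw [hv t ht', norm_elasticaVel hσ hW ht']

lemma arclengthParam_eq_shape {γ : ℝ → Plane} {σ : ℝ} {W W' : ℝ → ℝ} (hγ : IsW22Imm γ)
    (hσ : IsTipSwing σ) (hW : IsWeight W W')
    (hv : ∀ x ∈ Icc (0 : ℝ) 1, vel γ x = elasticaVel σ W x)
    (hc : ∀ x ∈ Icc (0 : ℝ) 1, γ x = elasticaCurve σ W x) {s : ℝ}
    (hs : s ∈ Icc 0 (elasticaScale σ * 2)) :
    arclengthParam γ s = elasticaShape σ (s / elasticaScale σ) := by
  have hsc := hσ.scale_pos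
  have h1 := intermediate_value_Icc zero_le_one
    (continuous_weightPrimitive hW.continuous).continuousOn
  rw [weightPrimitive_zero, hW.primitive_one] at h1
  obtain ⟨x, hx, hxs⟩ := h1 (show s / elasticaScale σ ∈ Icc (0 : ℝ) 2 from
    ⟨div_nonneg hs.1 hsc.le, by rw [div_le_iff₀ hsc]; linarith [hs.2]⟩)
  have h2 : arclength γ x = s := by
    rw [arclength_of_vel_eq hσ hW hv hx, hxs]; field_simp
  rw [← hxs, ← elasticaCurve_eq_shape σ hW, ← hc x hx, ← h2, arclengthParam,
    hγ.paramOfArclength_arclength hx]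

lemma IsTipSwing.eq_of_tip_eq {σ τ h : ℝ} (hσ : IsTipSwing σ) (hτ : IsTipSwing τ)
    (h1 : tipHeight (pendulumAngle σ) = 2 * h * tipWidth (pendulumAngle σ))
    (h2 : tipHeight (pendulumAngle τ) = 2 * h * tipWidth (pendulumAngle τ)) : σ = τ :=
  hσ.isSwing.eq_of_angle_eq hτ.isSwing
    (tip_slope_unique hσ.angle_mem hτ.angle_mem hσ.width_pos hτ.width_pos h1 h2)

lemma IsSCF.sameCurve {ψ : ℝ → ℝ} (hψ : IsObstacle ψ) (hcone : IsSymmetricCone ψ)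
    {γ η : ℝ → Plane} (hγ : IsSCF ψ γ) (hη : IsSCF ψ η) : SameCurve γ η := by
  obtain ⟨σ, W, W', hσ, hW, htip, hv, hc⟩ := hγ.exists_eq_elasticaCurve hψ hcone
  obtain ⟨τ, Z, Z', hτ, hZ, htip', hv', hc'⟩ := hη.exists_eq_elasticaCurve hψ hcone
  obtain rfl := hσ.eq_of_tip_eq hτ htip htip'
  have h1 : curveLength γ = elasticaScale σ * 2 := by
    rw [curveLength, arclength_of_vel_eq hσ hW hv ⟨zero_le_one, le_rfl⟩, hW.primitive_one]
  have h2 : curveLength η = elasticaScale σ * 2 := by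
    rw [curveLength, arclength_of_vel_eq hσ hZ hv' ⟨zero_le_one, le_rfl⟩, hZ.primitive_one]
  refine ⟨h1.trans h2.symm, fun s hs => ?_⟩
  rw [h1] at hs
  rw [arclengthParam_eq_shape hγ.mem_sym.1.1 hσ hW hv hc hs,
    arclengthParam_eq_shape hη.mem_sym.1.1 hσ hZ hv' hc' hs]

lemma exists_isSCF {ψ : ℝ → ℝ} (hψ : IsObstacle ψ) (hcone : IsSymmetricCone ψ) :
    ∃ γ, IsSCF ψ γ := by
  obtain ⟨Θ, hΘ, hg, htip⟩ := exists_tip_slope (cone_tip_pos hψ hcone)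
  obtain ⟨σ, hσ, rfl⟩ := exists_isSwing_angle_eq hΘ.1 hΘ.2
  exact ⟨_, isSCF_elasticaCurve hψ hcone ⟨hσ, hΘ.2, hg⟩ htip⟩

/-! ### Stability below and instability above the critical height -/

/-- Below the critical height the tangent angle of the elastica stays away from `π / 2`. Hence the
elastica and all curves close to it are graphs, and the calibration applies to them. -/
lemma IsSCF.isLocalMinimizer {ψ : ℝ → ℝ} (hψ : IsObstacle ψ) (hcone : IsSymmetricCone ψ)
    {γ : ℝ → Plane} (hγ : IsSCF ψ γ) (hlt : ψ (1 / 2) < criticalHeight) :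
    IsLocalMinimizer (admissibleSym ψ) γ := by
  obtain ⟨σ, W, W', hσ, hW, htip, hv, hc⟩ := hγ.exists_eq_elasticaCurve hψ hcone
  have hΦ : pendulumAngle σ < Real.pi / 2 :=
    (lt_criticalHeight_iff hσ.angle_mem hσ.width_pos htip).1 hlt
  have hsub : Icc (0 : ℝ) (1 / 2) ⊆ Icc 0 1 := Icc_subset_Icc_right (by norm_num)
  have hγ22 : IsW22 γ := hγ.mem_sym.1.1.1
  have hpos : ∀ x ∈ Icc (0 : ℝ) (1 / 2), 0 < vel γ x 0 := by
    intro x hx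
    have hX := hW.primitive_mem_half hx
    have hmem : σ * weightPrimitive W x ∈ Icc 0 σ :=
      ⟨mul_nonneg hσ.isSwing.1.le hX.1, by nlinarith [hX.2, hσ.isSwing.1]⟩
    have e1 := hσ.isSwing.angle_nonneg hmem
    have e2 := hσ.isSwing.angle_le hmem
    rw [hv x (hsub hx), elasticaVel, polarVel, elasticaAngle_eq hX.1 hX.2, PiLp.smul_apply,
      dir_zero, smul_eq_mul]
    exact mul_pos (mul_pos hσ.scale_pos (hW.pos x (hsub hx)))
      (Real.cos_pos_of_mem_Ioo ⟨by linarith [Real.pi_pos], by linarith⟩)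
  obtain ⟨x₀, hx₀, hmin⟩ := isCompact_Icc.exists_isMinOn (s := Icc (0 : ℝ) (1 / 2))
    ⟨0, by norm_num⟩ ((hγ22.isW12_vel.apply 0).continuousOn.mono hsub)
  refine ⟨hγ.mem_sym, vel γ x₀ 0 / 2, half_pos (hpos x₀ hx₀), fun η hη hdist => ?_⟩
  rw [bendingEnergy_of_elasticaVel hσ hW hv]
  have htop : η (1 / 2) 0 = 1 / 2 := by
    have h1 := hη.2 (1 / 2) (by norm_num)
    rw [show (1 : ℝ) - 1 / 2 = 1 / 2 by norm_num] at h1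
    have h2 := congrArg (fun v : Plane => v 0) h1
    simp only [Matrix.cons_val_zero] at h2
    linarith
  refine energy_le_of_graph hη.1.1 hη.2 ?_ (cone_tip_pos hψ hcone) ?_ (fun x hx => ?_)
    ⟨hσ.isSwing.angle_pos, hΦ⟩ hσ.width_pos htip
  · rw [hη.1.2.1]; exact plane_eq (by simp) (by simp)
  · have := hη.1.2.2.2 (1 / 2) (by norm_num)
    rwa [htop] at this
  · have h1 := norm_vel_sub_le hη.1.1.1 hγ22 (hsub hx)
    have h2 := abs_apply_le_norm (vel η x - vel γ x) 0
    have h3 : vel γ x₀ 0 ≤ vel γ x 0 := hmin hx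
    have h4 := neg_abs_le ((vel η x - vel γ x) 0)
    rw [PiLp.sub_apply] at h2 h4
    linarith

lemma IsSCF.not_isGlobalMinimizer {ψ : ℝ → ℝ} (hψ : IsObstacle ψ) (hcone : IsSymmetricCone ψ)
    {γ : ℝ → Plane} (hγ : IsSCF ψ γ) : ¬ IsGlobalMinimizer (admissibleSym ψ) γ := by
  obtain ⟨σ, W, W', hσ, hW, htip, hv, hc⟩ := hγ.exists_eq_elasticaCurve hψ hcone
  have hE : 0 < bendingEnergy γ := by
    rw [bendingEnergy_of_elasticaVel hσ hW hv]
    have := rootSineIntegral_pos hσ.isSwing.angle_pos hσ.isSwing.angle_le_pi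
    have := hσ.width_pos
    positivity
  rintro ⟨-, hmin⟩
  obtain ⟨η, hη, hlt⟩ := exists_small_energy hψ hcone hE
  exact absurd (hmin η hη) (not_le.2 hlt)

/-- From the critical height on, slightly longer swings of the pendulum yield admissible curves of
smaller energy. -/
lemma IsSCF.exists_energy_lt {ψ : ℝ → ℝ} (hψ : IsObstacle ψ) (hcone : IsSymmetricCone ψ)
    {γ : ℝ → Plane} (hγ : IsSCF ψ γ) (hle : criticalHeight ≤ ψ (1 / 2)) {ε : ℝ} (hε : 0 < ε) :
    ∃ η ∈ admissibleSym ψ, w22Dist η γ < ε ∧ bendingEnergy η < bendingEnergy γ := by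
  obtain ⟨σ, W, W', hσ, hW, htip, hv, hc⟩ := hγ.exists_eq_elasticaCurve hψ hcone
  have hΦ : Real.pi / 2 ≤ pendulumAngle σ := by
    by_contra hlt
    exact absurd ((lt_criticalHeight_iff hσ.angle_mem hσ.width_pos htip).2 (not_le.1 hlt))
      (not_lt.2 hle)
  obtain ⟨J, hJ⟩ := exists_w22Dist_le hσ hW hc
  obtain ⟨τ₁, hτ₁, hsw, hτπ⟩ := hσ.isSwing.exists_gt hσ.lt_pi
  have hdist : ∀ᶠ τ in 𝓝[>] σ, elasticaModulus σ τ * J < ε := by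
    have h1 := (tendsto_elasticaModulus hσ).mul_const J
    rw [zero_mul] at h1
    exact (h1.mono_left nhdsWithin_le_nhds).eventually_lt_const hε
  have hwidth : ∀ᶠ τ in 𝓝[>] σ, 0 < tipWidth (pendulumAngle τ) := by
    have h1 : Tendsto (fun τ => tipWidth (pendulumAngle τ)) (𝓝 σ)
        (𝓝 (tipWidth (pendulumAngle σ))) :=
      (continuous_tipWidth.comp continuous_pendulumAngle).tendsto σ
    exact (h1.mono_left nhdsWithin_le_nhds).eventually_const_lt hσ.width_pos
  obtain ⟨τ, hd, hg, hστ, hττ⟩ := (hdist.and (hwidth.and (Ioo_mem_nhdsGT hτ₁))).exists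
  have hτ0 : 0 < τ := hσ.isSwing.1.trans hστ
  have hτ : IsTipSwing τ := by
    refine ⟨hsw.mono hτ0 hττ.le, lt_of_le_of_lt (hsw.angle_le ⟨hτ0.le, hττ.le⟩) hτπ, hg⟩
  have hlt : pendulumAngle σ < pendulumAngle τ :=
    hsw.strictMonoOn ⟨hσ.isSwing.1.le, (hστ.trans hττ).le⟩ ⟨hτ0.le, hττ.le⟩ hστ
  have hslope := tip_slope_lt hσ.angle_mem.1 hlt hτ.lt_pi hg
  refine ⟨elasticaCurve τ W, elasticaCurve_mem hψ hcone hτ hW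
    (h := tipHeight (pendulumAngle τ) / (2 * tipWidth (pendulumAngle τ))) ?_ (by field_simp),
    (hJ τ hτ).trans_lt hd, ?_⟩
  · rw [htip] at hslope
    rw [le_div_iff₀ (by positivity)]
    have hw := hσ.width_pos
    by_contra hcon
    nlinarith [mul_lt_mul_of_pos_right (not_le.1 hcon) hw]
  · rw [bendingEnergy_of_elasticaVel hσ hW hv,
      bendingEnergy_of_elasticaVel hτ hW fun x hx => vel_elasticaCurve hW hx]
    linarith [rootSineIntegral_mul_tipWidth_lt hΦ hlt hτ.lt_pi hg]

end ObstacleElastica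

end

theorem theorem1p1 (ψ : ℝ → ℝ) (hψ : IsObstacle ψ) (hcone : IsSymmetricCone ψ) :
    (∃ γ : ℝ → Plane, IsSCF ψ γ) ∧
    (∀ γ η : ℝ → Plane, IsSCF ψ γ → IsSCF ψ η → SameCurve γ η) ∧
    (∀ γ : ℝ → Plane, IsSCF ψ γ →
      (ψ (1 / 2) < criticalHeight →
        IsLocalMinimizer (admissibleSym ψ) γ ∧ ¬ IsGlobalMinimizer (admissibleSym ψ) γ) ∧
      (criticalHeight ≤ ψ (1 / 2) →
        ¬ IsLocalMinimizer (admissibleSym ψ) γ ∧ ¬ IsLocalMinimizer (admissible ψ) γ)) := by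
  refine ⟨exists_isSCF hψ hcone, fun γ η hγ hη => hγ.sameCurve hψ hcone hη, fun γ hγ =>
    ⟨fun h => ⟨hγ.isLocalMinimizer hψ hcone h, hγ.not_isGlobalMinimizer hψ hcone⟩, fun h =>
    ⟨?_, ?_⟩⟩⟩
  · rintro ⟨-, ε, hε, hmin⟩
    obtain ⟨η, hη, hd, hlt⟩ := hγ.exists_energy_lt hψ hcone h hε
    exact absurd (hmin η hη hd) (not_le.2 hlt)
  · rintro ⟨-, ε, hε, hmin⟩
    obtain ⟨η, hη, hd, hlt⟩ := hγ.exists_energy_lt hψ hcone h hε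
    exact absurd (hmin η hη.1 hd) (not_le.2 hlt)
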